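/- **Theorem (assumption-free offline reinforcement learning).** *Setting.* Let $M=(\mathcal S,\mathcal A,P,r,H,d_1)$ be a finite-horizon MDP with finite nonempty $\mathcal S,\mathcal A$ ($S=|\mathcal S|$, $A=|\mathcal A|$), horizon $H\ge1$, transition kernels $P_h$, and random rewards $r_h\in[0,1]$ with mean $r_h(s,a)$ which, given $(s_h,a_h)$, are independent of $s_{h+1}$. For a policy $\pi$ let $V^\pi_h$, $v^\pi$ be its value functions and performance, $d^\pi_h(s,a)$ its marginal state-action probabilities, and let $V^\star_h$, $v^\star=\max_\pi v^\pi$ be the optimal ones. For a vector $V$, $\mathrm{Var}_{P_{s,a}}(r_h+V)$ denotes the conditional variance of $r_h+V(s_{h+1})$ given $(s_h,a_h)=(s,a)$, i.e. the variance of the random reward plus that of $V(s')$, $s'\sim P_h(\cdot|s,a)$. The dataset consists of $n$ independent episodes rolled out from an arbitrary behavior policy $\mu$, and $n_{s_h,a_h}$ is the number of episodes that visit $(s_h,a_h)$ at step $h$. Put $\mathcal C_h=\{(s,a):d^\mu_h(s,a)>0\}$, $\bar d_m=\min\{d^\mu_h(s,a): h\in[H],(s,a)\in\mathcal C_h\}$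 and $\iota=\log(HSA/\delta)$. *Augmented MDP.* $M^\dagger$ has an extra state $s^\dagger_h$ in each layer $h\in\{2,\dots,H+1\}$; it agrees with $M$ on $\mathcal C_h$, while from $s_h^\dagger$ and from every $(s_h,a_h)\in\mathcal S\times\mathcal A\setminus\mathcal C_h$ it moves to $s^\dagger_{h+1}$ with probability $1$ and reward $0$. Its quantities carry a $\dagger$. A policy of $M$ is extended arbitrarily to the states $s^\dagger_h$. $\widehat M^\dagger$ is built in the same way from the plug-in model $\widehat P,\widehat r$ (empirical next-state and reward laws), with $\{n_{s_h,a_h}>0\}$ in place of $\mathcal C_h$. *Algorithm (assumption-free APVI).* Put $\widehat V_{H+1}=0$. For $h=H,\dots,1$ let $$\overline Q_h=\max\Big\{\min\big\{\widehat r^\dagger_h+\widehat P^\dagger_h\widehat V_{h+1}-\Gamma_h,\;H-h+1\big\},\,0\Big\},$$ $$\Gamma_h(s,a)=2\sqrt{\frac{\mathrm{Var}_{\widehat P^\dagger_{s,a}}(\widehat r^\dagger_h+\widehat V_{h+1})\,\iota}{n_{s,a}}}+\frac{14H\iota}{n_{s,a}}\ \text{ if } n_{s,a}\ge1,\qquad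 \Gamma_h(s,a)=0\ \text{ otherwise}$$ (with $n_{s^\dagger_h,a}=0$; the variance is the one-step variance of reward plus $\widehat V_{h+1}$ in $\widehat M^\dagger$). Let $\widehat\pi_h(\cdot|s)$ maximize $\langle\overline Q_h(s,\cdot),p\rangle$ over distributions $p$ on $\mathcal A$, with any tie-breaking, and put $\widehat V_h(s)=\langle\overline Q_h(s,\cdot),\widehat\pi_h(\cdot|s)\rangle$. The output is $\widehat\pi$. *Claim.* There are absolute constants $c_0,C',C''>0$ and $k\in\mathbb N$ such that for every $M$, every $\mu$ and every optimal policy $\pi^\star$ of $M$ the following hold. 1. $d^{\dagger\pi^\star}_h(s,a)\le d^{\pi^\star}_h(s,a)$ for all $h\in[H]$ and $(s,a)\in\mathcal S\times\mathcal A$, and $V^{\dagger\pi^\star}_h(s)\le V^\star_h(s)$ for all $h\in[H+1]$ and $s\in\mathcal S$. For all $h\in[H+1]$, $$d^{\dagger\pi^\star}_h(s^\dagger_h)=\sum_{t=1}^{h-1}\ \sum_{(s_t,a_t)\in\mathcal S\times\mathcal A\setminus\mathcal C_t}d^{\dagger\pi^\star}_t(s_t,a_t)$$ (for $h=1$ both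 sides are $0$). 2. For every $0<\delta<1$ and every $n>c_0\,\iota/\bar d_m$, with probability at least $1-\delta$ the set of pairs visited by the data at step $h$ equals $\mathcal C_h$ for every $h\in[H]$ (so $M^\dagger$ may equally be defined through $n_{s_h,a_h}>0$), and every output $\widehat\pi$ of the algorithm satisfies $$v^\star-v^{\widehat\pi}\le\sum_{h=2}^{H+1}d^{\dagger\pi^\star}_h(s^\dagger_h)+C'\sum_{h=1}^H\sum_{(s,a)\in\mathcal C_h}d^{\dagger\pi^\star}_h(s,a)\sqrt{\frac{\mathrm{Var}_{P^\dagger_{s,a}}(r^\dagger_h+V^{\dagger\pi^\star}_{h+1})\,\iota}{n\,d^\mu_h(s,a)}}+C''\,\frac{H^3\log^k(nHSA/\delta)}{n\,\bar d_m}.$$ -/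

import Mathlib

open MeasureTheory
open scoped unitInterval

namespace OfflineRL

noncomputable section

/-! Conventions.  The horizon is `H`; the time steps `1, …, H` are the elements `0, …, H - 1` of
`Fin H`, and the layers `1, …, H + 1` of states (and of value functions) are the elements of
`Fin (H + 1)`: step `h : Fin H` leads from layer `h.castSucc` to layer `h.succ`.
Realized rewards are random and lie in the unit interval `I`; given the current state and action,
the reward and the next state are independent. -/

/-- The transition kernels and the reward laws of a tabular time-inhomogeneous decision process. -/
structure Model (S A : Type*) [Fintype S] (H : ℕ) where
  trans : Fin H → S → A → S → ℝ
  trans_mem : ∀ h s a, trans h s a ∈ stdSimplex ℝ S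
  rewardLaw : Fin H → S → A → Measure I
  rewardLaw_prob : ∀ h s a, IsProbabilityMeasure (rewardLaw h s a)

/-- A finite-horizon MDP: a model with an initial state distribution. -/
structure MDP (S A : Type*) [Fintype S] (H : ℕ) extends Model S A H where
  init : S → ℝ
  init_mem : init ∈ stdSimplex ℝ S

/-- A (randomized, time-dependent) policy; `prob h s a` is the probability of `a` in `s`. -/
structure Policy (S A : Type*) [Fintype A] (H : ℕ) where
  prob : Fin H → S → A → ℝ
  prob_mem : ∀ h s, prob h s ∈ stdSimplex ℝ A

section Basic

variable {S A : Type*} [Fintype S] [Fintype A] {H : ℕ}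

/-- The mean reward `r_h(s, a)`. -/
def Model.meanReward (M : Model S A H) (h : Fin H) (s : S) (a : A) : ℝ :=
  ∫ x : I, (x : ℝ) ∂(M.rewardLaw h s a)

/-- `(P_h V)(s, a)`. -/
def Model.transMean (M : Model S A H) (h : Fin H) (s : S) (a : A) (V : S → ℝ) : ℝ :=
  ∑ s', M.trans h s a s' * V s'

/-- `Var_{P_{s,a}}(r_h + V)`: the variance of (random reward + `V` at the random next state), given
`(s, a)` at step `h`.  The two summands are independent, so it is the sum of their variances. -/
def Model.stepVar (M : Model S A H) (h : Fin H) (s : S) (a : A) (V : S → ℝ) : ℝ :=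
  ProbabilityTheory.variance (fun x : I => (x : ℝ)) (M.rewardLaw h s a) +
    ∑ s', M.trans h s a s' * (V s' - M.transMean h s a V) ^ 2

/-- The value function `V^π_h(s)`, `h ∈ {1, …, H + 1}`, with `V^π_{H+1} = 0`. -/
def Model.value (M : Model S A H) (π : Policy S A H) (h : Fin (H + 1)) : S → ℝ :=
  Fin.reverseInduction (motive := fun _ => S → ℝ) (fun _ => 0)
    (fun h V s => ∑ a, π.prob h s a * (M.meanReward h s a + M.transMean h s a V)) h

/-- The optimal value function `V^⋆_h(s)`, with `V^⋆_{H+1} = 0`; the supremum is the maximum over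
the finite set of actions. -/
def Model.optValue (M : Model S A H) (h : Fin (H + 1)) : S → ℝ :=
  Fin.reverseInduction (motive := fun _ => S → ℝ) (fun _ => 0)
    (fun h V s => ⨆ a, (M.meanReward h s a + M.transMean h s a V)) h

/-- The performance `v^π`. -/
def MDP.perf (M : MDP S A H) (π : Policy S A H) : ℝ :=
  ∑ s, M.init s * M.value π 0 s

/-- The optimal performance `v^⋆`. -/
def MDP.optPerf (M : MDP S A H) : ℝ := ⨆ π : Policy S A H, M.perf π

/-- `π` is an optimal policy. -/
def MDP.IsOptimal (M : MDP S A H) (π : Policy S A H) : Prop :=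
  ∀ π' : Policy S A H, M.perf π' ≤ M.perf π

/-- The probability that the state in layer `h` is `s` under the policy `π`. -/
def MDP.stateOcc (M : MDP S A H) (π : Policy S A H) (h : Fin (H + 1)) : S → ℝ :=
  Fin.induction (motive := fun _ => S → ℝ) M.init
    (fun h d s' => ∑ s, ∑ a, d s * π.prob h s a * M.trans h s a s') h

/-- The marginal state-action probability `d^π_h(s, a)`. -/
def MDP.occ (M : MDP S A H) (π : Policy S A H) (h : Fin H) (s : S) (a : A) : ℝ :=
  M.stateOcc π h.castSucc s * π.prob h s a

/-- The trackable set `C_h` of the behavior policy `μ`. -/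
def MDP.covered (M : MDP S A H) (μ : Policy S A H) (h : Fin H) : Finset (S × A) :=
  Finset.univ.filter fun x => 0 < M.occ μ h x.1 x.2

/-- The least positive state-action probability of the behavior policy. -/
def MDP.minOcc (M : MDP S A H) (μ : Policy S A H) : ℝ :=
  sInf {p : ℝ | 0 < p ∧ ∃ h s a, p = M.occ μ h s a}

/-- `ι = log (H S A / δ)`. -/
def iota (S A : Type*) [Fintype S] [Fintype A] (H : ℕ) (δ : ℝ) : ℝ :=
  Real.log ((H : ℝ) * Fintype.card S * Fintype.card A / δ)

/-- The restriction to the original states of a policy on the augmented state space. -/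
def Policy.restrict (π : Policy (Option S) A H) : Policy S A H where
  prob h s := π.prob h (some s)
  prob_mem h s := π.prob_mem h (some s)

end Basic

section Augment

variable {S A : Type*} [Fintype S] [DecidableEq S] [DecidableEq A] {H : ℕ}

/-- The pessimistic augmentation of a model with respect to the sets `K h` of known state-action
pairs.  In each layer `none` is the extra state `s†`: from `s†` and from every unknown pair the
process moves to `s†` of the next layer, with reward `0`. -/
def Model.augment (M : Model S A H) (K : Fin H → Finset (S × A)) : Model (Option S) A H where
  trans h s a := s.elim (Pi.single none 1) fun s =>
    if (s, a) ∈ K h then fun s' => s'.elim 0 (M.trans h s a) else Pi.single none 1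
  trans_mem h s a := by
    rcases s with _ | s
    · exact single_mem_stdSimplex ℝ _
    · by_cases hs : (s, a) ∈ K h
      · simp only [Option.elim_some, hs, if_true]
        refine ⟨?_, ?_⟩
        · rintro (_ | s')
          · simp
          · exact (M.trans_mem h s a).1 s'
        · rw [Fintype.sum_option]
          simpa using (M.trans_mem h s a).2
      · simp only [Option.elim_some, hs, if_false]
        exact single_mem_stdSimplex ℝ _
  rewardLaw h s a := s.elim (Measure.dirac 0) fun s =>
    if (s, a) ∈ K h then M.rewardLaw h s a else Measure.dirac 0
  rewardLaw_prob h s a := by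
    rcases s with _ | s
    · exact Measure.dirac.isProbabilityMeasure
    · by_cases hs : (s, a) ∈ K h
      · simpa [hs] using M.rewardLaw_prob h s a
      · simpa [hs] using (Measure.dirac.isProbabilityMeasure : IsProbabilityMeasure _)

/-- The pessimistic augmented MDP; the process does not start in `s†`. -/
def MDP.augment (M : MDP S A H) (K : Fin H → Finset (S × A)) : MDP (Option S) A H where
  toModel := M.toModel.augment K
  init s := s.elim 0 M.init
  init_mem := by
    refine ⟨?_, ?_⟩
    · rintro (_ | s)
      · simp
      · exact M.init_mem.1 s
    · rw [Fintype.sum_option]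
      simpa using M.init_mem.2

/-- The pessimistic augmented MDP `M†` with respect to the trackable sets of `μ`. -/
def MDP.dagger [Fintype A] (M : MDP S A H) (μ : Policy S A H) : MDP (Option S) A H :=
  M.augment (M.covered μ)

end Augment

section Data

/-- One episode: the states `s_1, …, s_{H+1}`, the actions `a_1, …, a_H` and the realized rewards
`r_1, …, r_H`. -/
abbrev Episode (S A : Type*) (H : ℕ) : Type _ := (Fin (H + 1) → S) × (Fin H → A) × (Fin H → I)

variable {S A : Type*} [Fintype S] [Fintype A] {H n : ℕ}

/-- The law of one episode rolled out from the policy `μ`. -/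
def MDP.episodeLaw [MeasurableSpace S] [MeasurableSpace A] (M : MDP S A H) (μ : Policy S A H) :
    Measure (Episode S A H) :=
  ∑ x : Fin (H + 1) → S, ∑ y : Fin H → A,
    ENNReal.ofReal (M.init (x 0) *
      ∏ h : Fin H, μ.prob h (x h.castSucc) (y h) * M.trans h (x h.castSucc) (y h) (x h.succ)) •
    (Measure.dirac x).prod ((Measure.dirac y).prod
      (Measure.pi fun h : Fin H => M.rewardLaw h (x h.castSucc) (y h)))

/-- The law of a dataset of `n` independent episodes rolled out from `μ`. -/
def MDP.dataLaw [MeasurableSpace S] [MeasurableSpace A] (M : MDP S A H) (μ : Policy S A H)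
    (n : ℕ) : Measure (Fin n → Episode S A H) :=
  Measure.pi fun _ => M.episodeLaw μ

variable [DecidableEq S] [DecidableEq A]

/-- The episodes that visit `(s, a)` at step `h`. -/
def visits (D : Fin n → Episode S A H) (h : Fin H) (s : S) (a : A) : Finset (Fin n) :=
  Finset.univ.filter fun τ => (D τ).1 h.castSucc = s ∧ (D τ).2.1 h = a

/-- The visitation count `n_{s_h,a_h}`. -/
def count (D : Fin n → Episode S A H) (h : Fin H) (s : S) (a : A) : ℕ := (visits D h s a).card

/-- The set of state-action pairs that the dataset visits at step `h`. -/
def visited (D : Fin n → Episode S A H) (h : Fin H) : Finset (S × A) :=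
  Finset.univ.filter fun x => 0 < count D h x.1 x.2

/-- The plug-in model.  At a pair with `n_{s_h,a_h} > 0` the next-state law is the vector of
empirical frequencies and the reward law is the empirical law of the observed rewards (its mean is
the average observed reward); at the other pairs the next state is uniform and the reward is `0`. -/
def empModel [Nonempty S] (D : Fin n → Episode S A H) : Model S A H where
  trans h s a s' :=
    if 0 < count D h s a then
      (((visits D h s a).filter fun τ => (D τ).1 h.succ = s').card : ℝ) / count D h s a
    else 1 / Fintype.card S
  trans_mem h s a := by
    by_cases hc : 0 < count D h s a
    · simp only [hc, if_true]
      refine ⟨fun s' => by positivity, ?_⟩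
      rw [← Finset.sum_div, ← Nat.cast_sum,
        ← Finset.card_eq_sum_card_fiberwise (fun _ _ => Finset.mem_coe.2 (Finset.mem_univ _))]
      exact div_self (by exact_mod_cast hc.ne')
    · simp only [hc, if_false]
      refine ⟨fun s' => by positivity, ?_⟩
      simp
  rewardLaw h s a :=
    if 0 < count D h s a then
      (count D h s a : ENNReal)⁻¹ • ∑ τ ∈ visits D h s a, Measure.dirac ((D τ).2.2 h)
    else Measure.dirac 0
  rewardLaw_prob h s a := by
    by_cases hc : 0 < count D h s a
    · simp only [hc, if_true]
      refine ⟨?_⟩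
      simp only [Measure.smul_apply, Measure.finsetSum_apply, measure_univ, smul_eq_mul,
        Finset.sum_const, nsmul_eq_mul, mul_one]
      exact ENNReal.inv_mul_cancel (by exact_mod_cast hc.ne') (ENNReal.natCast_ne_top _)
    · simp only [hc, if_false]
      exact Measure.dirac.isProbabilityMeasure

/-- The empirical pessimistic augmented model: the augmentation of the plug-in model with respect
to the visited pairs. -/
def empDagger [Nonempty S] (D : Fin n → Episode S A H) : Model (Option S) A H :=
  (empModel D).augment (visited D)

/-- Visitation counts on the augmented state space; `s†` is never visited. -/
def augCount (D : Fin n → Episode S A H) (h : Fin H) (s : Option S) (a : A) : ℕ :=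
  s.elim 0 fun s => count D h s a

/-- The Bernstein penalty `Γ_h(s, a)` of assumption-free APVI (`C₁ = 2`, `C₂ = 14`), for the current
estimate `V` of the value function of the next layer. -/
def penalty [Nonempty S] (D : Fin n → Episode S A H) (δ : ℝ) (h : Fin H) (V : Option S → ℝ)
    (s : Option S) (a : A) : ℝ :=
  if 1 ≤ augCount D h s a then
    2 * Real.sqrt ((empDagger D).stepVar h s a V * iota S A H δ / augCount D h s a) +
      14 * H * iota S A H δ / augCount D h s a
  else 0

/-- The pessimistic update `Q̄_h(s, a) = min {Q̂_h - Γ_h, H - h + 1}⁺`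
(the step with number `h` in `{1, …, H}` is `h - 1` as an element of `Fin H`). -/
def qBar [Nonempty S] (D : Fin n → Episode S A H) (δ : ℝ) (h : Fin H) (V : Option S → ℝ)
    (s : Option S) (a : A) : ℝ :=
  max (min ((empDagger D).meanReward h s a + (empDagger D).transMean h s a V -
    penalty D δ h V s a) ((H : ℝ) - (h : ℕ))) 0

/-- `πhat` is an output of assumption-free APVI on the dataset `D` with failure probability `δ`
(with any way of breaking ties in the argmax): in a backward pass from `V̂_{H+1} = 0`,
`πhat_h(· | s)` maximizes `⟨Q̄_h(s, ·), p⟩` over the distributions `p` on actions, and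
`V̂_h(s) = ⟨Q̄_h(s, ·), πhat_h(· | s)⟩`. -/
def IsAPVIOutput [Nonempty S] (D : Fin n → Episode S A H) (δ : ℝ)
    (πhat : Policy (Option S) A H) : Prop :=
  ∃ V : Fin (H + 1) → Option S → ℝ,
    (∀ s, V (Fin.last H) s = 0) ∧
    ∀ (h : Fin H) (s : Option S),
      (∀ p ∈ stdSimplex ℝ A,
        ∑ a, qBar D δ h (V h.succ) s a * p a ≤
          ∑ a, qBar D δ h (V h.succ) s a * πhat.prob h s a) ∧
      V h.castSucc s = ∑ a, qBar D δ h (V h.succ) s a * πhat.prob h s a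

end Data

end

end OfflineRL

open OfflineRL

/-! The obstacle to a textbook Bernstein analysis is that the estimate of the next layer's value is
computed from the same episodes that estimate the transitions at step `h`. A uniform bound over all
value functions would cost a factor `S`. Algorithmic stability is used instead.

Put `m = n * M.minOcc μ / 2`. In the algorithm, replace every count by its maximum with `m`, and the
visited sets by the trackable sets (`padValue`). On a likely event this changes nothing
(`IsAPVIOutput.padValue_eq`). The padded estimates, however, are defined for all data, and replacing
one episode moves them by at most `β` of order `H² (1 + ι) / m` (`abs_padValue_update_sub_le`). For
a random function that is `β`-stable and bounded by `B`, bounded differences alone control the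
empirical mean minus the true mean over `N` samples only by `√N β + B / √N`. A dyadic decomposition
of the sample improves this to `β + B / √N` up to logarithms (`measureReal_stable_sum_le`).
Conditioning on which episodes visit `(s, a)` makes this applicable (`MDP.dataLaw_le_of_cond`).

Upper side. Let `V⋆` be the deterministic optimal value of the augmented model. Bernstein at `V⋆`
and the near nonexpansiveness of the update give the crude bound `|padValue - V⋆| ≤ ε = 32 H² √(ι /
m)` (`GoodData.abs_padValue_sub_le`). Stability applied to the difference clipped at `ε` then costs
only `O(H² L³ / m)`, where `L = log (n H S A / δ)`. The remaining fluctuation, that of `V⋆`, has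
leading term `2 √(Var ι / N)`, which the penalty cancels. Hence the estimates are pessimistic up to
`O(H² L³ / m)` per step (`GoodPair.padQ_le`, `padValue_le_value_add`).

Lower side. The deterministic function `lowerValue` is the value of `π⋆` in the augmented model with
a Bernstein bonus subtracted in each step; the bonus involves expected, not observed, visit counts.
The penalized update is monotone up to `O(H ι / N)`, because raising `V` raises its empirical
variance by at most `2 H` times the increase of its empirical mean. Concentration at the fixed
function `lowerValue` therefore yields `lowerValue ≤ padValue` (`GoodPair.le_padQ`,
`GoodData.lowerValue_le_padValue`). Summing the bonuses along `π⋆` gives the main term of the bound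
(`MDP.perf_le_lowerValue`).

Augmentation. For every policy the augmented performance is at most the true one, and it falls short
by at most the total mass of the extra states (`MDP.perf_restrict_ge`, `MDP.perf_restrict_le`).
Chaining these comparisons proves `MDP.optPerf_sub_perf_le`. The degenerate cases `H S A < 2` and `m
< 4 H² ι` are trivial: in the first there is only one policy, in the second the residual term
exceeds `H`. -/

set_option linter.unusedSectionVars false

namespace OfflineRL

/-! ### McDiarmid's and Hoeffding's inequalities on product spaces, by resampling coordinates. -/

noncomputable section Concentration

open ProbabilityTheory

variable {J Ω : Type*} [Fintype J] [DecidableEq J] [MeasurableSpace Ω] (ν : J → Measure Ω)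
  [∀ i, IsProbabilityMeasure (ν i)]

lemma measurable_piecewise_prod (b : Finset J) :
    Measurable (fun p : (J → Ω) × (J → Ω) => b.piecewise p.2 p.1) := by
  refine measurable_pi_lambda _ fun i => ?_
  by_cases hi : i ∈ b
  · simp only [Finset.piecewise, hi, if_true]
    exact (measurable_pi_apply i).comp measurable_snd
  · simp only [Finset.piecewise, hi, if_false]
    exact (measurable_pi_apply i).comp measurable_fst

/-- Resampling the coordinates in `b` preserves a product measure. -/
lemma measurePreserving_piecewise (b : Finset J) :
    MeasurePreserving (fun p : (J → Ω) × (J → Ω) => b.piecewise p.2 p.1)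
      ((Measure.pi ν).prod (Measure.pi ν)) (Measure.pi ν) := by
  refine ⟨measurable_piecewise_prod b, ?_⟩
  symm
  refine Measure.pi_eq fun s hs => ?_
  rw [Measure.map_apply (measurable_piecewise_prod b) (MeasurableSet.univ_pi hs)]
  have : (fun p : (J → Ω) × (J → Ω) => b.piecewise p.2 p.1) ⁻¹' (Set.univ.pi s) =
      (Set.univ.pi fun i => if i ∈ b then Set.univ else s i) ×ˢ
        (Set.univ.pi fun i => if i ∈ b then s i else Set.univ) := by
    ext ⟨z, w⟩
    simp only [Set.mem_preimage, Set.mem_pi, Set.mem_univ, true_implies, Set.mem_prod]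
    constructor
    · intro h
      refine ⟨fun i => ?_, fun i => ?_⟩ <;> have := h i <;> by_cases hi : i ∈ b <;>
        simp_all [Finset.piecewise]
    · rintro ⟨h1, h2⟩ i
      have h1 := h1 i
      have h2 := h2 i
      by_cases hi : i ∈ b <;> simp_all [Finset.piecewise]
  rw [this, Measure.prod_prod, Measure.pi_pi, Measure.pi_pi, ← Finset.prod_mul_distrib]
  refine Finset.prod_congr rfl fun i _ => ?_
  by_cases hi : i ∈ b <;> simp [hi]

/-- Integrating out the coordinates in `b`. -/
def avg (b : Finset J) (f : (J → Ω) → ℝ) (z : J → Ω) : ℝ :=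
  ∫ w, f (b.piecewise w z) ∂(Measure.pi ν)

variable {ν}

lemma measurable_avg (b : Finset J) {f : (J → Ω) → ℝ} (hf : Measurable f) :
    Measurable (avg ν b f) := by
  have h : StronglyMeasurable (fun p : (J → Ω) × (J → Ω) => f (b.piecewise p.2 p.1)) :=
    (hf.comp (measurable_piecewise_prod b)).stronglyMeasurable
  exact h.integral_prod_right.measurable

lemma integrable_of_abs_le {X : Type*} [MeasurableSpace X] {P : Measure X} [IsFiniteMeasure P]
    {f : X → ℝ} (hf : Measurable f) {B : ℝ} (hB : ∀ x, |f x| ≤ B) : Integrable f P :=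
  Integrable.of_bound hf.aestronglyMeasurable B (ae_of_all _ fun x => by
    simpa [Real.norm_eq_abs] using hB x)

lemma abs_integral_le_of_abs_le {X : Type*} [MeasurableSpace X] {P : Measure X}
    [IsProbabilityMeasure P] {f : X → ℝ} {B : ℝ} (hB : ∀ x, |f x| ≤ B) : |∫ x, f x ∂P| ≤ B := by
  have := norm_integral_le_of_norm_le_const (μ := P) (f := f) (C := B)
    (ae_of_all _ fun x => by simpa [Real.norm_eq_abs] using hB x)
  simpa [Real.norm_eq_abs] using this

lemma measurable_piecewise_left (b : Finset J) (z : J → Ω) :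
    Measurable (fun w : J → Ω => b.piecewise w z) :=
  (measurable_piecewise_prod b).comp (measurable_const.prodMk measurable_id)

lemma abs_avg_le (b : Finset J) {f : (J → Ω) → ℝ} {B : ℝ} (hB : ∀ x, |f x| ≤ B) (z : J → Ω) :
    |avg ν b f z| ≤ B :=
  abs_integral_le_of_abs_le fun _ => hB _

lemma avg_piecewise (b : Finset J) (f : (J → Ω) → ℝ) (w z : J → Ω) :
    avg ν b f (b.piecewise w z) = avg ν b f z := by
  unfold avg
  congr 1
  ext w'
  congr 1
  ext i
  by_cases hi : i ∈ b <;> simp [hi]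

lemma avg_congr {b : Finset J} (f : (J → Ω) → ℝ) {z z' : J → Ω} (h : ∀ i ∉ b, z i = z' i) :
    avg ν b f z = avg ν b f z' := by
  unfold avg
  congr 1
  ext w'
  congr 1
  ext i
  by_cases hi : i ∈ b <;> simp [hi, h]

lemma avg_empty (f : (J → Ω) → ℝ) (z : J → Ω) : avg ν ∅ f z = f z := by
  simp [avg]

lemma integral_piecewise_piecewise (b : Finset J) {f : (J → Ω) → ℝ} (hf : Measurable f) {B : ℝ}
    (hB : ∀ x, |f x| ≤ B) :
    ∫ z, ∫ w, f (b.piecewise w z) ∂(Measure.pi ν) ∂(Measure.pi ν) = ∫ z, f z ∂(Measure.pi ν) := by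
  have h := measurePreserving_piecewise ν b
  rw [← integral_prod (fun p : (J → Ω) × (J → Ω) => f (b.piecewise p.2 p.1))
    (integrable_of_abs_le (hf.comp h.measurable) fun x => hB _)]
  conv_rhs => rw [← h.map_eq]
  rw [integral_map h.measurable.aemeasurable hf.aestronglyMeasurable]

/-- Resampling the coordinates in `b₂` of the independent copy does not change its law, so the two
averages merge. -/
lemma avg_avg {b₁ b₂ : Finset J} {f : (J → Ω) → ℝ} (hf : Measurable f)
    {B : ℝ} (hB : ∀ x, |f x| ≤ B) (z : J → Ω) :
    avg ν b₁ (avg ν b₂ f) z = avg ν (b₁ ∪ b₂) f z := by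
  have h := integral_piecewise_piecewise (ν := ν) b₂
    (hf.comp (measurable_piecewise_left (b₁ ∪ b₂) z)) (fun x => hB _)
  simp only [Function.comp_def] at h
  unfold avg
  rw [← h]
  congr 1
  ext w
  congr 1
  ext w'
  congr 1
  ext i
  by_cases h2 : i ∈ b₂
  · simp [h2]
  · by_cases h1 : i ∈ b₁ <;> simp [h1, h2]

/-- If `i ∈ b` the change is overwritten before `f` sees it; otherwise it commutes with the
resampling. Bounded differences thus survive averaging. -/
lemma abs_avg_update_sub_le {b : Finset J} {f : (J → Ω) → ℝ} (hf : Measurable f)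
    {B : ℝ} (hB : ∀ x, |f x| ≤ B) {i : J} {β : ℝ}
    (hβ : ∀ z w, |f (Function.update z i w) - f z| ≤ β) (z : J → Ω) (w : Ω) :
    |avg ν b f (Function.update z i w) - avg ν b f z| ≤ β := by
  unfold avg
  have hint : ∀ z', Integrable (fun w' => f (b.piecewise w' z')) (Measure.pi ν) := fun z' =>
    integrable_of_abs_le (hf.comp (measurable_piecewise_left b z')) fun x => hB _
  rw [← integral_sub (hint _) (hint _)]
  refine abs_integral_le_of_abs_le fun w' => ?_
  by_cases hi : i ∈ b
  · have : b.piecewise w' (Function.update z i w) = b.piecewise w' z := by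
      ext j
      by_cases hj : j ∈ b
      · simp [hj]
      · have : j ≠ i := fun h => hj (h ▸ hi)
        simp [hj, this]
    rw [this, sub_self, abs_zero]
    exact (abs_nonneg _).trans (hβ z w)
  · have : b.piecewise w' (Function.update z i w) =
        Function.update (b.piecewise w' z) i w := by
      ext j
      by_cases hj : j ∈ b
      · have : j ≠ i := fun h => hi (h ▸ hj)
        simp [hj, this]
      · by_cases hji : j = i
        · subst hji; simp [hj]
        · simp [hj, hji]
    rw [this]
    exact hβ _ _

/-- The exponential-moment form of McDiarmid's inequality, for the fluctuation caused by the
coordinates in `b`. -/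
lemma integral_exp_sub_avg_le (l : ℝ) {β : ℝ} (hβ0 : 0 ≤ β) {B : ℝ} (b : Finset J) :
    ∀ {f : (J → Ω) → ℝ}, Measurable f → (∀ x, |f x| ≤ B) →
      (∀ i ∈ b, ∀ z w, |f (Function.update z i w) - f z| ≤ β) →
      ∫ z, Real.exp (l * (f z - avg ν b f z)) ∂(Measure.pi ν) ≤
        Real.exp (b.card * β ^ 2 * l ^ 2 / 2) := by
  induction b using Finset.induction_on with
  | empty =>
    intro f hf hB hβ
    simp [avg_empty]
  | insert i b hi ih =>
    intro f hf hB hβ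
    -- One martingale step: `f - f₁` has mean zero when only coordinate `i` is resampled, while `f₁
    -- - avg ν b f₁` does not involve coordinate `i` and falls under the induction hypothesis.
    set f₁ := avg ν {i} f with hf₁
    have mf₁ : Measurable f₁ := measurable_avg _ hf
    have bf₁ : ∀ x, |f₁ x| ≤ B := abs_avg_le _ hB
    have hins : ∀ z, avg ν (insert i b) f z = avg ν b f₁ z := fun z => by
      rw [hf₁, avg_avg hf hB, Finset.union_comm, ← Finset.insert_eq]
    have hinv : ∀ z w, avg ν b f₁ (({i} : Finset J).piecewise w z) = avg ν b f₁ z := by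
      intro z w
      rw [← hins, ← hins]
      refine avg_congr _ fun j hj => ?_
      have : j ∉ ({i} : Finset J) := fun h => hj (by simp_all)
      simp only [Finset.piecewise_eq_of_notMem _ _ _ this]
    have hBB : ∀ z, |f z - avg ν (insert i b) f z| ≤ 2 * B := fun z => by
      have h1 := hB z
      have h2 := abs_avg_le (ν := ν) (insert i b) hB z
      have := abs_sub (f z) (avg ν (insert i b) f z)
      linarith
    have hexpB : ∀ {y : ℝ}, |y| ≤ 2 * B → |Real.exp (l * y)| ≤ Real.exp (|l| * (2 * B)) := by
      intro y hy
      rw [abs_of_pos (Real.exp_pos _)]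
      refine Real.exp_le_exp.2 ((le_abs_self _).trans ?_)
      rw [abs_mul]
      exact mul_le_mul_of_nonneg_left hy (abs_nonneg _)
    have mF : Measurable fun z => Real.exp (l * (f z - avg ν (insert i b) f z)) :=
      ((hf.sub (measurable_avg _ hf)).const_mul l).exp
    rw [← integral_piecewise_piecewise {i} mF (fun z => hexpB (hBB z))]
    have key : ∀ z, ∫ w, Real.exp (l * (f (({i} : Finset J).piecewise w z) -
        avg ν (insert i b) f (({i} : Finset J).piecewise w z))) ∂(Measure.pi ν) ≤
        Real.exp (β ^ 2 * l ^ 2 / 2) * Real.exp (l * (f₁ z - avg ν b f₁ z)) := by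
      intro z
      have e : ∀ w, Real.exp (l * (f (({i} : Finset J).piecewise w z) -
          avg ν (insert i b) f (({i} : Finset J).piecewise w z))) =
          Real.exp (l * (f (({i} : Finset J).piecewise w z) - f₁ z)) *
            Real.exp (l * (f₁ z - avg ν b f₁ z)) := by
        intro w
        rw [hins, hinv, ← Real.exp_add]
        congr 1
        ring
      simp only [e]
      rw [integral_mul_const]
      refine mul_le_mul_of_nonneg_right ?_ (Real.exp_pos _).le
      have hm : Measurable fun w : J → Ω => f (({i} : Finset J).piecewise w z) :=
        hf.comp (measurable_piecewise_left _ z)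
      -- With only coordinate `i` resampled, `f` stays in an interval of length `2 β` around `f z`,
      -- which gives the variance proxy `β ^ 2`.
      have hsub := hasSubgaussianMGF_of_mem_Icc (μ := Measure.pi ν) (a := f z - β) (b := f z + β)
        hm.aemeasurable (ae_of_all _ fun w => by
          have := hβ i (Finset.mem_insert_self _ _) z (w i)
          rw [← Finset.piecewise_singleton] at this
          rw [abs_le] at this
          constructor <;> linarith [this.1, this.2])
      have := hsub.mgf_le l
      have hc : (((‖f z + β - (f z - β)‖₊ / 2) ^ 2 : NNReal) : ℝ) = β ^ 2 := by
        push_cast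
        rw [Real.norm_eq_abs, show f z + β - (f z - β) = 2 * β by ring, abs_mul,
          abs_of_nonneg hβ0]
        norm_num
      rw [hc] at this
      exact this
    have m1 : Measurable fun z => Real.exp (l * (f₁ z - avg ν b f₁ z)) :=
      ((mf₁.sub (measurable_avg _ mf₁)).const_mul l).exp
    have hB1 : ∀ z, |f₁ z - avg ν b f₁ z| ≤ 2 * B := fun z => by
      have h1 := bf₁ z
      have h2 := abs_avg_le (ν := ν) b bf₁ z
      have := abs_sub (f₁ z) (avg ν b f₁ z)
      linarith
    have hi1 : Integrable (fun z => Real.exp (l * (f₁ z - avg ν b f₁ z))) (Measure.pi ν) :=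
      integrable_of_abs_le m1 fun z => hexpB (hB1 z)
    calc _ ≤ ∫ z, Real.exp (β ^ 2 * l ^ 2 / 2) * Real.exp (l * (f₁ z - avg ν b f₁ z))
            ∂(Measure.pi ν) := by
          refine integral_mono ?_ (hi1.const_mul _) key
          refine integrable_of_abs_le (measurable_avg {i} mF) (B := Real.exp (|l| * (2 * B))) ?_
          exact abs_avg_le _ fun z => hexpB (hBB z)
      _ ≤ Real.exp (β ^ 2 * l ^ 2 / 2) * Real.exp (b.card * β ^ 2 * l ^ 2 / 2) := by
          rw [integral_const_mul]
          refine mul_le_mul_of_nonneg_left (ih mf₁ bf₁ fun j hj z w => ?_) (Real.exp_pos _).le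
          exact abs_avg_update_sub_le hf hB (hβ j (Finset.mem_insert_of_mem hj)) z w
      _ = _ := by
          rw [← Real.exp_add, Finset.card_insert_of_notMem hi]
          congr 1
          push_cast
          ring

/-- A Chernoff bound for a sub-Gaussian random variable with an explicit scale. -/
lemma measureReal_sqrt_le {X : Type*} [MeasurableSpace X] {P : Measure X} [IsProbabilityMeasure P]
    {F : X → ℝ} {v x : ℝ} (hv : 0 < v) (hx : 0 ≤ x)
    (hint : ∀ l, Integrable (fun z => Real.exp (l * F z)) P)
    (hmgf : ∀ l, ∫ z, Real.exp (l * F z) ∂P ≤ Real.exp (v * l ^ 2 / 2)) :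
    P.real {z | Real.sqrt (2 * v * x) ≤ F z} ≤ Real.exp (-x) := by
  have hs : HasSubgaussianMGF F v.toNNReal P :=
    ⟨hint, fun l => by rw [Real.coe_toNNReal _ hv.le]; exact hmgf l⟩
  refine (hs.measure_ge_le (Real.sqrt_nonneg _)).trans (Real.exp_le_exp.2 ?_)
  rw [Real.sq_sqrt (by positivity), Real.coe_toNNReal _ hv.le]
  field_simp
  rfl

lemma measureReal_sqrt_le_abs {X : Type*} [MeasurableSpace X] {P : Measure X}
    [IsProbabilityMeasure P] {F : X → ℝ} {v x : ℝ} (hv : 0 < v) (hx : 0 ≤ x)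
    (hint : ∀ l, Integrable (fun z => Real.exp (l * F z)) P)
    (hmgf : ∀ l, ∫ z, Real.exp (l * F z) ∂P ≤ Real.exp (v * l ^ 2 / 2)) :
    P.real {z | Real.sqrt (2 * v * x) ≤ |F z|} ≤ 2 * Real.exp (-x) := by
  have h1 := measureReal_sqrt_le hv hx hint hmgf
  have h2 := measureReal_sqrt_le (F := fun z => - F z) hv hx
    (fun l => by simpa using hint (-l)) (fun l => by simpa using hmgf (-l))
  have : {z | Real.sqrt (2 * v * x) ≤ |F z|} ⊆
      {z | Real.sqrt (2 * v * x) ≤ F z} ∪ {z | Real.sqrt (2 * v * x) ≤ -F z} := by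
    intro z hz
    simpa [le_abs] using hz
  calc _ ≤ _ := measureReal_mono this
    _ ≤ _ := measureReal_union_le _ _
    _ ≤ _ := by linarith

/-- McDiarmid's inequality for the fluctuation caused by the coordinates in `b`. -/
lemma measureReal_sub_avg_le {β B K x : ℝ} (hβ0 : 0 < β) (hK : 0 < K) (hx : 0 ≤ x) {b : Finset J}
    (hb : (b.card : ℝ) ≤ K) {f : (J → Ω) → ℝ} (hf : Measurable f) (hB : ∀ x, |f x| ≤ B)
    (hβ : ∀ i ∈ b, ∀ z w, |f (Function.update z i w) - f z| ≤ β) :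
    (Measure.pi ν).real {z | Real.sqrt (2 * (K * β ^ 2) * x) ≤ |f z - avg ν b f z|} ≤
      2 * Real.exp (-x) := by
  refine measureReal_sqrt_le_abs (by positivity) hx (fun l => ?_) fun l => ?_
  · refine integrable_of_abs_le ((hf.sub (measurable_avg _ hf)).const_mul l).exp
      (B := Real.exp (|l| * (2 * B))) fun z => ?_
    rw [abs_of_pos (Real.exp_pos _)]
    refine Real.exp_le_exp.2 ((le_abs_self _).trans ?_)
    rw [abs_mul]
    refine mul_le_mul_of_nonneg_left ?_ (abs_nonneg _)
    have h1 := hB z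
    have h2 := abs_avg_le (ν := ν) b hB z
    have := abs_sub (f z) (avg ν b f z)
    linarith
  · refine (integral_exp_sub_avg_le l hβ0.le b hf hB hβ).trans (Real.exp_le_exp.2 ?_)
    gcongr

/-- Hoeffding's inequality for centered functions of independent coordinates. -/
lemma measureReal_sum_le {B K x : ℝ} (hB0 : 0 < B) (hK : 0 < K) (hx : 0 ≤ x) {b : Finset J}
    (hb : (b.card : ℝ) ≤ K) {Y : Ω → ℝ} (hY : Measurable Y) {c : ℝ} (hYB : ∀ w, |Y w - c| ≤ B)
    (hmean : ∀ i ∈ b, ∫ w, Y w ∂(ν i) = 0) :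
    (Measure.pi ν).real {z | Real.sqrt (2 * (K * B ^ 2) * x) ≤ |∑ i ∈ b, Y (z i)|} ≤
      2 * Real.exp (-x) := by
  have hind : iIndepFun (fun (i : J) (z : J → Ω) => Y (z i)) (Measure.pi ν) :=
    iIndepFun_pi (X := fun _ => Y) fun i => hY.aemeasurable
  have hsub : ∀ i ∈ b, HasSubgaussianMGF (fun z : J → Ω => Y (z i)) (B ^ 2).toNNReal
      (Measure.pi ν) := by
    intro i hi
    have hm : ∫ z : J → Ω, Y (z i) ∂(Measure.pi ν) = 0 := by
      rw [← hmean i hi, ← (measurePreserving_eval ν i).map_eq,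
        integral_map (measurable_pi_apply i).aemeasurable hY.aestronglyMeasurable]
    have := hasSubgaussianMGF_of_mem_Icc (μ := Measure.pi ν) (X := fun z : J → Ω => Y (z i))
      (a := c - B) (b := c + B) (hY.comp (measurable_pi_apply i)).aemeasurable
      (ae_of_all _ fun w => by
        have := abs_le.1 (hYB (w i))
        constructor <;> linarith [this.1, this.2])
    rw [hm] at this
    simp only [sub_zero] at this
    have hc : (B ^ 2).toNNReal = (‖c + B - (c - B)‖₊ / 2) ^ 2 := by
      apply NNReal.coe_injective
      rw [Real.coe_toNNReal _ (by positivity)]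
      push_cast
      rw [Real.norm_eq_abs, show c + B - (c - B) = 2 * B by ring, abs_mul, abs_of_pos hB0]
      norm_num
    rw [hc]
    exact this
  have hs := HasSubgaussianMGF.sum_of_iIndepFun hind hsub
  refine measureReal_sqrt_le_abs (by positivity) hx (fun l => hs.integrable_exp_mul l) fun l => ?_
  refine (hs.mgf_le l).trans (Real.exp_le_exp.2 ?_)
  rw [Finset.sum_const, nsmul_eq_mul, NNReal.coe_mul, NNReal.coe_natCast,
    Real.coe_toNNReal _ (by positivity)]
  gcongr

end Concentration

/-! ### Empirical means of stable random functions, by dyadic splitting of the sample. -/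

noncomputable section StableConcentration

variable {J Ω S : Type*} [Fintype J] [DecidableEq J] [MeasurableSpace Ω] {ν : J → Measure Ω}
  [∀ i, IsProbabilityMeasure (ν i)] [Fintype S] [DecidableEq S] [MeasurableSpace S]
  [MeasurableSingletonClass S]

/-- Resampling the coordinates in `b` preserves the law, so by Fubini it suffices to bound the event
with the other coordinates held fixed. -/
lemma measureReal_le_of_fiber (b : Finset J) {E : Set (J → Ω)} (hE : MeasurableSet E) {c : ℝ}
    (hc : 0 ≤ c) (h : ∀ z, (Measure.pi ν).real {w | b.piecewise w z ∈ E} ≤ c) :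
    (Measure.pi ν).real E ≤ c := by
  have hp := measurePreserving_piecewise ν b
  rw [measureReal_def, ← hp.measure_preimage hE.nullMeasurableSet,
    Measure.prod_apply (hp.measurable hE)]
  refine ENNReal.toReal_le_of_le_ofReal hc ?_
  calc _ ≤ ∫⁻ _ : J → Ω, ENNReal.ofReal c ∂(Measure.pi ν) := by
        refine lintegral_mono fun z => ?_
        have := h z
        rw [measureReal_def] at this
        exact (ENNReal.le_ofReal_iff_toReal_le (measure_ne_top _ _) hc).2 this
    _ = ENNReal.ofReal c := by simp

/-- The deviation of `f (X ω)` from its mean `∑ s, p s * f s`. -/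
def dev (p : S → ℝ) (X : Ω → S) (f : S → ℝ) (ω : Ω) : ℝ := f (X ω) - ∑ s, p s * f s

lemma dev_add (p : S → ℝ) (X : Ω → S) (f g : S → ℝ) (ω : Ω) :
    dev p X (fun s => f s + g s) ω = dev p X f ω + dev p X g ω := by
  simp only [dev, mul_add, Finset.sum_add_distrib]
  ring

lemma abs_sum_mul_le {p : S → ℝ} (hp : p ∈ stdSimplex ℝ S) {f : S → ℝ} {B : ℝ}
    (hf : ∀ s, |f s| ≤ B) : |∑ s, p s * f s| ≤ B := by
  calc |∑ s, p s * f s| ≤ ∑ s, |p s * f s| := Finset.abs_sum_le_sum_abs _ _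
    _ ≤ ∑ s, p s * B := Finset.sum_le_sum fun s _ => by
        rw [abs_mul, abs_of_nonneg (hp.1 s)]
        exact mul_le_mul_of_nonneg_left (hf s) (hp.1 s)
    _ = B := by rw [← Finset.sum_mul, hp.2, one_mul]

lemma abs_dev_le {p : S → ℝ} (hp : p ∈ stdSimplex ℝ S) (X : Ω → S) {f : S → ℝ} {B : ℝ}
    (hf : ∀ s, |f s| ≤ B) (ω : Ω) : |dev p X f ω| ≤ 2 * B := by
  have h1 := abs_sub (f (X ω)) (∑ s, p s * f s)
  have h2 := abs_sum_mul_le hp hf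
  have h3 := hf (X ω)
  unfold dev
  linarith

lemma measurable_dev_comp {Y : Type*} [MeasurableSpace Y] (p : S → ℝ) {X : Ω → S}
    (hX : Measurable X) {D : Y → S → ℝ} (hD : ∀ s, Measurable fun y => D y s) {Z : Y → Ω}
    (hZ : Measurable Z) : Measurable fun y => dev p X (D y) (Z y) := by
  have e : ∀ y, D y (X (Z y)) = ∑ s, if X (Z y) = s then D y s else 0 := fun y => by simp
  unfold dev
  simp only [e]
  refine Measurable.sub (Finset.measurable_sum _ fun s _ => ?_)
    (Finset.measurable_sum _ fun s _ => (hD s).const_mul _)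
  exact Measurable.ite ((hX.comp hZ) (measurableSet_singleton s)) (hD s) measurable_const

/-- Hoeffding's inequality for the deviations of a bounded function. -/
lemma measureReal_sum_dev_le {p : S → ℝ} {X : Ω → S} (hX : Measurable X) {T : Finset J}
    (hlaw : ∀ i ∈ T, ∀ f : S → ℝ, ∫ w, f (X w) ∂(ν i) = ∑ s, p s * f s)
    {B K x : ℝ} (hB0 : 0 < B) (hK : 0 < K) (hx : 0 ≤ x)
    (hb : (T.card : ℝ) ≤ K) {f : S → ℝ} (hf : ∀ s, |f s| ≤ B) :
    (Measure.pi ν).real {z | Real.sqrt (2 * (K * B ^ 2) * x) ≤ |∑ i ∈ T, dev p X f (z i)|} ≤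
      2 * Real.exp (-x) := by
  have hm : Measurable f := measurable_of_finite f
  refine measureReal_sum_le hB0 hK hx hb (Y := dev p X f) ((hm.comp hX).sub_const _)
    (c := -∑ s, p s * f s) (fun w => ?_) fun i hi => ?_
  · simpa [dev] using hf (X w)
  · unfold dev
    have hi' : Integrable (fun w => f (X w)) (ν i) :=
      integrable_of_abs_le (hm.comp hX) fun w => hf (X w)
    rw [integral_sub hi' (integrable_const _),
      hlaw i hi]
    simp

/-- The same for a random function that does not depend on the coordinates in `b`. -/
lemma measureReal_sum_dev_le_of_frozen {p : S → ℝ} {X : Ω → S} (hX : Measurable X)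
    {b : Finset J}
    (hlaw : ∀ i ∈ b, ∀ f : S → ℝ, ∫ w, f (X w) ∂(ν i) = ∑ s, p s * f s)
    {B K x : ℝ} (hB0 : 0 < B) (hK : 0 < K) (hx : 0 ≤ x)
    (hb : (b.card : ℝ) ≤ K) {D : (J → Ω) → S → ℝ} (hD : ∀ z s, |D z s| ≤ B)
    (hDm : ∀ s, Measurable fun z => D z s)
    (hfr : ∀ z w, D (b.piecewise w z) = D z) :
    (Measure.pi ν).real {z | Real.sqrt (2 * (K * B ^ 2) * x) ≤ |∑ i ∈ b, dev p X (D z) (z i)|} ≤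
      2 * Real.exp (-x) := by
  refine measureReal_le_of_fiber b ?_ (by positivity) fun z => ?_
  · refine measurableSet_le measurable_const
      (Measurable.abs (Finset.measurable_sum _ fun i _ => ?_))
    exact measurable_dev_comp p hX hDm (measurable_pi_apply i)
  -- By `hfr` the random function equals the fixed function `D z` along the whole fiber through `z`.
  · have h := measureReal_sum_dev_le hX hlaw hB0 hK hx hb (hD z)
    convert h using 4 with w
    simp only [Set.mem_ofPred_eq, hfr]
    have : ∑ i ∈ b, dev p X (D z) (b.piecewise w z i) = ∑ i ∈ b, dev p X (D z) (w i) :=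
      Finset.sum_congr rfl fun i hi => by simp [hi]
    rw [this]

lemma abs_sub_avg_singleton_le {f : (J → Ω) → ℝ} (hf : Measurable f) {B : ℝ}
    (hB : ∀ x, |f x| ≤ B) {i : J} {β : ℝ}
    (hβ : ∀ z w, |f (Function.update z i w) - f z| ≤ β) (z : J → Ω) :
    |f z - avg ν {i} f z| ≤ β := by
  unfold avg
  have hint : Integrable (fun w' => f (({i} : Finset J).piecewise w' z)) (Measure.pi ν) :=
    integrable_of_abs_le (hf.comp (measurable_piecewise_left _ z)) fun x => hB _
  have : f z = ∫ _ : J → Ω, f z ∂(Measure.pi ν) := by simp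
  rw [this, ← integral_sub (integrable_const _) hint]
  refine abs_integral_le_of_abs_le fun w' => ?_
  rw [Finset.piecewise_singleton, abs_sub_comm]
  exact hβ _ _

variable {p : S → ℝ} {X : Ω → S} {T : Finset J} {g : (J → Ω) → S → ℝ} {B β x : ℝ}

/-- Two fluctuations multiply. The difference of the two averages does not depend on the coordinates
in `b₁`; by McDiarmid over `b₂` it is at most `t = √(2 K β² x)`. Hoeffding over `b₁`, for a frozen
function bounded by `t`, then gives `√(2 K t² x) = 2 K β x`: linear in `K β`, not `K ^ (3 / 2) β`.
-/
lemma measureReal_block_le (hX : Measurable X)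
    (hlaw : ∀ i ∈ T, ∀ f : S → ℝ, ∫ w, f (X w) ∂(ν i) = ∑ s, p s * f s)
    (hgm : ∀ s, Measurable fun z => g z s) (hgB : ∀ z s, |g z s| ≤ B)
    (hβ0 : 0 < β) (hβ : ∀ i ∈ T, ∀ z w s, |g (Function.update z i w) s - g z s| ≤ β)
    (hx : 0 < x) {K : ℝ} (hK : 0 < K) {b₁ b₂ : Finset J} (h₁ : b₁ ⊆ T) (h₂ : b₂ ⊆ T)
    (c₁ : (b₁.card : ℝ) ≤ K) (c₂ : (b₂.card : ℝ) ≤ K) :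
    (Measure.pi ν).real {z | 2 * K * β * x < |∑ i ∈ b₁, dev p X
      (fun s => avg ν b₁ (fun z => g z s) z - avg ν (b₁ ∪ b₂) (fun z => g z s) z) (z i)|} ≤
      (2 * Fintype.card S + 2) * Real.exp (-x) := by
  set t := Real.sqrt (2 * (K * β ^ 2) * x) with ht
  have t0 : 0 < t := Real.sqrt_pos.2 (by positivity)
  set D : (J → Ω) → S → ℝ := fun z s =>
    avg ν b₁ (fun z => g z s) z - avg ν (b₁ ∪ b₂) (fun z => g z s) z with hD
  -- Hoeffding needs a bound that holds surely, so the difference is truncated at `t`; the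
  -- truncation is inactive outside the McDiarmid events.
  set D' : (J → Ω) → S → ℝ := fun z s => max (-t) (min t (D z s)) with hD'
  have hDm : ∀ s, Measurable fun z => D z s := fun s =>
    (measurable_avg _ (hgm s)).sub (measurable_avg _ (hgm s))
  have e2 : Real.sqrt (2 * (K * t ^ 2) * x) = 2 * K * β * x := by
    rw [ht, Real.sq_sqrt (by positivity),
      show 2 * (K * (2 * (K * β ^ 2) * x)) * x = (2 * K * β * x) ^ 2 by ring,
      Real.sqrt_sq (by positivity)]
  have hsub : {z | 2 * K * β * x < |∑ i ∈ b₁, dev p X (D z) (z i)|} ⊆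
      (⋃ s : S, {z | t ≤ |D z s|}) ∪
        {z | Real.sqrt (2 * (K * t ^ 2) * x) ≤ |∑ i ∈ b₁, dev p X (D' z) (z i)|} := by
    intro z hz
    by_cases h : ∃ s, t ≤ |D z s|
    · left
      simpa using h
    · right
      push Not at h
      have : D' z = D z := by
        funext s
        have := abs_lt.1 (h s)
        simp only [hD']
        rw [min_eq_right this.2.le, max_eq_right this.1.le]
      rw [Set.mem_ofPred_eq, this, e2]
      rw [Set.mem_ofPred_eq] at hz
      exact hz.le
  have hA : ∀ s, (Measure.pi ν).real {z | t ≤ |D z s|} ≤ 2 * Real.exp (-x) := by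
    intro s
    have := measureReal_sub_avg_le (ν := ν) hβ0 hK hx.le c₂ (f := avg ν b₁ fun z => g z s)
      (measurable_avg _ (hgm s)) (abs_avg_le _ fun z => hgB z s)
      (fun i hi z w => abs_avg_update_sub_le (hgm s) (fun z => hgB z s)
        (fun z w => hβ i (h₂ hi) z w s) z w)
    simp only [avg_avg (hgm s) (fun z => hgB z s), Finset.union_comm b₂ b₁] at this
    exact this
  have hC := measureReal_sum_dev_le_of_frozen (ν := ν) (p := p) hX (fun i hi => hlaw i (h₁ hi)) t0 hK
    hx.le c₁ (D := D') (fun z s => abs_le.2 ⟨le_max_left _ _, max_le (by linarith)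
      (min_le_left _ _)⟩)
    (fun s => measurable_const.max (measurable_const.min (hDm s)))
    (fun z w => by
      funext s
      simp only [hD', hD]
      have hc : avg ν (b₁ ∪ b₂) (fun z => g z s) (b₁.piecewise w z) =
          avg ν (b₁ ∪ b₂) (fun z => g z s) z := by
        refine avg_congr _ fun i hi => ?_
        have : i ∉ b₁ := fun h => hi (Finset.mem_union_left _ h)
        simp [this]
      rw [avg_piecewise, hc])
  calc _ ≤ _ := measureReal_mono hsub
    _ ≤ _ := measureReal_union_le _ _
    _ ≤ (∑ s : S, (Measure.pi ν).real {z | t ≤ |D z s|}) + 2 * Real.exp (-x) :=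
        add_le_add (measureReal_iUnion_fintype_le _) hC
    _ ≤ (∑ s : S, 2 * Real.exp (-x)) + 2 * Real.exp (-x) := by
        gcongr with s
        exact hA s
    _ = _ := by
        rw [Finset.sum_const, Finset.card_univ, nsmul_eq_mul]
        ring

/-- Halve the block. In each half, pass through the average over that half alone: the first part is
the induction hypothesis, the second is `measureReal_block_le`. If `E l` denotes the threshold, then
`E (l + 1) = 2 * E l + 4 * 2 ^ l * β * x`, so each of the `l` levels adds the same amount relative
to the block size. Each node of the binary tree contributes `(4 |S| + 4) exp (-x)` to the failure
probability. -/
lemma measureReal_tree_le (hp : p ∈ stdSimplex ℝ S) (hX : Measurable X)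
    (hlaw : ∀ i ∈ T, ∀ f : S → ℝ, ∫ w, f (X w) ∂(ν i) = ∑ s, p s * f s)
    (hgm : ∀ s, Measurable fun z => g z s) (hgB : ∀ z s, |g z s| ≤ B)
    (hβ0 : 0 < β) (hβ : ∀ i ∈ T, ∀ z w s, |g (Function.update z i w) s - g z s| ≤ β)
    (hx : 0 < x) (l : ℕ) : ∀ b ⊆ T, b.card ≤ 2 ^ l →
    (Measure.pi ν).real {z | 2 ^ l * β * (2 + 2 * l * x) < |∑ i ∈ b, dev p X
      (fun s => g z s - avg ν b (fun z => g z s) z) (z i)|} ≤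
      (2 ^ l - 1) * ((4 * Fintype.card S + 4) * Real.exp (-x)) := by
  induction l with
  | zero =>
    intro b hb hcard
    have : {z | 2 ^ 0 * β * (2 + 2 * (0 : ℕ) * x) < |∑ i ∈ b, dev p X
      (fun s => g z s - avg ν b (fun z => g z s) z) (z i)|} = ∅ := by
      refine Set.eq_empty_of_forall_notMem fun z hz => ?_
      simp only [Set.mem_ofPred_eq] at hz
      rcases Nat.le_one_iff_eq_zero_or_eq_one.1 (by simpa using hcard) with h0 | h1
      · rw [Finset.card_eq_zero] at h0
        subst h0
        simp at hz
        linarith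
      -- At a leaf the function differs from its average by at most `β`, so its deviation is at most
      -- `2 β`, below the threshold.
      · obtain ⟨i, rfl⟩ := Finset.card_eq_one.1 h1
        rw [Finset.sum_singleton] at hz
        have hi' := hb (Finset.mem_singleton_self i)
        have := abs_dev_le hp X (f := fun s => g z s - avg ν {i} (fun z => g z s) z)
          (fun s => abs_sub_avg_singleton_le (hgm s) (fun z => hgB z s)
            (fun z w => hβ i hi' z w s) z) (z i)
        simp at hz
        linarith
    rw [this]
    simp
  | succ l ih =>
    intro b hb hcard
    obtain ⟨b₁, hb₁, hc₁⟩ := Finset.exists_subset_card_eq (min_le_right (2 ^ l) b.card)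
    set b₂ := b \ b₁ with hb₂
    have hun : b₁ ∪ b₂ = b := Finset.union_sdiff_of_subset hb₁
    have hdis : Disjoint b₁ b₂ := Finset.disjoint_sdiff
    have k₁ : b₁.card ≤ 2 ^ l := hc₁ ▸ min_le_left _ _
    have k₂ : b₂.card ≤ 2 ^ l := by
      rw [hb₂, Finset.card_sdiff_of_subset hb₁, hc₁]
      rw [pow_succ] at hcard
      omega
    have s₁ : b₁ ⊆ T := hb₁.trans hb
    have s₂ : b₂ ⊆ T := Finset.sdiff_subset.trans hb
    have c₁ : (b₁.card : ℝ) ≤ 2 ^ l := by exact_mod_cast k₁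
    have c₂ : (b₂.card : ℝ) ≤ 2 ^ l := by exact_mod_cast k₂
    have A₁ := ih b₁ s₁ k₁
    have A₂ := ih b₂ s₂ k₂
    have B₁ := measureReal_block_le (ν := ν) hX hlaw hgm hgB hβ0 hβ hx (by positivity) s₁ s₂ c₁ c₂
    have B₂ := measureReal_block_le (ν := ν) hX hlaw hgm hgB hβ0 hβ hx (by positivity) s₂ s₁ c₂ c₁
    rw [hun] at B₁
    rw [Finset.union_comm, hun] at B₂
    have split : ∀ (b' : Finset J) (z : J → Ω),
        ∑ i ∈ b', dev p X (fun s => g z s - avg ν b (fun z => g z s) z) (z i) =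
        ∑ i ∈ b', dev p X (fun s => g z s - avg ν b' (fun z => g z s) z) (z i) +
        ∑ i ∈ b', dev p X
          (fun s => avg ν b' (fun z => g z s) z - avg ν b (fun z => g z s) z) (z i) := by
      intro b' z
      rw [← Finset.sum_add_distrib]
      refine Finset.sum_congr rfl fun i _ => ?_
      rw [← dev_add]
      congr 1
      funext s
      ring
    have hsub : {z | 2 ^ (l + 1) * β * (2 + 2 * (l + 1 : ℕ) * x) < |∑ i ∈ b, dev p X
        (fun s => g z s - avg ν b (fun z => g z s) z) (z i)|} ⊆
        ({z | 2 ^ l * β * (2 + 2 * l * x) < |∑ i ∈ b₁, dev p X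
          (fun s => g z s - avg ν b₁ (fun z => g z s) z) (z i)|} ∪
        {z | 2 ^ l * β * (2 + 2 * l * x) < |∑ i ∈ b₂, dev p X
          (fun s => g z s - avg ν b₂ (fun z => g z s) z) (z i)|}) ∪
        ({z | 2 * 2 ^ l * β * x < |∑ i ∈ b₁, dev p X
          (fun s => avg ν b₁ (fun z => g z s) z - avg ν b (fun z => g z s) z) (z i)|} ∪
        {z | 2 * 2 ^ l * β * x < |∑ i ∈ b₂, dev p X
          (fun s => avg ν b₂ (fun z => g z s) z - avg ν b (fun z => g z s) z) (z i)|}) := by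
      intro z hz
      by_contra hcon
      simp only [Set.mem_union, Set.mem_ofPred_eq, not_or, not_lt] at hcon hz
      obtain ⟨⟨u1, u2⟩, u3, u4⟩ := hcon
      rw [← hun, Finset.sum_union hdis, hun, split b₁ z, split b₂ z] at hz
      have hz' := lt_of_lt_of_le hz ((abs_add_le _ _).trans
        (add_le_add (abs_add_le _ _) (abs_add_le _ _)))
      push_cast at hz'
      rw [pow_succ] at hz'
      nlinarith
    calc _ ≤ _ := measureReal_mono hsub
      _ ≤ _ := measureReal_union_le _ _
      _ ≤ _ := add_le_add (measureReal_union_le _ _) (measureReal_union_le _ _)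
      _ ≤ _ := add_le_add (add_le_add A₁ A₂) (add_le_add B₁ B₂)
      _ = _ := by rw [pow_succ]; ring

/-- Concentration of the empirical mean of a random function that is uniformly stable under
changes of single coordinates: the stability parameter `β` enters without a factor `√|T|`. -/
lemma measureReal_stable_sum_le (hp : p ∈ stdSimplex ℝ S) (hX : Measurable X)
    (hlaw : ∀ i ∈ T, ∀ f : S → ℝ, ∫ w, f (X w) ∂(ν i) = ∑ s, p s * f s)
    (hgm : ∀ s, Measurable fun z => g z s) (hB0 : 0 < B) (hgB : ∀ z s, |g z s| ≤ B)
    (hβ0 : 0 < β) (hβ : ∀ i ∈ T, ∀ z w s, |g (Function.update z i w) s - g z s| ≤ β)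
    (hx : 0 < x) (hI : 0 < T.card) {l : ℕ} (hl : T.card ≤ 2 ^ l) :
    (Measure.pi ν).real {z | Real.sqrt (2 * (T.card * B ^ 2) * x) + 2 ^ l * β * (2 + 2 * l * x) <
      |∑ i ∈ T, dev p X (g z) (z i)|} ≤
      2 ^ l * ((4 * Fintype.card S + 4) * Real.exp (-x)) := by
  have A := measureReal_tree_le (ν := ν) hp hX hlaw hgm hgB hβ0 hβ hx l T subset_rfl hl
  have C := measureReal_sum_dev_le_of_frozen (ν := ν) (p := p) hX hlaw hB0
    (by exact_mod_cast hI) hx.le le_rfl (D := fun z s => avg ν T (fun z => g z s) z)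
    (fun z s => abs_avg_le _ (fun z => hgB z s) z) (fun s => measurable_avg _ (hgm s))
    (fun z w => by funext s; rw [avg_piecewise])
  have hsub : {z | Real.sqrt (2 * (T.card * B ^ 2) * x) + 2 ^ l * β * (2 + 2 * l * x) <
      |∑ i ∈ T, dev p X (g z) (z i)|} ⊆
      {z | 2 ^ l * β * (2 + 2 * l * x) < |∑ i ∈ T, dev p X
      (fun s => g z s - avg ν T (fun z => g z s) z) (z i)|} ∪
      {z | Real.sqrt (2 * (T.card * B ^ 2) * x) ≤
        |∑ i ∈ T, dev p X (fun s => avg ν T (fun z => g z s) z) (z i)|} := by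
    intro z hz
    by_contra hcon
    simp only [Set.mem_union, Set.mem_ofPred_eq, not_or, not_lt, not_le] at hcon hz
    have : ∑ i ∈ T, dev p X (g z) (z i) =
        ∑ i ∈ T, dev p X (fun s => g z s - avg ν T (fun z => g z s) z) (z i) +
        ∑ i ∈ T, dev p X (fun s => avg ν T (fun z => g z s) z) (z i) := by
      rw [← Finset.sum_add_distrib]
      refine Finset.sum_congr rfl fun i _ => ?_
      rw [← dev_add]
      congr 1
      funext s
      ring
    rw [this] at hz
    have := abs_add_le
      (∑ i ∈ T, dev p X (fun s => g z s - avg ν T (fun z => g z s) z) (z i))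
      (∑ i ∈ T, dev p X (fun s => avg ν T (fun z => g z s) z) (z i))
    linarith [hcon.1, hcon.2]
  calc _ ≤ _ := measureReal_mono hsub
    _ ≤ _ := measureReal_union_le _ _
    _ ≤ _ := add_le_add A C
    _ ≤ _ := by
      have : (0 : ℝ) ≤ Fintype.card S * Real.exp (-x) := by positivity
      nlinarith [Real.exp_pos (-x)]

end StableConcentration

/-! ### Bernstein's inequality with an explicit scale. -/

noncomputable section Bernstein

open ProbabilityTheory

/-- The cubic Taylor remainder is at most `2 / 9 * |u| ^ 3`, which `u ^ 2 / 2 * c` absorbs. -/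
lemma exp_le_quadratic {u c : ℝ} (hu : |u| ≤ c) (hc : c ≤ 1) :
    Real.exp u ≤ 1 + u + u ^ 2 / 2 * (1 + c) := by
  have h := Real.exp_bound (hu.trans hc) (n := 3) (by norm_num)
  simp only [Finset.sum_range_succ, Finset.sum_range_zero, Nat.factorial] at h
  norm_num at h
  have h1 := (abs_le.1 h).2
  have h2 : |u| ^ 3 ≤ u ^ 2 * c := by
    rw [pow_succ, sq_abs]
    exact mul_le_mul_of_nonneg_left hu (sq_nonneg _)
  have h3 : 0 ≤ u ^ 2 * c := mul_nonneg (sq_nonneg _) ((abs_nonneg _).trans hu)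
  nlinarith

variable {J Ω : Type*} [Fintype J] [DecidableEq J] [MeasurableSpace Ω] {ν : J → Measure Ω}
  [∀ i, IsProbabilityMeasure (ν i)]

/-- In the integrated quadratic bound the linear term vanishes by centering; then `1 + y ≤ exp y`.
-/
lemma integral_exp_le_of_variance {P : Measure Ω} [IsProbabilityMeasure P] {Y : Ω → ℝ}
    (hY : Measurable Y) {c v B l : ℝ} (hYB : ∀ w, |Y w - c| ≤ B) (hmean : ∫ w, Y w ∂P = c)
    (hvar : ∫ w, (Y w - c) ^ 2 ∂P ≤ v) (hl : 0 ≤ l) (hlB : l * B ≤ 1) :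
    ∫ w, Real.exp (l * (Y w - c)) ∂P ≤ Real.exp (l ^ 2 * v / 2 * (1 + l * B)) := by
  have hB0 : 0 ≤ l * B := by
    rcases isEmpty_or_nonempty Ω with h | ⟨⟨w⟩⟩
    · exact absurd (measure_univ (μ := P)) (by simp [Set.eq_empty_of_isEmpty])
    · exact mul_nonneg hl ((abs_nonneg _).trans (hYB w))
  have i1 : Integrable (fun w => Y w - c) P := integrable_of_abs_le (hY.sub_const c) hYB
  have i2 : Integrable (fun w => (Y w - c) ^ 2) P :=
    integrable_of_abs_le ((hY.sub_const c).pow_const 2) (B := B ^ 2) fun w => by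
      rw [abs_pow]
      exact pow_le_pow_left₀ (abs_nonneg _) (hYB w) 2
  have hb : ∀ w, |l * (Y w - c)| ≤ l * B := fun w => by
    rw [abs_mul, abs_of_nonneg hl]
    exact mul_le_mul_of_nonneg_left (hYB w) hl
  have i0 : Integrable (fun w => Real.exp (l * (Y w - c))) P :=
    integrable_of_abs_le ((hY.sub_const c).const_mul l).exp (B := Real.exp (l * B)) fun w => by
      rw [abs_of_pos (Real.exp_pos _)]
      exact Real.exp_le_exp.2 ((le_abs_self _).trans (hb w))
  have iY : Integrable Y P := by
    have := i1.add (integrable_const c)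
    simpa [Pi.add_def] using this
  have hz : ∫ w, (Y w - c) ∂P = 0 := by
    rw [integral_sub iY (integrable_const _), hmean]
    simp
  calc ∫ w, Real.exp (l * (Y w - c)) ∂P
      ≤ ∫ w, (1 + l * (Y w - c) + l ^ 2 / 2 * (1 + l * B) * (Y w - c) ^ 2) ∂P := by
        refine integral_mono i0 (((integrable_const _).add (i1.const_mul l)).add
          (i2.const_mul _)) fun w => ?_
        have := exp_le_quadratic (hb w) hlB
        refine this.trans (le_of_eq ?_)
        ring
    _ = 1 + l ^ 2 / 2 * (1 + l * B) * ∫ w, (Y w - c) ^ 2 ∂P := by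
        have i3 : Integrable (fun w => 1 + l * (Y w - c)) P :=
          (integrable_const 1).add (i1.const_mul l)
        rw [integral_add i3 (i2.const_mul _),
          integral_add (integrable_const _) (i1.const_mul l), integral_const_mul,
          integral_const_mul, hz]
        simp
    _ ≤ 1 + l ^ 2 / 2 * (1 + l * B) * v := by gcongr
    _ = l ^ 2 * v / 2 * (1 + l * B) + 1 := by ring
    _ ≤ _ := Real.add_one_le_exp _

/-- Bernstein's inequality. -/
lemma measureReal_bernstein {T : Finset J} {Y : Ω → ℝ} (hY : Measurable Y) {c v B t : ℝ}
    (hB0 : 0 < B) (hv : 0 ≤ v) (ht : 0 ≤ t) (hYB : ∀ w, |Y w - c| ≤ B)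
    (hmean : ∀ i ∈ T, ∫ w, Y w ∂(ν i) = c) (hvar : ∀ i ∈ T, ∫ w, (Y w - c) ^ 2 ∂(ν i) ≤ v) :
    (Measure.pi ν).real {z | Real.sqrt (2 * (T.card * v) * t) + B * t < ∑ i ∈ T, (Y (z i) - c)} ≤
      Real.exp (-t) := by
  have hind : iIndepFun (fun (i : J) (z : J → Ω) => Y (z i) - c) (Measure.pi ν) :=
    iIndepFun_pi (X := fun _ w => Y w - c) fun i => (hY.sub_const c).aemeasurable
  have hmeas : ∀ i : J, Measurable fun z : J → Ω => Y (z i) - c := fun i =>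
    (hY.comp (measurable_pi_apply i)).sub_const c
  set V := T.card * v with hV
  have hV0 : 0 ≤ V := by positivity
  have main : ∀ l, 0 ≤ l → l * B ≤ 1 → ∀ u, (Measure.pi ν).real {z | u ≤ ∑ i ∈ T, (Y (z i) - c)} ≤
      Real.exp (-l * u + l ^ 2 * V / 2 * (1 + l * B)) := by
    intro l hl hlB u
    have hint : Integrable (fun z : J → Ω => Real.exp (l * ∑ i ∈ T, (Y (z i) - c)))
        (Measure.pi ν) := by
      refine integrable_of_abs_le
        ((Finset.measurable_sum _ fun i _ => hmeas i).const_mul l).exp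
        (B := Real.exp (l * (T.card * B))) fun z => ?_
      rw [abs_of_pos (Real.exp_pos _)]
      refine Real.exp_le_exp.2 (mul_le_mul_of_nonneg_left ?_ hl)
      rw [← nsmul_eq_mul]
      exact Finset.sum_le_card_nsmul _ _ _ fun i _ => (le_abs_self _).trans (hYB _)
    refine (measure_ge_le_exp_mul_mgf u hl hint).trans ?_
    have hs := hind.mgf_sum hmeas T (t := l)
    have he : (∑ i ∈ T, fun z : J → Ω => Y (z i) - c) = fun z => ∑ i ∈ T, (Y (z i) - c) := by
      ext z
      simp
    rw [he] at hs
    rw [hs, Real.exp_add]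
    refine mul_le_mul_of_nonneg_left ?_ (Real.exp_pos _).le
    calc ∏ i ∈ T, mgf (fun z : J → Ω => Y (z i) - c) (Measure.pi ν) l
        ≤ ∏ i ∈ T, Real.exp (l ^ 2 * v / 2 * (1 + l * B)) := by
          refine Finset.prod_le_prod (fun i _ => mgf_nonneg) fun i hi => ?_
          have : mgf (fun z : J → Ω => Y (z i) - c) (Measure.pi ν) l =
              ∫ w, Real.exp (l * (Y w - c)) ∂(ν i) := by
            unfold mgf
            rw [← (measurePreserving_eval ν i).map_eq,
              integral_map (measurable_pi_apply i).aemeasurable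
                ((hY.sub_const c).const_mul l).exp.aestronglyMeasurable]
          rw [this]
          exact integral_exp_le_of_variance hY hYB (hmean i hi) (hvar i hi) hl hlB
      _ = _ := by
          rw [Finset.prod_const, ← Real.exp_nat_mul, hV]
          congr 1
          ring
  set u := Real.sqrt (2 * V * t) + B * t with hu
  have mono : (Measure.pi ν).real {z | u < ∑ i ∈ T, (Y (z i) - c)} ≤
      (Measure.pi ν).real {z | u ≤ ∑ i ∈ T, (Y (z i) - c)} :=
    measureReal_mono fun z hz => by
      rw [Set.mem_ofPred_eq] at hz ⊢
      exact hz.le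
  refine mono.trans ?_
  -- The Gaussian choice `l = √(2 t / V)` is admissible only if `l * B ≤ 1`, and then the exponent
  -- is exactly `-t`. Otherwise `l = 1 / B` is used.
  by_cases hcase : 2 * t * B ^ 2 ≤ V ∧ 0 < V
  · obtain ⟨h1, h2⟩ := hcase
    set l := Real.sqrt (2 * t / V) with hl
    have hl0 : 0 ≤ l := Real.sqrt_nonneg _
    have l2 : l ^ 2 = 2 * t / V := Real.sq_sqrt (by positivity)
    have hlB : l * B ≤ 1 := by
      have : (l * B) ^ 2 ≤ 1 := by
        rw [mul_pow, l2, div_mul_eq_mul_div, div_le_one h2]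
        exact h1
      nlinarith [mul_nonneg hl0 hB0.le]
    have hls : l * Real.sqrt (2 * V * t) = 2 * t := by
      rw [hl, ← Real.sqrt_mul (by positivity)]
      rw [show 2 * t / V * (2 * V * t) = (2 * t) ^ 2 by field_simp]
      exact Real.sqrt_sq (by positivity)
    refine (main l hl0 hlB u).trans (Real.exp_le_exp.2 ?_)
    have e : l ^ 2 * V = 2 * t := by rw [l2]; field_simp
    rw [e, hu]
    nlinarith
  · have h1 : V ≤ 2 * t * B ^ 2 := by
      by_contra h
      push Not at h
      exact hcase ⟨h.le, lt_of_le_of_lt (by positivity) h⟩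
    have hlB : 1 / B * B ≤ 1 := by rw [one_div, inv_mul_cancel₀ hB0.ne']
    refine (main (1 / B) (by positivity) hlB u).trans (Real.exp_le_exp.2 ?_)
    have e1 : 1 / B * B = 1 := by rw [one_div, inv_mul_cancel₀ hB0.ne']
    rw [e1, hu]
    -- In the small-variance regime `V ≤ 2 t B²`, so the square-root part of the threshold pays for
    -- the whole quadratic term.
    have hs : V ≤ B * Real.sqrt (2 * V * t) := by
      have e : B * Real.sqrt (2 * V * t) = Real.sqrt (B ^ 2 * (2 * V * t)) := by
        rw [Real.sqrt_mul (sq_nonneg B), Real.sqrt_sq hB0.le]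
      rw [e]
      refine Real.le_sqrt_of_sq_le ?_
      nlinarith
    have : -(1 / B) * (Real.sqrt (2 * V * t) + B * t) + (1 / B) ^ 2 * V / 2 * (1 + 1) =
        -t + (V - B * Real.sqrt (2 * V * t)) / B ^ 2 := by
      field_simp
      ring
    rw [this]
    have : (V - B * Real.sqrt (2 * V * t)) / B ^ 2 ≤ 0 :=
      div_nonpos_of_nonpos_of_nonneg (by linarith) (by positivity)
    linarith

/-- The lower tail in Bernstein's inequality. -/
lemma measureReal_bernstein_neg {T : Finset J} {Y : Ω → ℝ} (hY : Measurable Y) {c v B t : ℝ}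
    (hB0 : 0 < B) (hv : 0 ≤ v) (ht : 0 ≤ t) (hYB : ∀ w, |Y w - c| ≤ B)
    (hmean : ∀ i ∈ T, ∫ w, Y w ∂(ν i) = c) (hvar : ∀ i ∈ T, ∫ w, (Y w - c) ^ 2 ∂(ν i) ≤ v) :
    (Measure.pi ν).real {z | Real.sqrt (2 * (T.card * v) * t) + B * t < ∑ i ∈ T, (c - Y (z i))} ≤
      Real.exp (-t) := by
  have := measureReal_bernstein (ν := ν) (T := T) (Y := fun w => -Y w) hY.neg (c := -c) (v := v)
    hB0 hv ht (fun w => by rw [← neg_add', abs_neg, ← sub_eq_add_neg]; exact hYB w)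
    (fun i hi => by rw [integral_neg, hmean i hi])
    (fun i hi => by
      refine le_trans (le_of_eq ?_) (hvar i hi)
      congr 1
      ext w
      ring)
  simpa [neg_add_eq_sub] using this

end Bernstein

/-! ### Conditioning i.i.d. variables on which of them lie in a given set. -/

noncomputable section Conditioning

open ProbabilityTheory
variable {J Ω : Type*} [Fintype J] [DecidableEq J] [MeasurableSpace Ω] {ν : Measure Ω}
  [IsProbabilityMeasure ν]

lemma pi_smul_measure (c : J → ENNReal) (hc : ∀ i, c i ≠ ⊤) (κ : J → Measure Ω)
    [∀ i, IsFiniteMeasure (κ i)] :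
    Measure.pi (fun i => c i • κ i) = (∏ i, c i) • Measure.pi κ := by
  have : ∀ i, IsFiniteMeasure (c i • κ i) := fun i => (κ i).smul_finite (hc i)
  refine Measure.pi_eq fun s hs => ?_
  simp [Measure.pi_pi, Finset.prod_mul_distrib]

/-- To bound the probability of an event for i.i.d. variables it suffices to bound it conditionally
on the set of those variables that lie in `E`. -/
lemma pi_le_of_cond {E : Set Ω} (hE : MeasurableSet E) {B : Set (J → Ω)} {c : ENNReal}
    (h : ∀ lab : J → Bool, (∀ i, ν (bif lab i then E else Eᶜ) ≠ 0) →
      Measure.pi (fun i => ν[|bif lab i then E else Eᶜ]) B ≤ c) :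
    Measure.pi (fun _ : J => ν) B ≤ c := by
  set F : Bool → Set Ω := fun b => bif b then E else Eᶜ with hF
  have hFm : ∀ b, MeasurableSet (F b) := by
    rintro (_ | _)
    · exact hE.compl
    · exact hE
  -- A mixture decomposition over all labelings. It is an identity of measures, checked on boxes,
  -- and can therefore be evaluated at a set `B` that need not be measurable.
  have hdec : Measure.pi (fun _ : J => ν) =
      ∑ lab : J → Bool, Measure.pi (fun i => ν.restrict (F (lab i))) := by
    refine Measure.pi_eq fun s hs => ?_
    rw [Measure.finsetSum_apply]
    simp only [Measure.pi_pi]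
    rw [← Fintype.piFinset_univ, ← Finset.prod_univ_sum (fun _ => Finset.univ)
      (fun i b => ν.restrict (F b) (s i))]
    refine Finset.prod_congr rfl fun i _ => ?_
    rw [Fintype.sum_bool, Measure.restrict_apply (hs i), Measure.restrict_apply (hs i)]
    simp only [hF, cond_true, cond_false]
    rw [← Set.sdiff_eq]
    exact measure_inter_add_sdiff _ hE
  have hw : ∑ lab : J → Bool, ∏ i, ν (F (lab i)) = 1 := by
    rw [← Fintype.piFinset_univ, ← Finset.prod_univ_sum (fun _ => Finset.univ)
      (fun i b => ν (F b))]
    refine Finset.prod_eq_one fun i _ => ?_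
    rw [Fintype.sum_bool]
    simp only [hF, cond_true, cond_false]
    rw [measure_add_measure_compl hE, measure_univ]
  rw [hdec, Measure.finsetSum_apply]
  calc _ ≤ ∑ lab : J → Bool, (∏ i, ν (F (lab i))) * c := by
        refine Finset.sum_le_sum fun lab _ => ?_
        have e : (fun i => ν.restrict (F (lab i))) = fun i => ν (F (lab i)) • ν[|F (lab i)] := by
          funext i
          by_cases h0 : ν (F (lab i)) = 0
          · rw [h0, zero_smul, Measure.restrict_eq_zero.2 h0]
          · rw [ProbabilityTheory.cond, smul_smul, ENNReal.mul_inv_cancel h0 (measure_ne_top _ _), one_smul]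
        rw [e, pi_smul_measure _ (fun i => measure_ne_top _ _), Measure.smul_apply, smul_eq_mul]
        -- Labelings of probability zero contribute nothing, which is why the hypothesis excludes
        -- them.
        by_cases h0 : ∀ i, ν (F (lab i)) ≠ 0
        · gcongr
          exact h lab h0
        · push Not at h0
          obtain ⟨i, hi⟩ := h0
          rw [Finset.prod_eq_zero (Finset.mem_univ i) hi]
          simp
    _ = c := by rw [← Finset.sum_mul, hw, one_mul]

end Conditioning

/-! ### Sums over paths as iterated kernels. -/

noncomputable section Paths

variable {S A : Type*} [Fintype S] [Fintype A]

/-- The forward flow of mass under a sequence of (sub-)stochastic kernels. -/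
def flow (d : S → ℝ) (K : ℕ → S → A → S → ℝ) : ℕ → S → ℝ
  | 0 => d
  | t + 1 => fun s' => ∑ s, ∑ a, flow d K t s * K t s a s'

/-- Induction on the length: the last state and action are summed first and absorbed into the test
function at the endpoint. -/
lemma sum_paths (d : S → ℝ) (K : ℕ → S → A → S → ℝ) (H : ℕ) : ∀ f : S → ℝ,
    ∑ x : Fin (H + 1) → S, ∑ y : Fin H → A,
      (d (x 0) * ∏ t : Fin H, K t (x t.castSucc) (y t) (x t.succ)) * f (x (Fin.last H)) =
    ∑ s, flow d K H s * f s := by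
  induction H with
  | zero =>
    intro f
    rw [← (Equiv.funUnique (Fin 1) S).symm.sum_comp]
    simp [flow]
  | succ H ih =>
    intro f
    rw [← (Fin.snocEquiv fun _ : Fin (H + 1 + 1) => S).sum_comp, Fintype.sum_prod_type,
      Finset.sum_comm]
    have := ih (fun s => ∑ s', ∑ a, K H s a s' * f s')
    simp only [flow, Finset.sum_mul]
    calc _ = ∑ x : Fin (H + 1) → S, ∑ y : Fin H → A,
        (d (x 0) * ∏ t : Fin H, K t (x t.castSucc) (y t) (x t.succ)) *
          ∑ s', ∑ a, K H (x (Fin.last H)) a s' * f s' := by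
          refine Finset.sum_congr rfl fun x _ => ?_
          simp only [Finset.mul_sum]
          rw [Finset.sum_comm (s := (Finset.univ : Finset (Fin H → A)))]
          refine Finset.sum_congr rfl fun s' _ => ?_
          rw [← (Fin.snocEquiv fun _ : Fin (H + 1) => A).sum_comp, Fintype.sum_prod_type,
            Finset.sum_comm]
          refine Finset.sum_congr rfl fun y _ => Finset.sum_congr rfl fun a _ => ?_
          rw [Fin.prod_univ_castSucc]
          simp only [Fin.snocEquiv, Equiv.coe_fn_mk, Fin.val_castSucc, Fin.val_last,
            Fin.snoc_last, Fin.snoc_castSucc, Fin.succ_last]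
          have h0 : (Fin.snoc (α := fun _ => S) x s' : Fin (H + 2) → S) 0 = x 0 := by simp
          have h2 : ∀ i : Fin H, (Fin.snoc (α := fun _ => S) x s' : Fin (H + 2) → S)
              i.castSucc.succ = x i.succ := fun i => by
            rw [Fin.succ_castSucc, Fin.snoc_castSucc]
          simp only [h0, h2]
          ring
      _ = _ := by
          rw [this]
          simp only [Finset.mul_sum]
          rw [Finset.sum_comm]
          refine Finset.sum_congr rfl fun s' _ => Finset.sum_congr rfl fun s _ =>
            Finset.sum_congr rfl fun a _ => ?_
          ring

lemma sum_flow_succ (d : S → ℝ) (K : ℕ → S → A → S → ℝ) (t : ℕ)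
    (hK : ∀ s, ∑ a, ∑ s', K t s a s' = 1) : ∑ s, flow d K (t + 1) s = ∑ s, flow d K t s := by
  simp only [flow]
  rw [Finset.sum_comm]
  refine Finset.sum_congr rfl fun s _ => ?_
  rw [Finset.sum_comm]
  simp only [← Finset.mul_sum]
  rw [hK, mul_one]

end Paths

/-! ### Occupancies and the law of one episode. -/

noncomputable section EpisodeLaw

variable {S A : Type*} [Fintype S] [Fintype A] {H : ℕ}

/-- The one-step kernels of the state-action process of a policy, extended by `0`. -/
def MDP.kernel (M : MDP S A H) (π : Policy S A H) (t : ℕ) (s : S) (a : A) (s' : S) : ℝ :=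
  if ht : t < H then π.prob ⟨t, ht⟩ s a * M.trans ⟨t, ht⟩ s a s' else 0

lemma MDP.sum_kernel (M : MDP S A H) (π : Policy S A H) {t : ℕ} (ht : t < H) (s : S) :
    ∑ a, ∑ s', M.kernel π t s a s' = 1 := by
  simp only [MDP.kernel, ht, dif_pos, ← Finset.mul_sum, (M.trans_mem _ s _).2, mul_one,
    (π.prob_mem _ s).2]

lemma MDP.stateOcc_succ (M : MDP S A H) (π : Policy S A H) (h : Fin H) (s' : S) :
    M.stateOcc π h.succ s' =
      ∑ s, ∑ a, M.stateOcc π h.castSucc s * π.prob h s a * M.trans h s a s' := by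
  simp [MDP.stateOcc, Fin.induction_succ]

lemma MDP.stateOcc_eq_flow (M : MDP S A H) (π : Policy S A H) (h : Fin (H + 1)) :
    M.stateOcc π h = flow M.init (M.kernel π) h := by
  induction h using Fin.induction with
  | zero => rfl
  | succ h ih =>
    funext s'
    rw [M.stateOcc_succ, ih]
    simp [flow, MDP.kernel, mul_assoc]

lemma MDP.sum_stateOcc (M : MDP S A H) (π : Policy S A H) (h : Fin (H + 1)) :
    ∑ s, M.stateOcc π h s = 1 := by
  induction h using Fin.induction with
  | zero => exact M.init_mem.2
  | succ h ih =>
    rw [stateOcc_eq_flow] at ih ⊢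
    rw [← ih]
    exact sum_flow_succ _ _ _ fun s => M.sum_kernel π h.2 s

lemma MDP.stateOcc_nonneg (M : MDP S A H) (π : Policy S A H) (h : Fin (H + 1)) (s : S) :
    0 ≤ M.stateOcc π h s := by
  induction h using Fin.induction generalizing s with
  | zero => exact M.init_mem.1 s
  | succ h ih =>
    rw [M.stateOcc_succ]
    exact Finset.sum_nonneg fun s _ => Finset.sum_nonneg fun a _ =>
      mul_nonneg (mul_nonneg (ih s) ((π.prob_mem h s).1 a)) ((M.trans_mem h s a).1 _)

lemma MDP.occ_nonneg (M : MDP S A H) (π : Policy S A H) (h : Fin H) (s : S) (a : A) :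
    0 ≤ M.occ π h s a := mul_nonneg (M.stateOcc_nonneg π _ s) ((π.prob_mem h s).1 a)

lemma MDP.sum_occ (M : MDP S A H) (π : Policy S A H) (h : Fin H) :
    ∑ s, ∑ a, M.occ π h s a = 1 := by
  simp only [MDP.occ, ← Finset.mul_sum, (π.prob_mem h _).2, mul_one]
  exact M.sum_stateOcc π _

lemma MDP.occ_le_one (M : MDP S A H) (π : Policy S A H) (h : Fin H) (s : S) (a : A) :
    M.occ π h s a ≤ 1 := by
  rw [← M.sum_occ π h]
  calc M.occ π h s a ≤ ∑ a, M.occ π h s a :=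
        Finset.single_le_sum (fun a _ => M.occ_nonneg π h s a) (Finset.mem_univ a)
    _ ≤ _ := Finset.single_le_sum (f := fun s => ∑ a, M.occ π h s a)
        (fun s _ => Finset.sum_nonneg fun a _ => M.occ_nonneg π h s a) (Finset.mem_univ s)

/-- The probability of a state-action path. -/
def MDP.pathProb (M : MDP S A H) (π : Policy S A H) (x : Fin (H + 1) → S) (y : Fin H → A) : ℝ :=
  M.init (x 0) *
    ∏ h : Fin H, π.prob h (x h.castSucc) (y h) * M.trans h (x h.castSucc) (y h) (x h.succ)

lemma MDP.pathProb_nonneg (M : MDP S A H) (π : Policy S A H) (x : Fin (H + 1) → S)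
    (y : Fin H → A) : 0 ≤ M.pathProb π x y :=
  mul_nonneg (M.init_mem.1 _) (Finset.prod_nonneg fun h _ =>
    mul_nonneg ((π.prob_mem h _).1 _) ((M.trans_mem h _ _).1 _))

lemma MDP.sum_pathProb (M : MDP S A H) (π : Policy S A H) :
    ∑ x : Fin (H + 1) → S, ∑ y : Fin H → A, M.pathProb π x y = 1 := by
  have h := sum_paths M.init (M.kernel π) H (fun _ => 1)
  have h2 := M.sum_stateOcc π (Fin.last H)
  rw [stateOcc_eq_flow] at h2
  simp only [mul_one, Fin.val_last] at h h2
  rw [← h2, ← h]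
  simp [MDP.pathProb, MDP.kernel]

variable [DecidableEq S] [DecidableEq A]

/-- Put the indicator of the prescribed step into the kernel at time `h`. The flow is unchanged up
to time `h`, collapses there to one atom of the claimed mass, and afterwards keeps its total mass.
-/
lemma MDP.sum_pathProb_ite (M : MDP S A H) (π : Policy S A H) (h : Fin H) (s : S) (a : A)
    (s' : S) :
    ∑ x : Fin (H + 1) → S, ∑ y : Fin H → A,
      (if x h.castSucc = s ∧ y h = a ∧ x h.succ = s' then M.pathProb π x y else 0) =
    M.occ π h s a * M.trans h s a s' := by
  set K : ℕ → S → A → S → ℝ := fun t u b u' =>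
    M.kernel π t u b u' * if t = h → u = s ∧ b = a ∧ u' = s' then 1 else 0
  have hK : ∀ t u b u', K t u b u' =
    M.kernel π t u b u' * if t = h → u = s ∧ b = a ∧ u' = s' then 1 else 0 := fun _ _ _ _ => rfl
  clear_value K
  have key := sum_paths M.init K H (fun _ => 1)
  have e : ∀ (x : Fin (H + 1) → S) (y : Fin H → A),
      (if x h.castSucc = s ∧ y h = a ∧ x h.succ = s' then M.pathProb π x y else 0) =
      (M.init (x 0) * ∏ t : Fin H, K t (x t.castSucc) (y t) (x t.succ)) * 1 := by
    intro x y
    simp only [hK]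
    rw [Finset.prod_mul_distrib, mul_one, ← mul_assoc]
    have e1 : M.init (x 0) * ∏ t : Fin H, M.kernel π t (x t.castSucc) (y t) (x t.succ) =
        M.pathProb π x y := by
      simp [MDP.pathProb, MDP.kernel]
    rw [e1, Finset.prod_eq_single h]
    · simp
    · intro t _ ht
      have : ¬ (t : ℕ) = h := fun h' => ht (Fin.ext h')
      simp [this]
    · simp
  simp only [e]
  rw [key]
  have f1 : ∀ t : ℕ, t ≤ h → flow M.init K t = flow M.init (M.kernel π) t := by
    intro t
    induction t with
    | zero => intro _; rfl
    | succ t ih =>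
      intro ht
      funext u
      have : t ≠ h := by omega
      simp [flow, ih (by omega), hK, this]
  have f2 : ∀ u, flow M.init K (h + 1) u =
      if u = s' then M.occ π h s a * M.trans h s a s' else 0 := by
    intro u
    simp only [flow, f1 h le_rfl, hK, forall_const]
    have : ∀ (v : S) (b : A), flow M.init (M.kernel π) h v * (M.kernel π h v b u *
        if v = s ∧ b = a ∧ u = s' then 1 else 0) =
        if v = s then (if b = a then (if u = s' then
          flow M.init (M.kernel π) h v * M.kernel π h v b u else 0) else 0) else 0 := by
      intro v b
      by_cases h1 : v = s <;> by_cases h2 : b = a <;> by_cases h3 : u = s' <;> simp [h1, h2, h3]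
    simp only [this]
    rw [Finset.sum_eq_single s (fun v _ hv => by simp [hv]) (by simp),
      Finset.sum_eq_single a (fun v _ hv => by simp [hv]) (by simp)]
    by_cases h3 : u = s'
    · simp only [if_true, h3]
      rw [MDP.occ, stateOcc_eq_flow]
      simp [MDP.kernel, mul_assoc]
    · simp [h3]
  -- After step `h` the kernels are again the unmodified ones, which conserve mass.
  have f3 : ∀ k : ℕ, h + 1 + k ≤ H → ∑ u, flow M.init K (h + 1 + k) u =
      M.occ π h s a * M.trans h s a s' := by
    intro k
    induction k with
    | zero => intro _; simp [f2]
    | succ k ih =>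
      intro hk
      rw [← ih (by omega), ← add_assoc]
      refine sum_flow_succ _ _ _ fun u => ?_
      have : ¬ (h : ℕ) + 1 + k = h := by omega
      simp only [hK, this, false_imp_iff, if_true, mul_one]
      exact M.sum_kernel π (by omega) u
  have hle : (h : ℕ) + 1 + (H - (h + 1)) = H := by omega
  have := f3 (H - (h + 1)) (by omega)
  rw [hle] at this
  simpa using this

variable [MeasurableSpace S] [MeasurableSingletonClass S] [MeasurableSpace A]
  [MeasurableSingletonClass A]

instance (M : MDP S A H) (h : Fin H) (s : S) (a : A) :
    IsProbabilityMeasure (M.rewardLaw h s a) := M.rewardLaw_prob h s a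

lemma MDP.episodeLaw_apply_prod (M : MDP S A H) (π : Policy S A H) (X : Set (Fin (H + 1) → S))
    (Y : Set (Fin H → A)) (R : Set (Fin H → I)) :
    M.episodeLaw π (X ×ˢ Y ×ˢ R) = ∑ x : Fin (H + 1) → S, ∑ y : Fin H → A,
      ENNReal.ofReal (M.pathProb π x y) * (X.indicator 1 x * (Y.indicator 1 y *
        Measure.pi (fun h : Fin H => M.rewardLaw h (x h.castSucc) (y h)) R)) := by
  unfold MDP.episodeLaw
  rw [Measure.finsetSum_apply]
  refine Finset.sum_congr rfl fun x _ => ?_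
  rw [Measure.finsetSum_apply]
  refine Finset.sum_congr rfl fun y _ => ?_
  rw [Measure.smul_apply, Measure.prod_prod, Measure.prod_prod, Measure.dirac_apply,
    Measure.dirac_apply]
  rfl

instance (M : MDP S A H) (π : Policy S A H) : IsProbabilityMeasure (M.episodeLaw π) := by
  refine ⟨?_⟩
  have := M.episodeLaw_apply_prod π Set.univ Set.univ Set.univ
  rw [Set.univ_prod_univ, Set.univ_prod_univ] at this
  rw [this]
  simp only [Set.indicator_univ, Pi.one_apply, measure_univ, mul_one]
  have e : ∀ x : Fin (H + 1) → S, ∑ y : Fin H → A, ENNReal.ofReal (M.pathProb π x y) =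
      ENNReal.ofReal (∑ y : Fin H → A, M.pathProb π x y) := fun x =>
    (ENNReal.ofReal_sum_of_nonneg fun y _ => M.pathProb_nonneg π x y).symm
  simp only [e]
  rw [← ENNReal.ofReal_sum_of_nonneg fun x _ => Finset.sum_nonneg fun y _ =>
    M.pathProb_nonneg π x y, M.sum_pathProb, ENNReal.ofReal_one]

/-- The joint law of a visit, the observed reward and the next state. -/
lemma MDP.episodeLaw_step (M : MDP S A H) (π : Policy S A H) (h : Fin H) (s : S) (a : A)
    (s' : S) (R : Set I) :
    M.episodeLaw π {e | e.1 h.castSucc = s ∧ e.2.1 h = a ∧ e.1 h.succ = s' ∧ e.2.2 h ∈ R} =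
      ENNReal.ofReal (M.occ π h s a * M.trans h s a s') * M.rewardLaw h s a R := by
  have hset : {e : Episode S A H | e.1 h.castSucc = s ∧ e.2.1 h = a ∧ e.1 h.succ = s' ∧
      e.2.2 h ∈ R} = {x | x h.castSucc = s ∧ x h.succ = s'} ×ˢ {y | y h = a} ×ˢ
        {r | r h ∈ R} := by
    ext e
    simp only [Set.mem_ofPred_eq, Set.mem_prod]
    tauto
  have hpi : ∀ (x : Fin (H + 1) → S) (y : Fin H → A),
      Measure.pi (fun t : Fin H => M.rewardLaw t (x t.castSucc) (y t)) {r | r h ∈ R} =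
        M.rewardLaw h (x h.castSucc) (y h) R := by
    intro x y
    have : {r : Fin H → I | r h ∈ R} =
        Set.univ.pi fun t : Fin H => if t = h then R else Set.univ := by
      ext r
      simp only [Set.mem_ofPred_eq, Set.mem_pi, Set.mem_univ, true_imp_iff]
      constructor
      · intro hr t
        by_cases ht : t = h
        · subst ht; simpa using hr
        · simp [ht]
      · intro hr
        simpa using hr h
    rw [this, Measure.pi_pi, Finset.prod_eq_single h (fun t _ ht => by simp [ht]) (by simp)]
    simp
  rw [hset, M.episodeLaw_apply_prod]
  have e : ∀ (x : Fin (H + 1) → S) (y : Fin H → A),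
      ENNReal.ofReal (M.pathProb π x y) *
        (({x | x h.castSucc = s ∧ x h.succ = s'} : Set (Fin (H + 1) → S)).indicator 1 x *
        (({y | y h = a} : Set (Fin H → A)).indicator 1 y *
        Measure.pi (fun t : Fin H => M.rewardLaw t (x t.castSucc) (y t)) {r | r h ∈ R})) =
      ENNReal.ofReal (if x h.castSucc = s ∧ y h = a ∧ x h.succ = s' then M.pathProb π x y else 0) *
        M.rewardLaw h s a R := by
    intro x y
    rw [hpi]
    by_cases h1 : x h.castSucc = s <;> by_cases h2 : y h = a <;> by_cases h3 : x h.succ = s' <;>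
      simp [h1, h2, h3]
  simp only [e, ← Finset.sum_mul]
  congr 1
  have n0 : ∀ (x : Fin (H + 1) → S) (y : Fin H → A),
      0 ≤ if x h.castSucc = s ∧ y h = a ∧ x h.succ = s' then M.pathProb π x y else 0 := by
    intro x y
    split_ifs
    · exact M.pathProb_nonneg π x y
    · exact le_rfl
  simp only [← ENNReal.ofReal_sum_of_nonneg fun y (_ : y ∈ Finset.univ) => n0 _ y]
  rw [← ENNReal.ofReal_sum_of_nonneg fun x _ => Finset.sum_nonneg fun y _ => n0 x y,
    M.sum_pathProb_ite]

end EpisodeLaw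

/-! ### Means of functions of the reward and the next state under one step. -/

noncomputable section StepMean

variable {S A : Type*} [Fintype S] {H : ℕ} (M : Model S A H) (h : Fin H) (s : S) (a : A)

/-- The mean of `q (r, s')` for one step of the model. -/
def Model.stepMean (q : I → S → ℝ) : ℝ :=
  ∑ s', M.trans h s a s' * ∫ r, q r s' ∂(M.rewardLaw h s a)

lemma Model.stepMean_le {q : I → S → ℝ}
    {B : ℝ} (hB : ∀ r s', q r s' ≤ B) (h0 : ∀ r s', 0 ≤ q r s') : M.stepMean h s a q ≤ B := by
  have := M.rewardLaw_prob h s a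
  calc M.stepMean h s a q ≤ ∑ s', M.trans h s a s' * B := by
        refine Finset.sum_le_sum fun s' _ => mul_le_mul_of_nonneg_left ?_ ((M.trans_mem h s a).1 s')
        refine (le_abs_self _).trans (abs_integral_le_of_abs_le fun r => ?_)
        rw [abs_of_nonneg (h0 r s')]
        exact hB r s'
    _ = B := by rw [← Finset.sum_mul, (M.trans_mem h s a).2, one_mul]

lemma Model.stepMean_nonneg {q : I → S → ℝ}
    (h0 : ∀ r s', 0 ≤ q r s') : 0 ≤ M.stepMean h s a q :=
  Finset.sum_nonneg fun s' _ => mul_nonneg ((M.trans_mem h s a).1 s')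
    (integral_nonneg fun r => h0 r s')

end StepMean

/-! ### Transfer of concentration to the steps observed from a given pair. -/

noncomputable section StepLaw

open ProbabilityTheory

variable {S A : Type*} [Fintype S] [Fintype A] [DecidableEq S] [DecidableEq A] {H n : ℕ}
  [MeasurableSpace S] [MeasurableSingletonClass S] [MeasurableSpace A]
  [MeasurableSingletonClass A]

/-- The episodes that visit `(s, a)` at step `h`. -/
def visitSet (h : Fin H) (s : S) (a : A) : Set (Episode S A H) :=
  {e | e.1 h.castSucc = s ∧ e.2.1 h = a}

lemma measurable_state (h : Fin (H + 1)) : Measurable fun e : Episode S A H => e.1 h :=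
  (measurable_pi_apply h).comp measurable_fst

lemma measurable_action (h : Fin H) : Measurable fun e : Episode S A H => e.2.1 h :=
  (measurable_pi_apply h).comp (measurable_fst.comp measurable_snd)

lemma measurable_reward (h : Fin H) : Measurable fun e : Episode S A H => e.2.2 h :=
  (measurable_pi_apply h).comp (measurable_snd.comp measurable_snd)

lemma measurableSet_visitSet (h : Fin H) (s : S) (a : A) :
    MeasurableSet (visitSet h s a : Set (Episode S A H)) :=
  (measurable_state h.castSucc (measurableSet_singleton s)).inter
    (measurable_action h (measurableSet_singleton a))

lemma mem_visits {D : Fin n → Episode S A H} {h : Fin H} {s : S} {a : A} {τ : Fin n} :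
    τ ∈ visits D h s a ↔ D τ ∈ (visitSet h s a : Set (Episode S A H)) := by
  simp [visits, visitSet]

variable (M : MDP S A H) (π : Policy S A H) (h : Fin H) (s : S) (a : A)

lemma MDP.episodeLaw_visitSet : M.episodeLaw π (visitSet h s a) = ENNReal.ofReal (M.occ π h s a) := by
  have h1 := sum_measure_preimage_singleton (μ := (M.episodeLaw π).restrict (visitSet h s a))
    (Finset.univ : Finset S) (f := fun e : Episode S A H => e.1 h.succ)
    (fun y _ => measurable_state h.succ (measurableSet_singleton y))
  rw [Finset.coe_univ, Set.preimage_univ, Measure.restrict_apply_univ] at h1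
  rw [← h1]
  have e : ∀ s' : S, (M.episodeLaw π).restrict (visitSet h s a)
      ((fun e : Episode S A H => e.1 h.succ) ⁻¹' {s'}) =
      ENNReal.ofReal (M.occ π h s a * M.trans h s a s') := by
    intro s'
    rw [Measure.restrict_apply (measurable_state h.succ (measurableSet_singleton s'))]
    have := M.episodeLaw_step π h s a s' Set.univ
    rw [measure_univ, mul_one] at this
    rw [← this]
    congr 1
    ext e
    simp only [visitSet, Set.mem_inter_iff, Set.mem_preimage, Set.mem_singleton_iff,
      Set.mem_ofPred_eq, Set.mem_univ, and_true]
    tauto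
  simp only [e]
  rw [← ENNReal.ofReal_sum_of_nonneg fun s' _ => mul_nonneg (M.occ_nonneg π h s a)
    ((M.trans_mem h s a).1 s'), ← Finset.mul_sum, (M.trans_mem h s a).2, mul_one]

variable {M π h s a}

/-- Given a visit to `(s, a)`, the observed reward and the next state are independent and have the
laws prescribed by the model. -/
lemma MDP.integral_cond_step (hpos : 0 < M.occ π h s a) {q : I → S → ℝ}
    (hq : ∀ s', Measurable fun r => q r s') {B : ℝ} (hB : ∀ r s', |q r s'| ≤ B) :
    ∫ e, q (e.2.2 h) (e.1 h.succ) ∂((M.episodeLaw π)[|visitSet h s a]) =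
      ∑ s', M.trans h s a s' * ∫ r, q r s' ∂(M.rewardLaw h s a) := by
  have hE := measurableSet_visitSet (S := S) (A := A) h s a
  have hE0 : M.episodeLaw π (visitSet h s a) ≠ 0 := by
    rw [M.episodeLaw_visitSet]
    simpa using hpos
  have hprob : IsProbabilityMeasure ((M.episodeLaw π)[|visitSet h s a]) :=
    cond_isProbabilityMeasure hE0
  set P := (M.episodeLaw π)[|visitSet h s a] with hP
  -- Given the visit, the reward law on the slice of next state `s'` is the unconditional reward law
  -- scaled by the transition probability. This is the independence of reward and next state.
  have hmap : ∀ s' : S, (P.restrict {e | e.1 h.succ = s'}).map (fun e => e.2.2 h) =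
      ENNReal.ofReal (M.trans h s a s') • M.rewardLaw h s a := by
    intro s'
    have ms : MeasurableSet {e : Episode S A H | e.1 h.succ = s'} :=
      measurable_state h.succ (measurableSet_singleton s')
    ext R hR
    rw [Measure.map_apply (measurable_reward h) hR,
      Measure.restrict_apply (measurable_reward h hR), hP, cond_apply hE, Measure.smul_apply,
      smul_eq_mul, M.episodeLaw_visitSet]
    have : visitSet h s a ∩ ((fun e : Episode S A H => e.2.2 h) ⁻¹' R ∩ {e | e.1 h.succ = s'}) =
        {e | e.1 h.castSucc = s ∧ e.2.1 h = a ∧ e.1 h.succ = s' ∧ e.2.2 h ∈ R} := by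
      ext e
      simp only [visitSet, Set.mem_inter_iff, Set.mem_preimage, Set.mem_ofPred_eq]
      tauto
    rw [this, M.episodeLaw_step, ENNReal.ofReal_mul (M.occ_nonneg π h s a), ← mul_assoc,
      ← mul_assoc, ENNReal.inv_mul_cancel (by simpa using hpos) ENNReal.ofReal_ne_top, one_mul]
  have mq : ∀ s' : S, Measurable fun e : Episode S A H =>
      ({e | e.1 h.succ = s'} : Set (Episode S A H)).indicator (fun e => q (e.2.2 h) s') e :=
    fun s' => ((hq s').comp (measurable_reward h)).indicator
      (measurable_state h.succ (measurableSet_singleton s'))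
  have e1 : ∀ e : Episode S A H, q (e.2.2 h) (e.1 h.succ) =
      ∑ s', ({e | e.1 h.succ = s'} : Set (Episode S A H)).indicator
        (fun e => q (e.2.2 h) s') e := by
    intro e
    simp [Set.indicator_apply]
  simp only [e1]
  rw [integral_finsetSum]
  · refine Finset.sum_congr rfl fun s' _ => ?_
    have ms : MeasurableSet {e : Episode S A H | e.1 h.succ = s'} :=
      measurable_state h.succ (measurableSet_singleton s')
    rw [integral_indicator ms]
    have := integral_map (μ := P.restrict {e | e.1 h.succ = s'})
      (measurable_reward h).aemeasurable (f := fun r => q r s') (hq s').aestronglyMeasurable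
    rw [← this, hmap, integral_smul_measure, ENNReal.toReal_ofReal ((M.trans_mem h s a).1 s'),
      smul_eq_mul]
  · intro s' _
    refine integrable_of_abs_le (mq s') (B := B) fun e => ?_
    by_cases he : e.1 h.succ = s'
    · simpa [Set.indicator_apply, he] using hB (e.2.2 h) s'
    · simpa [Set.indicator_apply, he] using (abs_nonneg _).trans (hB (e.2.2 h) s')

variable (M π h s a)

/-- To bound the probability of an event it suffices to bound it conditionally on the set of the
episodes that visit `(s, a)` at step `h`. -/
lemma MDP.dataLaw_le_of_cond {B : Set (Fin n → Episode S A H)} {c : ℝ} (hc : 0 ≤ c)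
    (hT : ∀ (T : Finset (Fin n)) (κ : Fin n → Measure (Episode S A H)),
      (∀ i, IsProbabilityMeasure (κ i)) →
      (∀ i ∈ T, κ i = (M.episodeLaw π)[|visitSet h s a]) →
      (Measure.pi κ).real (B ∩ {D | visits D h s a = T}) ≤ c) :
    M.dataLaw π n B ≤ ENNReal.ofReal c := by
  have hE := measurableSet_visitSet (S := S) (A := A) h s a
  refine pi_le_of_cond hE fun lab hlab => ?_
  have hpr : ∀ i, IsProbabilityMeasure
      ((M.episodeLaw π)[|bif lab i then visitSet h s a else (visitSet h s a)ᶜ]) := fun i =>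
    cond_isProbabilityMeasure (hlab i)
  have hFm : ∀ i, MeasurableSet (bif lab i then visitSet h s a else (visitSet h s a)ᶜ :
      Set (Episode S A H)) := by
    intro i
    cases lab i
    · exact hE.compl
    · exact hE
  set κ := fun i => (M.episodeLaw π)[|bif lab i then visitSet h s a else (visitSet h s a)ᶜ]
    with hκ
  set T : Finset (Fin n) := Finset.univ.filter fun i => lab i = true with hTdef
  -- Under the conditioned product measure the set of visiting episodes is almost surely `T`, so the
  -- random index set can be treated as fixed.
  have hsupp : Measure.pi κ {D | visits D h s a = T}ᶜ = 0 := by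
    have hsub : {D : Fin n → Episode S A H | visits D h s a = T}ᶜ ⊆
        ⋃ i, Function.eval i ⁻¹' (bif lab i then visitSet h s a else (visitSet h s a)ᶜ)ᶜ := by
      intro D hD
      simp only [Set.mem_compl_iff, Set.mem_ofPred_eq] at hD
      by_contra hcon
      simp only [Set.mem_iUnion, Set.mem_preimage, Set.mem_compl_iff, not_exists, not_not] at hcon
      refine hD ?_
      ext i
      have := hcon i
      rw [mem_visits, hTdef, Finset.mem_filter]
      cases hl : lab i
      · simp only [hl, cond_false] at this
        simpa using this
      · simp only [hl, cond_true] at this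
        simpa using this
    refine measure_mono_null hsub (measure_iUnion_null fun i => ?_)
    rw [(measurePreserving_eval κ i).measure_preimage (hFm i).compl.nullMeasurableSet, hκ]
    simp only
    rw [cond_apply (hFm i), Set.inter_compl_self, measure_empty, mul_zero]
  have hmain := hT T κ hpr fun i hi => by
    rw [hTdef, Finset.mem_filter] at hi
    simp [hκ, hi.2]
  calc Measure.pi κ B ≤ Measure.pi κ (B ∩ {D | visits D h s a = T}) +
        Measure.pi κ {D | visits D h s a = T}ᶜ := by
        refine (measure_mono ?_).trans (measure_union_le _ _)
        intro D hD
        by_cases hv : visits D h s a = T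
        · exact Or.inl ⟨hD, hv⟩
        · exact Or.inr hv
    _ ≤ ENNReal.ofReal c := by
        rw [hsupp, add_zero]
        exact (ENNReal.le_ofReal_iff_toReal_le (measure_ne_top _ _) hc).2 hmain

/-- The sum of `q` over the observed steps from `(s, a)`. -/
def sampleSum (D : Fin n → Episode S A H) (h : Fin H) (s : S) (a : A) (q : I → S → ℝ) : ℝ :=
  ∑ τ ∈ visits D h s a, q ((D τ).2.2 h) ((D τ).1 h.succ)

lemma sampleSum_sub (D : Fin n → Episode S A H) (h : Fin H) (s : S) (a : A) (q : I → S → ℝ)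
    (c : ℝ) : sampleSum D h s a (fun r s' => q r s' - c) =
      sampleSum D h s a q - count D h s a * c := by
  simp [sampleSum, Finset.sum_sub_distrib, count]

variable {M π h s a}

/-- For each fixed set `T` of visiting episodes the summands are i.i.d. with the one-step law of the
model. Bernstein is applied given `T`; since `T` is then the visiting set, the threshold may involve
the random count. -/
lemma MDP.dataLaw_bernstein (hpos : 0 < M.occ π h s a) {q : I → S → ℝ}
    (hq : ∀ s', Measurable fun r => q r s') {B v t : ℝ} (hB0 : 0 < B) (ht : 0 ≤ t)
    (h0 : ∀ r s', 0 ≤ q r s') (hB : ∀ r s', q r s' ≤ B)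
    (hv : M.stepMean h s a (fun r s' => (q r s' - M.stepMean h s a q) ^ 2) ≤ v) :
    M.dataLaw π n {D | Real.sqrt (2 * (count D h s a * v) * t) + B * t <
        sampleSum D h s a q - count D h s a * M.stepMean h s a q} ≤
      ENNReal.ofReal (Real.exp (-t)) ∧
    M.dataLaw π n {D | Real.sqrt (2 * (count D h s a * v) * t) + B * t <
        count D h s a * M.stepMean h s a q - sampleSum D h s a q} ≤
      ENNReal.ofReal (Real.exp (-t)) := by
  set c := M.stepMean h s a q with hc
  have hc0 : 0 ≤ c := M.stepMean_nonneg _ _ _ h0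
  have hcB : c ≤ B := M.stepMean_le _ _ _ hB h0
  have hdev : ∀ r s', |q r s' - c| ≤ B := fun r s' => by
    have := h0 r s'
    have := hB r s'
    rw [abs_le]
    constructor <;> linarith
  have hv0 : 0 ≤ v := (M.stepMean_nonneg _ _ _ fun r s' => sq_nonneg _).trans hv
  have mY : Measurable fun e : Episode S A H => q (e.2.2 h) (e.1 h.succ) := by
    have e1 : (fun e : Episode S A H => q (e.2.2 h) (e.1 h.succ)) =
        fun e => ∑ s', if e.1 h.succ = s' then q (e.2.2 h) s' else 0 := by
      funext e
      simp
    rw [e1]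
    exact Finset.measurable_sum _ fun s' _ => Measurable.ite
      (measurable_state h.succ (measurableSet_singleton s')) ((hq s').comp (measurable_reward h))
      measurable_const
  have hmean : ∫ e, q (e.2.2 h) (e.1 h.succ) ∂((M.episodeLaw π)[|visitSet h s a]) = c :=
    M.integral_cond_step hpos hq fun r s' => by
      rw [abs_of_nonneg (h0 r s')]
      exact hB r s'
  have hvar : ∫ e, (q (e.2.2 h) (e.1 h.succ) - c) ^ 2 ∂((M.episodeLaw π)[|visitSet h s a]) ≤ v := by
    refine le_trans (le_of_eq ?_) hv
    exact M.integral_cond_step (q := fun r s' => (q r s' - c) ^ 2) hpos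
      (fun s' => ((hq s').sub_const c).pow_const 2) (B := B ^ 2) fun r s' => by
        rw [abs_pow]
        exact pow_le_pow_left₀ (abs_nonneg _) (hdev r s') 2
  have hsum : ∀ (D : Fin n → Episode S A H) (T : Finset (Fin n)), visits D h s a = T →
      sampleSum D h s a q - count D h s a * c =
        ∑ τ ∈ T, (q ((D τ).2.2 h) ((D τ).1 h.succ) - c) := by
    rintro D T rfl
    rw [← sampleSum_sub]
    rfl
  constructor
  · refine M.dataLaw_le_of_cond π h s a (Real.exp_pos _).le fun T κ hκ hT => ?_
    refine le_trans (measureReal_mono ?_) (measureReal_bernstein (ν := κ) (T := T) mY (c := c)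
      hB0 hv0 ht (fun e => hdev _ _) (fun i hi => by rw [hT i hi]; exact hmean)
      (fun i hi => by rw [hT i hi]; exact hvar))
    rintro D ⟨hD, hv⟩
    rw [Set.mem_ofPred_eq] at hD hv ⊢
    rw [hsum D T hv, count, hv] at hD
    exact hD
  · refine M.dataLaw_le_of_cond π h s a (Real.exp_pos _).le fun T κ hκ hT => ?_
    refine le_trans (measureReal_mono ?_) (measureReal_bernstein_neg (ν := κ) (T := T) mY (c := c)
      hB0 hv0 ht (fun e => hdev _ _) (fun i hi => by rw [hT i hi]; exact hmean)
      (fun i hi => by rw [hT i hi]; exact hvar))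
    rintro D ⟨hD, hv⟩
    rw [Set.mem_ofPred_eq] at hD hv ⊢
    have e2 : ∑ τ ∈ T, (c - q ((D τ).2.2 h) ((D τ).1 h.succ)) =
        -(sampleSum D h s a q - count D h s a * c) := by
      rw [hsum D T hv, ← Finset.sum_neg_distrib]
      exact Finset.sum_congr rfl fun τ _ => by ring
    rw [e2]
    rw [count, hv] at hD ⊢
    linarith

end StepLaw

/-! ### One-step means and variances in terms of the model. -/

noncomputable section StepMean

variable {S A : Type*} [Fintype S] {H : ℕ} (M : Model S A H) (h : Fin H) (s : S) (a : A)

lemma Model.stepMean_affine {q : I → S → ℝ} (hq : ∀ s', Measurable fun r => q r s')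
    {B : ℝ} (hB : ∀ r s', |q r s'| ≤ B) (α γ : ℝ) :
    M.stepMean h s a (fun r s' => α * q r s' + γ) = α * M.stepMean h s a q + γ := by
  have := M.rewardLaw_prob h s a
  have e : ∀ s', ∫ r, (α * q r s' + γ) ∂(M.rewardLaw h s a) =
      α * (∫ r, q r s' ∂(M.rewardLaw h s a)) + γ := fun s' => by
    rw [integral_add ((integrable_of_abs_le (hq s') fun r => hB r s').const_mul α)
      (integrable_const _), integral_const_mul]
    simp
  simp only [Model.stepMean, e, mul_add, Finset.sum_add_distrib]
  rw [← Finset.sum_mul, (M.trans_mem h s a).2, one_mul, Finset.mul_sum]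
  congr 1
  exact Finset.sum_congr rfl fun s' _ => by ring

lemma Model.stepMean_mono {q q' : I → S → ℝ} (hq : ∀ s', Measurable fun r => q r s')
    (hq' : ∀ s', Measurable fun r => q' r s')
    {B : ℝ} (hB : ∀ r s', |q r s'| ≤ B) (hB' : ∀ r s', |q' r s'| ≤ B)
    (hle : ∀ r s', q r s' ≤ q' r s') :
    M.stepMean h s a q ≤ M.stepMean h s a q' := by
  have := M.rewardLaw_prob h s a
  refine Finset.sum_le_sum fun s' _ => mul_le_mul_of_nonneg_left ?_ ((M.trans_mem h s a).1 s')
  exact integral_mono (integrable_of_abs_le (hq s') fun r => hB r s')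
    (integrable_of_abs_le (hq' s') fun r => hB' r s') fun r => hle r s'

/-- The variance of `q (r, s')` for one step of the model. -/
def Model.stepSq (q : I → S → ℝ) : ℝ :=
  M.stepMean h s a fun r s' => (q r s' - M.stepMean h s a q) ^ 2

lemma Model.stepSq_nonneg (q : I → S → ℝ) : 0 ≤ M.stepSq h s a q :=
  M.stepMean_nonneg _ _ _ fun _ _ => sq_nonneg _

lemma Model.abs_sub_stepMean_le {q : I → S → ℝ} {B : ℝ} (h0 : ∀ r s', 0 ≤ q r s')
    (hB : ∀ r s', q r s' ≤ B) (r : I) (s' : S) : |q r s' - M.stepMean h s a q| ≤ B := by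
  have h1 := M.stepMean_nonneg h s a h0
  have h2 := M.stepMean_le h s a hB h0
  have := h0 r s'
  have := hB r s'
  rw [abs_le]
  constructor <;> linarith

lemma Model.stepSq_le {q : I → S → ℝ} {B : ℝ} (h0 : ∀ r s', 0 ≤ q r s')
    (hB : ∀ r s', q r s' ≤ B) : M.stepSq h s a q ≤ B ^ 2 :=
  M.stepMean_le _ _ _ (fun r s' => by
    rw [← sq_abs]
    exact pow_le_pow_left₀ (abs_nonneg _) (M.abs_sub_stepMean_le h s a h0 hB r s') 2)
    fun _ _ => sq_nonneg _

lemma Model.stepMean_reward : M.stepMean h s a (fun r _ => (r : ℝ)) = M.meanReward h s a := by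
  simp only [Model.stepMean, Model.meanReward]
  rw [← Finset.sum_mul, (M.trans_mem h s a).2, one_mul]

lemma Model.stepMean_state (V : S → ℝ) :
    M.stepMean h s a (fun _ s' => V s') = M.transMean h s a V := by
  have := M.rewardLaw_prob h s a
  simp [Model.stepMean, Model.transMean]

lemma integrable_reward {P : Measure I} [IsProbabilityMeasure P] :
    Integrable (fun x : I => (x : ℝ)) P :=
  integrable_of_abs_le measurable_subtype_coe (B := 1) fun x => by
    rw [abs_of_nonneg x.2.1]
    exact x.2.2

lemma Model.stepMean_add (V : S → ℝ) : M.stepMean h s a (fun r s' => (r : ℝ) + V s') =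
    M.meanReward h s a + M.transMean h s a V := by
  have := M.rewardLaw_prob h s a
  have e : ∀ s', ∫ r : I, ((r : ℝ) + V s') ∂(M.rewardLaw h s a) = M.meanReward h s a + V s' :=
    fun s' => by
      rw [integral_add integrable_reward (integrable_const _)]
      simp [Model.meanReward]
  simp only [Model.stepMean, e, mul_add, Finset.sum_add_distrib]
  rw [← Finset.sum_mul, (M.trans_mem h s a).2, one_mul]
  rfl

lemma variance_reward (P : Measure I) [IsProbabilityMeasure P] :
    ProbabilityTheory.variance (fun x : I => (x : ℝ)) P =
      ∫ r : I, ((r : ℝ) - ∫ x : I, (x : ℝ) ∂P) ^ 2 ∂P :=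
  ProbabilityTheory.variance_eq_integral measurable_subtype_coe.aemeasurable

lemma Model.stepSq_reward : M.stepSq h s a (fun r _ => (r : ℝ)) =
    ProbabilityTheory.variance (fun x : I => (x : ℝ)) (M.rewardLaw h s a) := by
  have := M.rewardLaw_prob h s a
  rw [variance_reward, Model.stepSq, Model.stepMean_reward]
  simp only [Model.stepMean]
  rw [← Finset.sum_mul, (M.trans_mem h s a).2, one_mul]
  rfl

lemma Model.stepSq_state (V : S → ℝ) : M.stepSq h s a (fun _ s' => V s') =
    ∑ s', M.trans h s a s' * (V s' - M.transMean h s a V) ^ 2 := by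
  have := M.rewardLaw_prob h s a
  have hm : M.stepMean h s a (fun _ s' => V s') = M.transMean h s a V := M.stepMean_state h s a V
  rw [Model.stepSq, hm]
  exact M.stepMean_state h s a fun s' => (V s' - M.transMean h s a V) ^ 2

/-- The cross term `2 (V s' - m) (r - c)` integrates to zero over the reward, which is independent
of `s'`. -/
lemma Model.stepSq_add (V : S → ℝ) : M.stepSq h s a (fun r s' => (r : ℝ) + V s') =
    M.stepVar h s a V := by
  have := M.rewardLaw_prob h s a
  rw [Model.stepSq, Model.stepMean_add, Model.stepVar, variance_reward]
  set c := M.meanReward h s a with hc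
  set m := M.transMean h s a V with hm
  have hc' : ∫ x : I, (x : ℝ) ∂(M.rewardLaw h s a) = c := rfl
  rw [hc']
  have i2 : Integrable (fun r : I => ((r : ℝ) - c) ^ 2) (M.rewardLaw h s a) := by
    refine integrable_of_abs_le ((measurable_subtype_coe.sub_const c).pow_const 2)
      (B := (1 + |c|) ^ 2) fun r => ?_
    rw [abs_pow]
    refine pow_le_pow_left₀ (abs_nonneg _) ((abs_sub _ _).trans ?_) 2
    have : |(r : ℝ)| ≤ 1 := by rw [abs_of_nonneg r.2.1]; exact r.2.2
    linarith
  have i1 : Integrable (fun r : I => ((r : ℝ) - c)) (M.rewardLaw h s a) :=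
    integrable_reward.sub (integrable_const _)
  have e : ∀ s', ∫ r : I, ((r : ℝ) + V s' - (c + m)) ^ 2 ∂(M.rewardLaw h s a) =
      ∫ r : I, ((r : ℝ) - c) ^ 2 ∂(M.rewardLaw h s a) + (V s' - m) ^ 2 := by
    intro s'
    have e1 : ∀ r : I, ((r : ℝ) + V s' - (c + m)) ^ 2 =
        ((r : ℝ) - c) ^ 2 + 2 * (V s' - m) * ((r : ℝ) - c) + (V s' - m) ^ 2 := fun r => by ring
    simp only [e1]
    have i3 : Integrable (fun r : I => ((r : ℝ) - c) ^ 2 + 2 * (V s' - m) * ((r : ℝ) - c))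
        (M.rewardLaw h s a) := i2.add (i1.const_mul _)
    rw [integral_add i3 (integrable_const _), integral_add i2 (i1.const_mul _), integral_const_mul,
      integral_sub integrable_reward (integrable_const _), hc']
    simp
  simp only [Model.stepMean, e, mul_add, Finset.sum_add_distrib]
  rw [← Finset.sum_mul, (M.trans_mem h s a).2, one_mul]

end StepMean

/-! ### Bernstein events for first and second moments, and for visit counts. -/

noncomputable section StepConc

variable {S A : Type*} [Fintype S] [Fintype A] [DecidableEq S] [DecidableEq A] {H n : ℕ}

/-- The observed steps from `(s, a)` represent `q` well, with confidence parameter `t`. -/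
structure StepConc (M : Model S A H) (D : Fin n → Episode S A H) (h : Fin H) (s : S) (a : A)
    (q : I → S → ℝ) (B t : ℝ) : Prop where
  upper : sampleSum D h s a q - count D h s a * M.stepMean h s a q ≤
    Real.sqrt (2 * (count D h s a * M.stepSq h s a q) * t) + B * t
  lower : count D h s a * M.stepMean h s a q - sampleSum D h s a q ≤
    Real.sqrt (2 * (count D h s a * M.stepSq h s a q) * t) + B * t
  sq_upper : sampleSum D h s a (fun r s' => (q r s' - M.stepMean h s a q) ^ 2) -
      count D h s a * M.stepSq h s a q ≤
    Real.sqrt (2 * (count D h s a * (B ^ 2 * M.stepSq h s a q)) * t) + B ^ 2 * t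
  sq_lower : count D h s a * M.stepSq h s a q -
      sampleSum D h s a (fun r s' => (q r s' - M.stepMean h s a q) ^ 2) ≤
    Real.sqrt (2 * (count D h s a * (B ^ 2 * M.stepSq h s a q)) * t) + B ^ 2 * t

/-- Four Bernstein tails: two for `q` and two for `Y = (q - c)²`. As `0 ≤ Y ≤ B²`, the variance of
`Y` is at most `B² v` with `v` its mean. The fluctuation of the empirical variance is thus
proportional to the standard deviation, so that empirical and true variances can be exchanged
multiplicatively. -/
lemma MDP.dataLaw_not_stepConc [MeasurableSpace S] [MeasurableSingletonClass S]
    [MeasurableSpace A] [MeasurableSingletonClass A] {M : MDP S A H} {π : Policy S A H} {h : Fin H}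
    {s : S} {a : A} (hpos : 0 < M.occ π h s a) {q : I → S → ℝ}
    (hq : ∀ s', Measurable fun r => q r s') {B t : ℝ} (hB0 : 0 < B) (ht : 0 ≤ t)
    (h0 : ∀ r s', 0 ≤ q r s') (hB : ∀ r s', q r s' ≤ B) :
    M.dataLaw π n {D | ¬ StepConc M.toModel D h s a q B t} ≤
      ENNReal.ofReal (4 * Real.exp (-t)) := by
  set c := M.stepMean h s a q with hc
  set v := M.stepSq h s a q with hv
  have hdev := M.abs_sub_stepMean_le h s a h0 hB
  have hsqB : ∀ r s', (q r s' - c) ^ 2 ≤ B ^ 2 := fun r s' => by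
    rw [← sq_abs]
    exact pow_le_pow_left₀ (abs_nonneg _) (hdev r s') 2
  have hsqm : ∀ s', Measurable fun r => (q r s' - c) ^ 2 := fun s' =>
    ((hq s').sub_const c).pow_const 2
  have hv0 : 0 ≤ v := M.stepSq_nonneg h s a q
  have hvB : v ≤ B ^ 2 := M.stepSq_le h s a h0 hB
  have hvar : M.stepMean h s a (fun r s' => ((q r s' - c) ^ 2 - v) ^ 2) ≤ B ^ 2 * v := by
    calc M.stepMean h s a (fun r s' => ((q r s' - c) ^ 2 - v) ^ 2)
        -- Pointwise `(Y - v)² ≤ (B² - 2 v) Y + v²`, because `Y² ≤ B² Y`.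
        ≤ M.stepMean h s a (fun r s' => (B ^ 2 - 2 * v) * (q r s' - c) ^ 2 + v ^ 2) := by
          refine M.stepMean_mono h s a (fun s' => ((hsqm s').sub_const v).pow_const 2)
            (fun s' => ((hsqm s').const_mul _).add_const _) (B := 4 * B ^ 4) ?_ ?_ ?_
          · intro r s'
            rw [abs_of_nonneg (sq_nonneg _)]
            have h1 := hsqB r s'
            have h2 := sq_nonneg (q r s' - c)
            nlinarith
          · intro r s'
            have h1 := hsqB r s'
            have h2 := sq_nonneg (q r s' - c)
            rw [abs_le]
            constructor <;> nlinarith [mul_nonneg hv0 h2, mul_nonneg hv0 hv0, sq_nonneg (B ^ 2),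
              mul_le_mul hvB h1 h2 (sq_nonneg B), mul_le_mul hvB hvB hv0 (sq_nonneg B),
              mul_le_mul_of_nonneg_left h1 (sq_nonneg B)]
          · intro r s'
            have h1 := hsqB r s'
            have h2 := sq_nonneg (q r s' - c)
            nlinarith
      _ = (B ^ 2 - 2 * v) * v + v ^ 2 := by
          rw [M.stepMean_affine h s a hsqm (B := B ^ 2) fun r s' => by
            rw [abs_of_nonneg (sq_nonneg _)]; exact hsqB r s']
          rfl
      _ ≤ B ^ 2 * v := by nlinarith
  have A1 := M.dataLaw_bernstein (n := n) hpos hq hB0 ht h0 hB le_rfl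
  have A2 := M.dataLaw_bernstein (n := n) hpos hsqm (B := B ^ 2) (by positivity) ht
    (fun _ _ => sq_nonneg _) hsqB hvar
  have hsub : {D : Fin n → Episode S A H | ¬ StepConc M.toModel D h s a q B t} ⊆
      ({D | Real.sqrt (2 * (count D h s a * v) * t) + B * t <
        sampleSum D h s a q - count D h s a * c} ∪
      {D | Real.sqrt (2 * (count D h s a * v) * t) + B * t <
        count D h s a * c - sampleSum D h s a q}) ∪
      ({D | Real.sqrt (2 * (count D h s a * (B ^ 2 * v)) * t) + B ^ 2 * t <
        sampleSum D h s a (fun r s' => (q r s' - c) ^ 2) - count D h s a * v} ∪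
      {D | Real.sqrt (2 * (count D h s a * (B ^ 2 * v)) * t) + B ^ 2 * t <
        count D h s a * v - sampleSum D h s a (fun r s' => (q r s' - c) ^ 2)}) := by
    intro D hD
    by_contra hcon
    simp only [Set.mem_union, Set.mem_ofPred_eq, not_or, not_lt] at hcon
    exact hD ⟨hcon.1.1, hcon.1.2, hcon.2.1, hcon.2.2⟩
  calc _ ≤ _ := measure_mono hsub
    _ ≤ _ := measure_union_le _ _
    _ ≤ _ := add_le_add (measure_union_le _ _) (measure_union_le _ _)
    _ ≤ _ := add_le_add (add_le_add A1.1 A1.2) (add_le_add A2.1 A2.2)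
    _ = _ := by
      have := (Real.exp_pos (-t)).le
      rw [← ENNReal.ofReal_add this this, ← ENNReal.ofReal_add (by positivity) (by positivity)]
      congr 1
      ring

instance [MeasurableSpace S] [MeasurableSingletonClass S]
    [MeasurableSpace A] [MeasurableSingletonClass A] (M : MDP S A H) (π : Policy S A H) :
    IsProbabilityMeasure (M.dataLaw π n) := by
  unfold MDP.dataLaw
  infer_instance

/-- Lower Bernstein tail for the indicator of a visit, whose variance is at most `d`, at `t = n d /
16`: the threshold `√(n² d² / 8) + n d / 16` is at most `7 / 16 * (n d)`, hence less than half of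
the mean when `n d > 0`. -/
lemma MDP.dataLaw_count_lt [MeasurableSpace S] [MeasurableSingletonClass S]
    [MeasurableSpace A] [MeasurableSingletonClass A] (M : MDP S A H) (π : Policy S A H) (h : Fin H)
    (s : S) (a : A) :
    M.dataLaw π n {D | (count D h s a : ℝ) < n * M.occ π h s a / 2} ≤
      ENNReal.ofReal (Real.exp (-(n * M.occ π h s a / 16))) := by
  have hE := measurableSet_visitSet (S := S) (A := A) h s a
  set d := M.occ π h s a with hd
  have hd0 : 0 ≤ d := M.occ_nonneg π h s a
  have hd1 : d ≤ 1 := M.occ_le_one π h s a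
  set Y : Episode S A H → ℝ := (visitSet h s a).indicator 1 with hY
  have mY : Measurable Y := measurable_one.indicator hE
  have hm : ∫ e, Y e ∂(M.episodeLaw π) = d := by
    rw [hY, integral_indicator_one hE, measureReal_def, M.episodeLaw_visitSet,
      ENNReal.toReal_ofReal hd0]
  have iY : Integrable Y (M.episodeLaw π) := integrable_of_abs_le mY (B := 1) fun e => by
    by_cases he : e ∈ (visitSet h s a : Set (Episode S A H)) <;> simp [hY, he]
  have hvar : ∫ e, (Y e - d) ^ 2 ∂(M.episodeLaw π) ≤ d := by
    have e1 : ∀ e, (Y e - d) ^ 2 = (1 - 2 * d) * Y e + d ^ 2 := fun e => by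
      by_cases he : e ∈ (visitSet h s a : Set (Episode S A H))
      · simp [hY, he]; ring
      · simp [hY, he]
    simp only [e1]
    rw [integral_add (iY.const_mul _) (integrable_const _), integral_const_mul, hm]
    simp
    nlinarith
  have hB := measureReal_bernstein_neg (ν := fun _ : Fin n => M.episodeLaw π) (T := Finset.univ)
    mY (c := d) (v := d) (B := 1) (t := n * d / 16) one_pos hd0 (by positivity) (fun e => by
      by_cases he : e ∈ (visitSet h s a : Set (Episode S A H))
      · simp only [hY, he, Set.indicator_of_mem, Pi.one_apply]
        rw [abs_le]; constructor <;> linarith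
      · simp only [hY, he, Set.indicator_of_notMem, not_false_eq_true]
        rw [abs_le]; constructor <;> linarith) (fun _ _ => hm) (fun _ _ => hvar)
  refine (ENNReal.le_ofReal_iff_toReal_le (measure_ne_top _ _) (Real.exp_pos _).le).2
    (le_trans (measureReal_mono ?_) hB)
  intro D hD
  rw [Set.mem_ofPred_eq] at hD ⊢
  have hc : ∑ i, Y (D i) = count D h s a := by
    have : ∀ i, Y (D i) = if i ∈ visits D h s a then 1 else 0 := fun i => by
      by_cases hi : i ∈ visits D h s a
      · simp [hY, mem_visits.1 hi, hi]
      · have : D i ∉ (visitSet h s a : Set (Episode S A H)) := fun h' => hi (mem_visits.2 h')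
        simp [hY, this, hi]
    simp only [this]
    simp [count]
  rw [Finset.sum_sub_distrib, hc, Finset.sum_const, Finset.card_univ, Fintype.card_fin,
    nsmul_eq_mul]
  have hs : Real.sqrt (2 * (n * d) * (n * d / 16)) ≤ 3 / 8 * (n * d) := by
    rw [Real.sqrt_le_left (by positivity)]
    nlinarith [sq_nonneg ((n : ℝ) * d)]
  have : (0 : ℝ) ≤ n * d := by positivity
  linarith

end StepConc

/-! ### Variances with respect to sub-probability weights. -/

noncomputable section WeightedVariance

variable {κ : Type*} {T : Finset κ} {w : κ → ℝ}

/-- The variance of `y` with respect to (sub-)probability weights. -/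
def wvar (T : Finset κ) (w y : κ → ℝ) : ℝ := ∑ i ∈ T, w i * y i ^ 2 - (∑ i ∈ T, w i * y i) ^ 2

/-- Cauchy–Schwarz. Total weight at most one suffices, as if the missing mass sat at the value zero;
padded averages need this generality. -/
lemma sq_sum_mul_le (hw : ∀ i ∈ T, 0 ≤ w i) (hs : ∑ i ∈ T, w i ≤ 1) (y : κ → ℝ) :
    (∑ i ∈ T, w i * y i) ^ 2 ≤ ∑ i ∈ T, w i * y i ^ 2 := by
  have h := Finset.sum_sq_le_sum_mul_sum_of_sq_le_mul T hw (g := fun i => w i * y i ^ 2)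
    (r := fun i => w i * y i) (fun i hi => mul_nonneg (hw i hi) (sq_nonneg _))
    (fun i _ => le_of_eq (by ring))
  refine h.trans ?_
  have : 0 ≤ ∑ i ∈ T, w i * y i ^ 2 :=
    Finset.sum_nonneg fun i hi => mul_nonneg (hw i hi) (sq_nonneg _)
  nlinarith

lemma wvar_nonneg (hw : ∀ i ∈ T, 0 ≤ w i) (hs : ∑ i ∈ T, w i ≤ 1) (y : κ → ℝ) :
    0 ≤ wvar T w y := sub_nonneg.2 (sq_sum_mul_le hw hs y)

/-- `wvar` is a nonnegative quadratic form, so its square root is a seminorm. The Cauchy–Schwarz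
inequality for it is read off the discriminant of `x ↦ wvar (g + x e)`. -/
lemma sqrt_wvar_le_add (hw : ∀ i ∈ T, 0 ≤ w i) (hs : ∑ i ∈ T, w i ≤ 1) {f g : κ → ℝ} {C : ℝ}
    (hC : 0 ≤ C) (hfg : ∀ i ∈ T, |f i - g i| ≤ C) :
    Real.sqrt (wvar T w f) ≤ Real.sqrt (wvar T w g) + C := by
  set e : κ → ℝ := fun i => f i - g i with he
  set cov := ∑ i ∈ T, w i * (g i * e i) - (∑ i ∈ T, w i * g i) * ∑ i ∈ T, w i * e i with hcov
  have expand : ∀ x : ℝ, wvar T w (fun i => g i + x * e i) =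
      wvar T w e * (x * x) + 2 * cov * x + wvar T w g := by
    intro x
    have e1 : ∑ i ∈ T, w i * (g i + x * e i) ^ 2 = ∑ i ∈ T, w i * g i ^ 2 +
        2 * x * ∑ i ∈ T, w i * (g i * e i) + x ^ 2 * ∑ i ∈ T, w i * e i ^ 2 := by
      rw [Finset.mul_sum, Finset.mul_sum, ← Finset.sum_add_distrib, ← Finset.sum_add_distrib]
      exact Finset.sum_congr rfl fun i _ => by ring
    have e2 : ∑ i ∈ T, w i * (g i + x * e i) =
        ∑ i ∈ T, w i * g i + x * ∑ i ∈ T, w i * e i := by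
      rw [Finset.mul_sum, ← Finset.sum_add_distrib]
      exact Finset.sum_congr rfl fun i _ => by ring
    simp only [wvar, e1, e2, hcov]
    ring
  have hd := discrim_le_zero fun x => by rw [← expand x]; exact wvar_nonneg hw hs _
  have hcs : cov ^ 2 ≤ wvar T w g * wvar T w e := by
    unfold discrim at hd
    nlinarith
  have hg := wvar_nonneg hw hs g
  have hee := wvar_nonneg hw hs e
  have hf : wvar T w f = wvar T w e + 2 * cov + wvar T w g := by
    have := expand 1
    rw [show (fun i => g i + 1 * e i) = f by funext i; simp [he]] at this
    rw [this]
    ring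
  have heC : Real.sqrt (wvar T w e) ≤ C := by
    refine Real.sqrt_le_iff.2 ⟨hC, ?_⟩
    calc wvar T w e ≤ ∑ i ∈ T, w i * e i ^ 2 := sub_le_self _ (sq_nonneg _)
      _ ≤ ∑ i ∈ T, w i * C ^ 2 := Finset.sum_le_sum fun i hi =>
          mul_le_mul_of_nonneg_left (by
            rw [← sq_abs]; exact pow_le_pow_left₀ (abs_nonneg _) (hfg i hi) 2) (hw i hi)
      _ ≤ C ^ 2 := by
          rw [← Finset.sum_mul]
          exact mul_le_of_le_one_left (sq_nonneg _) hs
  have hcov' : cov ≤ Real.sqrt (wvar T w g) * Real.sqrt (wvar T w e) := by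
    rw [← Real.sqrt_mul hg]
    exact (le_abs_self _).trans (Real.abs_le_sqrt hcs)
  have : Real.sqrt (wvar T w f) ≤ Real.sqrt (wvar T w g) + Real.sqrt (wvar T w e) := by
    refine Real.sqrt_le_iff.2 ⟨by positivity, ?_⟩
    rw [hf]
    nlinarith [Real.sq_sqrt hg, Real.sq_sqrt hee]
  linarith

/-- The second moment grows by `(V - U) (V + U) ≤ 2 B (V - U)`, and the squared mean only grows. A
larger function can thus have a larger variance only if its mean is larger too, which makes the
penalized update almost monotone. -/
lemma wvar_sub_le (hw : ∀ i ∈ T, 0 ≤ w i) {U V : κ → ℝ} {B : ℝ} (hU : ∀ i ∈ T, 0 ≤ U i)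
    (hUV : ∀ i ∈ T, U i ≤ V i) (hV : ∀ i ∈ T, V i ≤ B) :
    wvar T w V - wvar T w U ≤ 2 * B * ∑ i ∈ T, w i * (V i - U i) := by
  have h1 : ∑ i ∈ T, w i * U i ≤ ∑ i ∈ T, w i * V i :=
    Finset.sum_le_sum fun i hi => mul_le_mul_of_nonneg_left (hUV i hi) (hw i hi)
  have h0 : 0 ≤ ∑ i ∈ T, w i * U i := Finset.sum_nonneg fun i hi => mul_nonneg (hw i hi) (hU i hi)
  have h2 : ∑ i ∈ T, w i * V i ^ 2 - ∑ i ∈ T, w i * U i ^ 2 ≤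
      2 * B * ∑ i ∈ T, w i * (V i - U i) := by
    rw [← Finset.sum_sub_distrib, Finset.mul_sum]
    refine Finset.sum_le_sum fun i hi => ?_
    have a1 := hU i hi
    have a2 := hUV i hi
    have a3 := hV i hi
    have : w i * (V i - U i) * (V i + U i) ≤ w i * (V i - U i) * (2 * B) :=
      mul_le_mul_of_nonneg_left (by linarith) (mul_nonneg (hw i hi) (by linarith))
    nlinarith
  unfold wvar
  nlinarith

lemma sqrt_add_le_add {v a b C : ℝ} (hv : 0 ≤ v) (hb : 0 ≤ b) (hC : 0 ≤ C)
    (hab : Real.sqrt a ≤ Real.sqrt b + C) : Real.sqrt (v + a) ≤ Real.sqrt (v + b) + C := by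
  refine Real.sqrt_le_iff.2 ⟨by positivity, ?_⟩
  have h1 : a ≤ (Real.sqrt b + C) ^ 2 := by
    rcases le_or_gt 0 a with ha | ha
    · rw [← Real.sq_sqrt ha]
      exact pow_le_pow_left₀ (Real.sqrt_nonneg _) hab 2
    · exact ha.le.trans (sq_nonneg _)
  have h2 : Real.sqrt b ≤ Real.sqrt (v + b) := Real.sqrt_le_sqrt (by linarith)
  nlinarith [Real.sq_sqrt hb, Real.sq_sqrt (show 0 ≤ v + b by linarith)]

lemma abs_sqrt_sub_sqrt_le {a b : ℝ} (ha : 0 ≤ a) (hb : 0 ≤ b) :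
    |Real.sqrt a - Real.sqrt b| ≤ Real.sqrt |a - b| := by
  refine Real.le_sqrt_of_sq_le ?_
  have h1 := Real.sqrt_nonneg a
  have h2 := Real.sqrt_nonneg b
  have h3 := Real.sq_sqrt ha
  have h4 := Real.sq_sqrt hb
  have e : a - b = (Real.sqrt a - Real.sqrt b) * (Real.sqrt a + Real.sqrt b) := by nlinarith
  rw [e, abs_mul, sq, abs_of_nonneg (add_nonneg h1 h2)]
  rw [← abs_mul_abs_self]
  simp only [abs_abs]
  refine mul_le_mul_of_nonneg_left ?_ (abs_nonneg _)
  rw [abs_le]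
  constructor <;> linarith

lemma abs_ciSup_sub_le {A : Type*} [Finite A] [Nonempty A] {f g : A → ℝ} {C : ℝ}
    (hfg : ∀ a, |f a - g a| ≤ C) : |(⨆ a, f a) - ⨆ a, g a| ≤ C := by
  have key : ∀ f g : A → ℝ, (∀ a, |f a - g a| ≤ C) → (⨆ a, f a) ≤ (⨆ a, g a) + C := by
    intro f g hfg
    refine ciSup_le fun a => ?_
    have := le_ciSup (Set.finite_range g).bddAbove a
    have := (abs_le.1 (hfg a)).2
    linarith
  rw [abs_le]
  have h1 := key f g hfg
  have h2 := key g f fun a => by rw [abs_sub_comm]; exact hfg a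
  constructor <;> linarith

end WeightedVariance

/-! ### The algorithm with padded counts and fixed known sets. -/

noncomputable section Padded

variable {S A : Type*} [Fintype S] [Fintype A] [DecidableEq S] [DecidableEq A] {H n : ℕ}

/-- The visitation count, padded up to `m`. -/
def padCount (m : ℝ) (D : Fin n → Episode S A H) (h : Fin H) (s : S) (a : A) : ℝ :=
  max (count D h s a) m

/-- The empirical mean, with the padded count as denominator. -/
def padMean (m : ℝ) (D : Fin n → Episode S A H) (h : Fin H) (s : S) (a : A) (q : I → S → ℝ) : ℝ :=
  sampleSum D h s a q / padCount m D h s a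

/-- The empirical variance, with the padded count as denominator. -/
def padVar (m : ℝ) (D : Fin n → Episode S A H) (h : Fin H) (s : S) (a : A) (q : I → S → ℝ) : ℝ :=
  padMean m D h s a (fun r s' => q r s' ^ 2) - padMean m D h s a q ^ 2

/-- The sum of the empirical variances of the reward and of `V` at the next state. -/
def padStepVar (m : ℝ) (D : Fin n → Episode S A H) (h : Fin H) (s : S) (a : A) (V : S → ℝ) : ℝ :=
  padVar m D h s a (fun r _ => (r : ℝ)) + padVar m D h s a (fun _ s' => V s')

/-- The penalized one-step estimate, with padded counts. -/
def padQ (b m : ℝ) (D : Fin n → Episode S A H) (h : Fin H) (V : S → ℝ) (s : S) (a : A) : ℝ :=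
  padMean m D h s a (fun r _ => (r : ℝ)) + padMean m D h s a (fun _ s' => V s') -
    (2 * Real.sqrt (padStepVar m D h s a V * b / padCount m D h s a) +
      14 * H * b / padCount m D h s a)

/-- The clipped penalized estimate, with value `0` outside of the sets `C h`. -/
def padQBar (C : Fin H → Finset (S × A)) (b m : ℝ) (D : Fin n → Episode S A H) (h : Fin H)
    (V : S → ℝ) (s : S) (a : A) : ℝ :=
  if (s, a) ∈ C h then max (min (padQ b m D h V s a) ((H : ℝ) - (h : ℕ))) 0 else 0

/-- The value estimates of assumption-free APVI with padded counts and known sets `C h`. -/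
def padValue (C : Fin H → Finset (S × A)) (b m : ℝ) (D : Fin n → Episode S A H)
    (h : Fin (H + 1)) : S → ℝ :=
  Fin.reverseInduction (motive := fun _ => S → ℝ) (fun _ => 0)
    (fun h V s => ⨆ a, padQBar C b m D h V s a) h

variable {C : Fin H → Finset (S × A)} {b m : ℝ} {D : Fin n → Episode S A H} {h : Fin H} {s : S}
  {a : A}

lemma padValue_last : padValue C b m D (Fin.last H) = fun _ => 0 := by
  simp [padValue]

lemma padValue_castSucc (h : Fin H) : padValue C b m D h.castSucc =
    fun s => ⨆ a, padQBar C b m D h (padValue C b m D h.succ) s a := by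
  simp [padValue]

lemma padCount_pos (hm : 0 < m) : 0 < padCount m D h s a := lt_max_of_lt_right hm

lemma le_padCount : m ≤ padCount m D h s a := le_max_right _ _

lemma padMean_eq (q : I → S → ℝ) : padMean m D h s a q =
    ∑ τ ∈ visits D h s a, 1 / padCount m D h s a * q ((D τ).2.2 h) ((D τ).1 h.succ) := by
  rw [← Finset.mul_sum, padMean, sampleSum, one_div, div_eq_inv_mul]

lemma padVar_eq (q : I → S → ℝ) : padVar m D h s a q =
    wvar (visits D h s a) (fun _ => 1 / padCount m D h s a)
      (fun τ => q ((D τ).2.2 h) ((D τ).1 h.succ)) := by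
  simp only [padVar, padMean_eq, wvar]

lemma padWeight_nonneg (hm : 0 < m) : 0 ≤ 1 / padCount m D h s a :=
  one_div_nonneg.2 (padCount_pos hm).le

lemma sum_padWeight_le (hm : 0 < m) :
    ∑ _τ ∈ visits D h s a, 1 / padCount m D h s a ≤ 1 := by
  rw [Finset.sum_const, nsmul_eq_mul, mul_one_div, div_le_one (padCount_pos hm)]
  exact le_max_left _ _

lemma padVar_nonneg (hm : 0 < m) (q : I → S → ℝ) : 0 ≤ padVar m D h s a q := by
  rw [padVar_eq]
  exact wvar_nonneg (fun _ _ => padWeight_nonneg hm) (sum_padWeight_le hm) _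

lemma padStepVar_nonneg (hm : 0 < m) (V : S → ℝ) : 0 ≤ padStepVar m D h s a V :=
  add_nonneg (padVar_nonneg hm _) (padVar_nonneg hm _)

lemma abs_padMean_le (hm : 0 < m) {q : I → S → ℝ} {B : ℝ} (hB0 : 0 ≤ B)
    (hB : ∀ r s', |q r s'| ≤ B) : |padMean m D h s a q| ≤ B := by
  rw [padMean_eq]
  calc _ ≤ ∑ τ ∈ visits D h s a, |1 / padCount m D h s a * q ((D τ).2.2 h) ((D τ).1 h.succ)| :=
        Finset.abs_sum_le_sum_abs _ _
    _ ≤ ∑ _τ ∈ visits D h s a, 1 / padCount m D h s a * B := Finset.sum_le_sum fun τ _ => by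
        rw [abs_mul, abs_of_nonneg (padWeight_nonneg hm)]
        exact mul_le_mul_of_nonneg_left (hB _ _) (padWeight_nonneg hm)
    _ ≤ B := by
        rw [← Finset.sum_mul]
        exact mul_le_of_le_one_left hB0 (sum_padWeight_le hm)

lemma padVar_le (hm : 0 < m) {q : I → S → ℝ} {B : ℝ}
    (hB : ∀ r s', |q r s'| ≤ B) : padVar m D h s a q ≤ B ^ 2 := by
  have := abs_padMean_le (D := D) (h := h) (s := s) (a := a) hm (q := fun r s' => q r s' ^ 2)
    (sq_nonneg B) fun r s' => by
      rw [abs_of_nonneg (sq_nonneg _), ← sq_abs]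
      exact pow_le_pow_left₀ (abs_nonneg _) (hB r s') 2
  have h1 := (abs_le.1 this).2
  unfold padVar
  nlinarith [sq_nonneg (padMean m D h s a q)]

lemma padMean_sub (q q' : I → S → ℝ) : padMean m D h s a (fun r s' => q r s' - q' r s') =
    padMean m D h s a q - padMean m D h s a q' := by
  simp only [padMean, sampleSum, Finset.sum_sub_distrib, sub_div]

lemma sqrt_padStepVar_le_add (hm : 0 < m) {V V' : S → ℝ} {ε : ℝ} (hε : 0 ≤ ε)
    (hV : ∀ s, |V s - V' s| ≤ ε) :
    Real.sqrt (padStepVar m D h s a V) ≤ Real.sqrt (padStepVar m D h s a V') + ε := by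
  refine sqrt_add_le_add (padVar_nonneg hm _) (padVar_nonneg hm _) hε ?_
  rw [padVar_eq, padVar_eq]
  exact sqrt_wvar_le_add (fun _ _ => padWeight_nonneg hm) (sum_padWeight_le hm) hε
    fun τ _ => hV _

lemma sqrt_mul_div {x y z : ℝ} (hx : 0 ≤ x) : Real.sqrt (x * y / z) =
    Real.sqrt x * Real.sqrt (y / z) := by
  rw [mul_div_assoc, Real.sqrt_mul hx]

/-- The penalized estimate is almost nonexpansive in the value function. -/
lemma abs_padQ_sub_le (hm : 0 < m) (hb : 0 ≤ b) {V V' : S → ℝ} {ε : ℝ} (hε : 0 ≤ ε)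
    (hV : ∀ s, |V s - V' s| ≤ ε) :
    |padQ b m D h V s a - padQ b m D h V' s a| ≤ (1 + 2 * Real.sqrt (b / m)) * ε := by
  have h1 : |padMean m D h s a (fun _ s' => V s') - padMean m D h s a (fun _ s' => V' s')| ≤ ε := by
    rw [← padMean_sub]
    exact abs_padMean_le hm hε fun _ s' => hV s'
  have h2 := sqrt_padStepVar_le_add (D := D) (h := h) (s := s) (a := a) hm hε hV
  have h3 := sqrt_padStepVar_le_add (D := D) (h := h) (s := s) (a := a) hm hε (V := V')
    (V' := V) fun s => by rw [abs_sub_comm]; exact hV s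
  have h4 : Real.sqrt (b / padCount m D h s a) ≤ Real.sqrt (b / m) :=
    Real.sqrt_le_sqrt (div_le_div_of_nonneg_left hb hm le_padCount)
  have h5 := Real.sqrt_nonneg (b / padCount m D h s a)
  unfold padQ
  rw [sqrt_mul_div (padStepVar_nonneg hm _), sqrt_mul_div (padStepVar_nonneg hm _)]
  have h6 : |Real.sqrt (padStepVar m D h s a V) - Real.sqrt (padStepVar m D h s a V')| ≤ ε := by
    rw [abs_le]
    constructor <;> linarith
  set x := Real.sqrt (padStepVar m D h s a V)
  set x' := Real.sqrt (padStepVar m D h s a V')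
  set y := Real.sqrt (b / padCount m D h s a)
  set u := padMean m D h s a (fun _ s' => V s')
  set u' := padMean m D h s a (fun _ s' => V' s')
  set z := padMean m D h s a (fun r _ => (r : ℝ))
  set k := 14 * H * b / padCount m D h s a
  have e : z + u - (2 * (x * y) + k) - (z + u' - (2 * (x' * y) + k)) =
      (u - u') - 2 * ((x - x') * y) := by ring
  rw [e]
  calc _ ≤ |u - u'| + |2 * ((x - x') * y)| := abs_sub _ _
    _ = |u - u'| + 2 * (|x - x'| * y) := by
        rw [abs_mul, abs_mul, abs_of_nonneg h5, abs_of_pos (two_pos : (0 : ℝ) < 2)]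
    _ ≤ ε + 2 * (ε * Real.sqrt (b / m)) := by gcongr
    _ = _ := by ring

lemma abs_clip_sub_le (x y c : ℝ) : |max (min x c) 0 - max (min y c) 0| ≤ |x - y| :=
  (abs_max_sub_max_le_abs _ _ _).trans (by
    have := abs_min_sub_min_le_max x c y c
    simpa using this)

lemma padQBar_mem (hs : (h : ℕ) ≤ H) (V : S → ℝ) : padQBar C b m D h V s a ∈
    Set.Icc 0 ((H : ℝ) - (h : ℕ)) := by
  have : (0 : ℝ) ≤ (H : ℝ) - (h : ℕ) := sub_nonneg.2 (by exact_mod_cast hs)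
  unfold padQBar
  split_ifs
  · exact ⟨le_max_right _ _, max_le (min_le_right _ _) this⟩
  · exact ⟨le_rfl, this⟩

lemma padValue_mem [Nonempty A] (h : Fin (H + 1)) (s : S) :
    padValue C b m D h s ∈ Set.Icc 0 ((H : ℝ) - (h : ℕ)) := by
  induction h using Fin.reverseInduction with
  | last => simp [padValue_last]
  | cast h _ =>
    rw [padValue_castSucc]
    have hb : ∀ a, padQBar C b m D h (padValue C b m D h.succ) s a ∈
        Set.Icc 0 ((H : ℝ) - (h : ℕ)) := fun a => padQBar_mem h.2.le _
    refine ⟨?_, ciSup_le fun a => (hb a).2⟩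
    exact (hb (Classical.arbitrary A)).1.trans (le_ciSup (f := fun a =>
      padQBar C b m D h (padValue C b m D h.succ) s a) (Set.finite_range _).bddAbove _)

end Padded

/-! ### Stability of the padded value estimates under replacement of one episode. -/

noncomputable section Stability

variable {S A : Type*} [Fintype S] [Fintype A] [DecidableEq S] [DecidableEq A] {H n : ℕ}
  {C : Fin H → Finset (S × A)} {b m : ℝ} {D : Fin n → Episode S A H} {h : Fin H} {s : S}
  {a : A}

/-- The contribution of one episode to a sample sum. -/
def stepTerm (h : Fin H) (s : S) (a : A) (q : I → S → ℝ) (e : Episode S A H) : ℝ :=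
  if e.1 h.castSucc = s ∧ e.2.1 h = a then q (e.2.2 h) (e.1 h.succ) else 0

lemma sampleSum_eq_sum (D : Fin n → Episode S A H) (q : I → S → ℝ) :
    sampleSum D h s a q = ∑ τ, stepTerm h s a q (D τ) := by
  simp only [sampleSum, visits, Finset.sum_filter, stepTerm]

lemma sampleSum_one (D : Fin n → Episode S A H) :
    sampleSum D h s a (fun _ _ => 1) = count D h s a := by
  simp [sampleSum, count]

lemma stepTerm_mem {q : I → S → ℝ} {B : ℝ} (h0 : ∀ r s', 0 ≤ q r s')
    (hB : ∀ r s', q r s' ≤ B) (hB0 : 0 ≤ B) (e : Episode S A H) :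
    stepTerm h s a q e ∈ Set.Icc 0 B := by
  unfold stepTerm
  split_ifs
  · exact ⟨h0 _ _, hB _ _⟩
  · exact ⟨le_rfl, hB0⟩

lemma abs_sampleSum_update_sub_le {q : I → S → ℝ} {B : ℝ} (h0 : ∀ r s', 0 ≤ q r s')
    (hB : ∀ r s', q r s' ≤ B) (hB0 : 0 ≤ B) (i : Fin n) (e : Episode S A H) :
    |sampleSum (Function.update D i e) h s a q - sampleSum D h s a q| ≤ B := by
  have e1 : ∀ D : Fin n → Episode S A H, sampleSum D h s a q =
      stepTerm h s a q (D i) + ∑ τ ∈ Finset.univ.erase i, stepTerm h s a q (D τ) := fun D => by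
    rw [sampleSum_eq_sum,
      Finset.add_sum_erase _ (fun τ => stepTerm h s a q (D τ)) (Finset.mem_univ i)]
  have e2 : ∑ τ ∈ Finset.univ.erase i, stepTerm h s a q (Function.update D i e τ) =
      ∑ τ ∈ Finset.univ.erase i, stepTerm h s a q (D τ) :=
    Finset.sum_congr rfl fun τ hτ => by
      rw [Function.update_of_ne (Finset.ne_of_mem_erase hτ)]
  rw [e1, e1 D, e2, Function.update_self, add_sub_add_right_eq_sub]
  have k1 := stepTerm_mem (h := h) (s := s) (a := a) h0 hB hB0 e
  have k2 := stepTerm_mem (h := h) (s := s) (a := a) h0 hB hB0 (D i)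
  rw [abs_le]
  constructor <;> linarith [k1.1, k1.2, k2.1, k2.2]

lemma abs_count_update_sub_le (i : Fin n) (e : Episode S A H) :
    |(count (Function.update D i e) h s a : ℝ) - count D h s a| ≤ 1 := by
  rw [← sampleSum_one, ← sampleSum_one]
  exact abs_sampleSum_update_sub_le (fun _ _ => zero_le_one) (fun _ _ => le_rfl) zero_le_one i e

lemma abs_padCount_update_sub_le (i : Fin n) (e : Episode S A H) :
    |padCount m (Function.update D i e) h s a - padCount m D h s a| ≤ 1 :=
  (abs_max_sub_max_le_abs _ _ _).trans (abs_count_update_sub_le i e)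

/-- A change of the denominator by one is multiplied by the ratio itself, which is at most `B`. This
uses the lower bound `m` for both denominators, hence the padding. -/
lemma abs_div_sub_div_le {x x' N N' m B : ℝ} (hm : 0 < m) (hN : m ≤ N) (hN' : m ≤ N') (hB : 0 ≤ B)
    (hx' : |x'| ≤ B * N') (hx : |x - x'| ≤ B) (hNN : |N - N'| ≤ 1) :
    |x / N - x' / N'| ≤ 2 * B / m := by
  have p := hm.trans_le hN
  have p' := hm.trans_le hN'
  have e : x / N - x' / N' = ((x - x') + x' / N' * (N' - N)) / N := by
    field_simp
    ring
  rw [e, abs_div, abs_of_pos p]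
  refine div_le_div₀ (by positivity) ?_ hm hN
  refine (abs_add_le _ _).trans ?_
  rw [abs_mul, abs_div, abs_of_pos p']
  have h1 : |x'| / N' ≤ B := by rwa [div_le_iff₀ p']
  have h2 : |N' - N| ≤ 1 := by rwa [abs_sub_comm]
  have := mul_le_mul h1 h2 (abs_nonneg _) hB
  linarith

lemma abs_padMean_update_sub_le (hm : 0 < m) {q : I → S → ℝ} {B : ℝ} (h0 : ∀ r s', 0 ≤ q r s')
    (hB : ∀ r s', q r s' ≤ B) (hB0 : 0 ≤ B) (i : Fin n) (e : Episode S A H) :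
    |padMean m (Function.update D i e) h s a q - padMean m D h s a q| ≤ 2 * B / m := by
  refine abs_div_sub_div_le hm le_padCount le_padCount hB0 ?_
    (abs_sampleSum_update_sub_le h0 hB hB0 i e) (abs_padCount_update_sub_le i e)
  have := abs_padMean_le (D := D) (h := h) (s := s) (a := a) hm hB0 (q := q) fun r s' => by
    rw [abs_of_nonneg (h0 r s')]; exact hB r s'
  rwa [padMean, abs_div, abs_of_pos (padCount_pos hm), div_le_iff₀ (padCount_pos hm)] at this

lemma abs_padVar_update_sub_le (hm : 0 < m) {q : I → S → ℝ} {B : ℝ} (h0 : ∀ r s', 0 ≤ q r s')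
    (hB : ∀ r s', q r s' ≤ B) (hB0 : 0 ≤ B) (i : Fin n) (e : Episode S A H) :
    |padVar m (Function.update D i e) h s a q - padVar m D h s a q| ≤ 6 * B ^ 2 / m := by
  have h1 := abs_padMean_update_sub_le (D := D) (h := h) (s := s) (a := a) hm
    (q := fun r s' => q r s' ^ 2) (B := B ^ 2) (fun _ _ => sq_nonneg _)
    (fun r s' => pow_le_pow_left₀ (h0 r s') (hB r s') 2) (sq_nonneg B) i e
  have h2 := abs_padMean_update_sub_le (D := D) (h := h) (s := s) (a := a) hm h0 hB hB0 i e
  have hq : ∀ r s', |q r s'| ≤ B := fun r s' => by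
    rw [abs_of_nonneg (h0 r s')]; exact hB r s'
  have h3 := abs_padMean_le (D := D) (h := h) (s := s) (a := a) hm hB0 hq
  have h4 := abs_padMean_le (D := Function.update D i e) (h := h) (s := s) (a := a) hm hB0 hq
  unfold padVar
  set x := padMean m D h s a q
  set x' := padMean m (Function.update D i e) h s a q
  set y := padMean m D h s a fun r s' => q r s' ^ 2
  set y' := padMean m (Function.update D i e) h s a fun r s' => q r s' ^ 2
  have e1 : y' - x' ^ 2 - (y - x ^ 2) = (y' - y) - (x' - x) * (x' + x) := by ring
  rw [e1]
  calc _ ≤ |y' - y| + |x' - x| * |x' + x| := by rw [← abs_mul]; exact abs_sub _ _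
    _ ≤ 2 * B ^ 2 / m + 2 * B / m * (2 * B) := by
        have := abs_add_le x' x
        gcongr
        linarith
    _ = _ := by ring

/-- The square root is not Lipschitz at zero, but its argument has the count in its own denominator
and so moves by only `O(b H² / m²)`. Then `|√x - √y| ≤ √|x - y|` bounds the change of the penalty by
`O(√b H / m)`, with no lower bound on the variance. -/
lemma abs_padQ_update_sub_le (hm : 1 ≤ m) (hb : 0 ≤ b) {V : S → ℝ} (h0 : ∀ s, 0 ≤ V s)
    (hV : ∀ s, V s ≤ H) (i : Fin n) (e : Episode S A H) :
    |padQ b m (Function.update D i e) h V s a - padQ b m D h V s a| ≤ H * (8 + 18 * b) / m := by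
  have hm0 : 0 < m := one_pos.trans_le hm
  have hH : (1 : ℝ) ≤ H := by exact_mod_cast (Nat.zero_le _).trans_lt h.2
  have hH0 : (0 : ℝ) ≤ H := zero_le_one.trans hH
  set D' := Function.update D i e
  have r1 := abs_padMean_update_sub_le (D := D) (h := h) (s := s) (a := a) hm0
    (q := fun r (_ : S) => (r : ℝ)) (B := 1) (fun r _ => r.2.1) (fun r _ => r.2.2) zero_le_one i e
  have v1 := abs_padMean_update_sub_le (D := D) (h := h) (s := s) (a := a) hm0
    (q := fun _ s' => V s') (fun _ s' => h0 s') (fun _ s' => hV s') hH0 i e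
  have r2 := abs_padVar_update_sub_le (D := D) (h := h) (s := s) (a := a) hm0
    (q := fun r (_ : S) => (r : ℝ)) (B := 1) (fun r _ => r.2.1) (fun r _ => r.2.2) zero_le_one i e
  have v2 := abs_padVar_update_sub_le (D := D) (h := h) (s := s) (a := a) hm0
    (q := fun _ s' => V s') (fun _ s' => h0 s') (fun _ s' => hV s') hH0 i e
  have v3 : padStepVar m D h s a V ≤ 2 * H ^ 2 := by
    have k1 := padVar_le (D := D) (h := h) (s := s) (a := a) hm0
      (q := fun r (_ : S) => (r : ℝ)) (B := 1)
      fun r _ => by rw [abs_of_nonneg r.2.1]; exact r.2.2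
    have k2 := padVar_le (D := D) (h := h) (s := s) (a := a) hm0
      (q := fun _ s' => V s') (B := H) fun _ s' => by
        rw [abs_of_nonneg (h0 s')]; exact hV s'
    unfold padStepVar
    nlinarith
  have n3 := padStepVar_nonneg (D := D) (h := h) (s := s) (a := a) hm0 V
  have n3' := padStepVar_nonneg (D := D') (h := h) (s := s) (a := a) hm0 V
  have p := padCount_pos (D := D) (h := h) (s := s) (a := a) hm0
  have p' := padCount_pos (D := D') (h := h) (s := s) (a := a) hm0
  have dv : |padStepVar m D' h s a V - padStepVar m D h s a V| ≤ 12 * H ^ 2 / m := by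
    unfold padStepVar
    rw [add_sub_add_comm]
    refine (abs_add_le _ _).trans ((add_le_add r2 v2).trans ?_)
    rw [← add_div]
    refine div_le_div_of_nonneg_right ?_ hm0.le
    nlinarith
  have dN : |1 / padCount m D' h s a - 1 / padCount m D h s a| ≤ 1 / m ^ 2 := by
    rw [div_sub_div _ _ p'.ne' p.ne', abs_div, abs_of_pos (mul_pos p' p)]
    refine div_le_div₀ zero_le_one ?_ (by positivity) ?_
    · have := abs_padCount_update_sub_le (m := m) (D := D) (h := h) (s := s) (a := a) i e
      rw [one_mul, mul_one, abs_sub_comm]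
      exact this
    · rw [sq]
      exact mul_le_mul le_padCount le_padCount hm0.le p'.le
  have da : |padStepVar m D' h s a V * b / padCount m D' h s a -
      padStepVar m D h s a V * b / padCount m D h s a| ≤ 16 * b * (H / m) ^ 2 := by
    have e1 : padStepVar m D' h s a V * b / padCount m D' h s a -
        padStepVar m D h s a V * b / padCount m D h s a =
        b * ((padStepVar m D' h s a V - padStepVar m D h s a V) * (1 / padCount m D' h s a)) +
        b * (padStepVar m D h s a V *
          (1 / padCount m D' h s a - 1 / padCount m D h s a)) := by ring
    rw [e1]
    have k1 : |(padStepVar m D' h s a V - padStepVar m D h s a V) * (1 / padCount m D' h s a)| ≤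
        12 * H ^ 2 / m * (1 / m) := by
      rw [abs_mul, abs_of_pos (one_div_pos.2 p')]
      exact mul_le_mul dv (one_div_le_one_div_of_le hm0 le_padCount) (by positivity) (by positivity)
    have k2 : |padStepVar m D h s a V *
          (1 / padCount m D' h s a - 1 / padCount m D h s a)| ≤ 2 * H ^ 2 * (1 / m ^ 2) := by
      rw [abs_mul, abs_of_nonneg n3]
      exact mul_le_mul v3 dN (abs_nonneg _) (by positivity)
    calc _ ≤ b * (12 * H ^ 2 / m * (1 / m)) + b * (2 * H ^ 2 * (1 / m ^ 2)) := by
          refine (abs_add_le _ _).trans ?_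
          rw [abs_mul b, abs_mul b, abs_of_nonneg hb]
          exact add_le_add (mul_le_mul_of_nonneg_left k1 hb) (mul_le_mul_of_nonneg_left k2 hb)
      _ = 14 * b * (H / m) ^ 2 := by field_simp; ring
      _ ≤ _ := by
        have : 0 ≤ b * (H / m) ^ 2 := by positivity
        nlinarith
  have ds := (abs_sqrt_sub_sqrt_le (div_nonneg (mul_nonneg n3' hb) p'.le)
    (div_nonneg (mul_nonneg n3 hb) p.le)).trans (Real.sqrt_le_sqrt da)
  have e2 : Real.sqrt (16 * b * (H / m) ^ 2) = 4 * Real.sqrt b * (H / m) := by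
    rw [Real.sqrt_mul (by positivity), Real.sqrt_sq (by positivity), Real.sqrt_mul (by positivity),
      show (16 : ℝ) = 4 ^ 2 by norm_num, Real.sqrt_sq (by norm_num)]
  rw [e2] at ds
  have hsb : Real.sqrt b ≤ (1 + b) / 2 := by
    have := Real.sq_sqrt hb
    nlinarith [sq_nonneg (Real.sqrt b - 1)]
  have dN2 : |14 * H * b / padCount m D' h s a - 14 * H * b / padCount m D h s a| ≤
      14 * b * (H / m) := by
    have e3 : 14 * H * b / padCount m D' h s a - 14 * H * b / padCount m D h s a =
      14 * H * b * (1 / padCount m D' h s a - 1 / padCount m D h s a) := by ring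
    rw [e3, abs_mul, abs_of_nonneg (by positivity)]
    calc _ ≤ 14 * H * b * (1 / m ^ 2) := by gcongr
      _ = 14 * b * (H / m) * (1 / m) := by ring
      _ ≤ 14 * b * (H / m) * 1 := by
          have : 1 / m ≤ 1 := by rw [div_le_one hm0]; exact hm
          gcongr
      _ = _ := mul_one _
  unfold padQ
  set x1 := padMean m D' h s a fun r _ => (r : ℝ)
  set x2 := padMean m D h s a fun r _ => (r : ℝ)
  set y1 := padMean m D' h s a fun _ s' => V s'
  set y2 := padMean m D h s a fun _ s' => V s'
  set z1 := Real.sqrt (padStepVar m D' h s a V * b / padCount m D' h s a)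
  set z2 := Real.sqrt (padStepVar m D h s a V * b / padCount m D h s a)
  set w1 := 14 * H * b / padCount m D' h s a
  set w2 := 14 * H * b / padCount m D h s a
  have hHm : 1 / m ≤ H / m := div_le_div_of_nonneg_right hH hm0.le
  have hHm0 : 0 ≤ H / m := by positivity
  have r1' : |x1 - x2| ≤ 2 * (H / m) := r1.trans (by rw [mul_div_assoc]; linarith)
  have v1' : |y1 - y2| ≤ 2 * (H / m) := v1.trans (by rw [mul_div_assoc])
  have ds' : |z1 - z2| ≤ 2 * (1 + b) * (H / m) := ds.trans (by nlinarith)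
  rw [mul_div_right_comm]
  rw [abs_le] at r1' v1' ds' dN2 ⊢
  constructor <;> linarith [r1'.1, r1'.2, v1'.1, v1'.2, ds'.1, ds'.2, dN2.1, dN2.2]

lemma abs_padQBar_sub_le {D' : Fin n → Episode S A H} {V V' : S → ℝ} {ε : ℝ}
    (hε : 0 ≤ ε)
    (hQ : |padQ b m D' h V' s a - padQ b m D h V s a| ≤ ε) :
    |padQBar C b m D' h V' s a - padQBar C b m D h V s a| ≤ ε := by
  unfold padQBar
  split_ifs
  · exact (abs_clip_sub_le _ _ _).trans hQ
  · simpa using hε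

/-- Backward recursion: one step amplifies the change in the next layer by `1 + 2 √(b / m)` and adds
the direct effect of the episode on the update. -/
lemma abs_padValue_update_sub_le_aux [Nonempty A] (hm : 1 ≤ m) (hb : 0 ≤ b) (i : Fin n)
    (e : Episode S A H) (h : Fin (H + 1)) (s : S) :
    |padValue C b m (Function.update D i e) h s - padValue C b m D h s| ≤
      (H - (h : ℕ) : ℕ) * (1 + 2 * Real.sqrt (b / m)) ^ (H - (h : ℕ)) *
        (H * (8 + 18 * b) / m) := by
  have hm0 : 0 < m := one_pos.trans_le hm
  set K := H * (8 + 18 * b) / m with hK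
  have hK0 : 0 ≤ K := by positivity
  set l := 1 + 2 * Real.sqrt (b / m) with hl
  have hl1 : 1 ≤ l := by
    have := Real.sqrt_nonneg (b / m)
    linarith
  induction h using Fin.reverseInduction generalizing s with
  | last => simp [padValue_last]
  | cast h ih =>
    rw [padValue_castSucc, padValue_castSucc]
    refine abs_ciSup_sub_le fun a => ?_
    set V := padValue C b m D h.succ with hV
    set V' := padValue C b m (Function.update D i e) h.succ with hV'
    obtain ⟨j, hj⟩ : ∃ j, H - (h : ℕ) = j + 1 := ⟨H - (h : ℕ) - 1, by have := h.2; omega⟩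
    have hj' : H - (h.succ : ℕ) = j := by rw [Fin.val_succ]; omega
    rw [Fin.val_castSucc, hj]
    rw [hj'] at ih
    have hε : 0 ≤ (j : ℝ) * l ^ j * K := by positivity
    have hstep : l * ((j : ℝ) * l ^ j * K) + K ≤ ((j + 1 : ℕ) : ℝ) * l ^ (j + 1) * K := by
      have : 1 ≤ l ^ (j + 1) := one_le_pow₀ hl1
      push_cast
      rw [pow_succ] at *
      nlinarith
    refine abs_padQBar_sub_le (by positivity) (le_trans ?_ hstep)
    have hmem := fun s' => padValue_mem (C := C) (b := b) (m := m) (D := D) h.succ s'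
    have k1 := abs_padQ_sub_le (D := Function.update D i e) (h := h) (s := s) (a := a) hm0 hb hε ih
    have k2 := abs_padQ_update_sub_le (D := D) (h := h) (s := s) (a := a) hm hb
      (V := V) (fun s' => (hmem s').1) (fun s' => (hmem s').2.trans (by
        have : (0 : ℝ) ≤ ((h.succ : Fin (H + 1)) : ℕ) := Nat.cast_nonneg _
        linarith)) i e
    calc _ ≤ _ := abs_sub_le _ (padQ b m (Function.update D i e) h V s a) _
      _ ≤ _ := add_le_add k1 k2

/-- Changing one episode changes the padded value estimates only slightly. -/
lemma abs_padValue_update_sub_le [Nonempty A] (hm : 1 ≤ m) (hb : 0 ≤ b)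
    (hbm : 4 * (H : ℝ) ^ 2 * b ≤ m) (i : Fin n)
    (e : Episode S A H) (h : Fin (H + 1)) (s : S) :
    |padValue C b m (Function.update D i e) h s - padValue C b m D h s| ≤
      3 * (H : ℝ) ^ 2 * (8 + 18 * b) / m := by
  have hm0 : 0 < m := one_pos.trans_le hm
  refine (abs_padValue_update_sub_le_aux hm hb i e h s).trans ?_
  rcases Nat.eq_zero_or_pos H with h0 | hpos
  · subst h0
    simp
  have hH : (0 : ℝ) < H := by exact_mod_cast hpos
  -- Here `4 H² b ≤ m` is used: the amplification over the horizon is then at most `(1 + 1 / H) ^ H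
  -- ≤ e ≤ 3`.
  have h1 : 2 * Real.sqrt (b / m) ≤ 1 / H := by
    have : Real.sqrt (b / m) ≤ 1 / (2 * H) := by
      refine Real.sqrt_le_iff.2 ⟨by positivity, ?_⟩
      rw [div_pow, one_pow, div_le_div_iff₀ hm0 (by positivity)]
      nlinarith
    calc _ ≤ 2 * (1 / (2 * (H : ℝ))) := by linarith
      _ = _ := by field_simp
  have h2 : (1 + 2 * Real.sqrt (b / m)) ^ (H - (h : ℕ)) ≤ 3 := by
    have p0 : 1 ≤ 1 + 2 * Real.sqrt (b / m) := by
      have := Real.sqrt_nonneg (b / m)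
      linarith
    calc _ ≤ (1 + 2 * Real.sqrt (b / m)) ^ H := pow_le_pow_right₀ p0 (Nat.sub_le _ _)
      _ ≤ Real.exp (1 / H) ^ H := by
          refine pow_le_pow_left₀ (by linarith) ?_ H
          have := Real.add_one_le_exp (1 / (H : ℝ))
          linarith
      _ = Real.exp 1 := by
          rw [← Real.exp_nat_mul, mul_one_div_cancel hH.ne']
      _ ≤ 3 := by linarith [Real.exp_one_lt_d9]
  have h3 : ((H - (h : ℕ) : ℕ) : ℝ) ≤ H := by exact_mod_cast Nat.sub_le _ _
  calc _ ≤ H * 3 * (H * (8 + 18 * b) / m) := by gcongr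
    _ = _ := by ring

end Stability

/-! ### Measurability of the padded estimates in the data. -/

noncomputable section Measurability

variable {S A : Type*} [Fintype S] [Fintype A] [DecidableEq S] [DecidableEq A] {H n : ℕ}
  {C : Fin H → Finset (S × A)} {b m : ℝ} {h : Fin H} {s : S} {a : A}
  [MeasurableSpace S] [MeasurableSingletonClass S] [MeasurableSpace A]
  [MeasurableSingletonClass A]

lemma measurable_sampleSum {q : (Fin n → Episode S A H) → I → S → ℝ}
    (hq : ∀ s', Measurable fun p : (Fin n → Episode S A H) × I => q p.1 p.2 s') :
    Measurable fun D : Fin n → Episode S A H => sampleSum D h s a (q D) := by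
  simp only [sampleSum_eq_sum]
  refine Finset.measurable_sum _ fun τ _ => ?_
  unfold stepTerm
  refine Measurable.ite ?_ ?_ measurable_const
  · exact (measurable_pi_apply τ : Measurable fun D : Fin n → Episode S A H => D τ)
      (measurableSet_visitSet h s a)
  · have e1 : (fun D : Fin n → Episode S A H => q D ((D τ).2.2 h) ((D τ).1 h.succ)) =
        fun D => ∑ s', if (D τ).1 h.succ = s' then q D ((D τ).2.2 h) s' else 0 := by
      funext D
      simp
    rw [e1]
    refine Finset.measurable_sum _ fun s' _ => Measurable.ite ?_ ?_ measurable_const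
    · exact ((measurable_state h.succ).comp (measurable_pi_apply τ)) (measurableSet_singleton s')
    · exact (hq s').comp (measurable_id.prodMk
        ((measurable_reward h).comp (measurable_pi_apply τ)))

lemma measurable_padCount : Measurable fun D : Fin n → Episode S A H => padCount m D h s a := by
  have : Measurable fun D : Fin n → Episode S A H => (count D h s a : ℝ) := by
    simp only [← sampleSum_one]
    exact measurable_sampleSum fun _ => measurable_const
  exact this.max measurable_const

lemma measurable_padMean {q : (Fin n → Episode S A H) → I → S → ℝ}
    (hq : ∀ s', Measurable fun p : (Fin n → Episode S A H) × I => q p.1 p.2 s') :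
    Measurable fun D : Fin n → Episode S A H => padMean m D h s a (q D) :=
  (measurable_sampleSum hq).div measurable_padCount

lemma measurable_padVar {q : (Fin n → Episode S A H) → I → S → ℝ}
    (hq : ∀ s', Measurable fun p : (Fin n → Episode S A H) × I => q p.1 p.2 s') :
    Measurable fun D : Fin n → Episode S A H => padVar m D h s a (q D) :=
  (measurable_padMean fun s' => (hq s').pow_const 2).sub ((measurable_padMean hq).pow_const 2)

lemma measurable_padQ {V : (Fin n → Episode S A H) → S → ℝ}
    (hV : ∀ s', Measurable fun D => V D s') :
    Measurable fun D : Fin n → Episode S A H => padQ b m D h (V D) s a := by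
  have hr : ∀ s' : S, Measurable fun p : (Fin n → Episode S A H) × I => (p.2 : ℝ) := fun _ =>
    measurable_subtype_coe.comp measurable_snd
  have hv : ∀ s' : S, Measurable fun p : (Fin n → Episode S A H) × I => V p.1 s' := fun s' =>
    (hV s').comp measurable_fst
  have m1 := measurable_padMean (q := fun _ r (_ : S) => (r : ℝ)) (m := m) (h := h) (s := s) (a := a) hr
  have m2 := measurable_padMean (q := fun D _ s' => V D s') (m := m) (h := h) (s := s) (a := a) hv
  have m3 := measurable_padVar (q := fun _ r (_ : S) => (r : ℝ)) (m := m) (h := h) (s := s) (a := a) hr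
  have m4 := measurable_padVar (q := fun D _ s' => V D s') (m := m) (h := h) (s := s) (a := a) hv
  have m5 : Measurable fun D : Fin n → Episode S A H => padCount m D h s a := measurable_padCount
  exact (m1.add m2).sub (((((m3.add m4).mul_const b).div m5).sqrt.const_mul 2).add
    (measurable_const.div m5))

lemma measurable_padValue [Nonempty A] (h : Fin (H + 1)) (s : S) :
    Measurable fun D : Fin n → Episode S A H => padValue C b m D h s := by
  induction h using Fin.reverseInduction generalizing s with
  | last => simp only [padValue_last]; exact measurable_const
  | cast h ih =>
    simp only [padValue_castSucc]
    refine Measurable.iSup fun a => ?_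
    unfold padQBar
    split_ifs
    · exact ((measurable_padQ ih).min measurable_const).max measurable_const
    · exact measurable_const

end Measurability

/-! ### Concentration for the data-dependent value estimate. -/

noncomputable section StableEvent

variable {S A : Type*} [Fintype S] [Fintype A] [DecidableEq S] [DecidableEq A] {H n : ℕ}
  {C : Fin H → Finset (S × A)} {b m : ℝ} {h : Fin H} {s : S} {a : A}
  [MeasurableSpace S] [MeasurableSingletonClass S] [MeasurableSpace A]
  [MeasurableSingletonClass A] [Nonempty A]

/-- The clipped difference of the padded value estimate and a reference function. -/
def clippedGap (C : Fin H → Finset (S × A)) (b m ε : ℝ) (V : S → ℝ) (h : Fin (H + 1))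
    (D : Fin n → Episode S A H) (s : S) : ℝ :=
  max (-ε) (min ε (padValue C b m D h s - V s))

/-- The deviation of the empirical next-state mean of the estimated value from its true mean is of
the order of the stability parameter, although the estimate depends on the same data. -/
lemma MDP.dataLaw_clippedGap {M : MDP S A H} {π : Policy S A H} (hpos : 0 < M.occ π h s a)
    {ε x : ℝ} (hε : 0 < ε) (hx : 0 < x) (V : S → ℝ)
    (hm : 1 ≤ m) (hb : 0 ≤ b) (hbm : 4 * (H : ℝ) ^ 2 * b ≤ m) :
    M.dataLaw π n {D | 0 < count D h s a ∧
      Real.sqrt (2 * (count D h s a * ε ^ 2) * x) +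
        2 * count D h s a * (3 * (H : ℝ) ^ 2 * (8 + 18 * b) / m) * (2 + 2 * Nat.clog 2 n * x) <
      |sampleSum D h s a (fun _ s' => clippedGap C b m ε V h.succ D s') -
        count D h s a * M.transMean h s a (clippedGap C b m ε V h.succ D)|} ≤
      ENNReal.ofReal (2 * n * ((4 * Fintype.card S + 4) * Real.exp (-x))) := by
  have hm0 : 0 < m := one_pos.trans_le hm
  have hH : (1 : ℝ) ≤ H := by exact_mod_cast (Nat.zero_le _).trans_lt h.2
  set β := 3 * (H : ℝ) ^ 2 * (8 + 18 * b) / m with hβ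
  have hβ0 : 0 < β := by positivity
  refine M.dataLaw_le_of_cond π h s a (by positivity) fun T κ hκ hT => ?_
  -- Without visits the event is empty, since it demands a positive count.
  rcases Nat.eq_zero_or_pos T.card with h0 | hTpos
  · refine le_trans (le_of_eq ?_) (by positivity : (0 : ℝ) ≤ _)
    convert measureReal_empty
    refine Set.eq_empty_of_forall_notMem ?_
    rintro D ⟨hD, hv⟩
    rw [Set.mem_ofPred_eq] at hD hv
    rw [count, hv, h0] at hD
    exact lt_irrefl _ hD.1
  set l := Nat.clog 2 T.card with hl
  have hTn : T.card ≤ n := by simpa using Finset.card_le_univ T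
  have hln : l ≤ Nat.clog 2 n := Nat.clog_mono_right 2 hTn
  have hl1 : T.card ≤ 2 ^ l := Nat.le_pow_clog (by norm_num) _
  -- Rounding the sample size up to a power of two costs at most a factor `2`.
  have hl2 : 2 ^ l ≤ 2 * T.card := by
    rcases Nat.lt_or_ge 1 T.card with h1 | h1
    · have h2 := Nat.pow_pred_clog_lt_self (b := 2) (by norm_num) h1
      rw [← hl] at h2
      have h3 : 0 < l := Nat.clog_pos (by norm_num) h1
      obtain ⟨k, hk⟩ : ∃ k, l = k + 1 := ⟨l - 1, by omega⟩
      rw [hk] at h2 ⊢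
      simp only [Nat.pred_eq_sub_one, Nat.add_sub_cancel] at h2
      rw [pow_succ]
      omega
    · have h2 : T.card = 1 := by omega
      simp [hl, h2]
  have hl2' : (2 : ℝ) ^ l ≤ 2 * T.card := by exact_mod_cast hl2
  have hgm : ∀ s', Measurable fun D : Fin n → Episode S A H =>
      clippedGap C b m ε V h.succ D s' := fun s' =>
    measurable_const.max (measurable_const.min ((measurable_padValue _ _).sub_const _))
  have hgB : ∀ (D : Fin n → Episode S A H) s', |clippedGap C b m ε V h.succ D s'| ≤ ε :=
    fun D s' => abs_le.2 ⟨le_max_left _ _, max_le (by linarith) (min_le_left _ _)⟩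
  -- Clipping is `1`-Lipschitz, so the clipped difference inherits the stability of the estimate;
  -- the reference `V` is fixed and drops out.
  have hgβ : ∀ i ∈ T, ∀ (D : Fin n → Episode S A H) (e : Episode S A H) (s' : S),
      |clippedGap C b m ε V h.succ (Function.update D i e) s' -
        clippedGap C b m ε V h.succ D s'| ≤ β := by
    intro i _ D e s'
    refine le_trans ?_ (abs_padValue_update_sub_le (C := C) (D := D) hm hb hbm i e h.succ s')
    unfold clippedGap
    have e1 : padValue C b m (Function.update D i e) h.succ s' - padValue C b m D h.succ s' =
      (padValue C b m (Function.update D i e) h.succ s' - V s') -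
        (padValue C b m D h.succ s' - V s') := by ring
    rw [e1]
    refine (abs_max_sub_max_le_max _ _ _ _).trans ?_
    rw [sub_self, abs_zero, max_eq_right (abs_nonneg _)]
    refine (abs_min_sub_min_le_max _ _ _ _).trans ?_
    rw [sub_self, abs_zero, max_eq_right (abs_nonneg _)]
  have hlaw : ∀ i ∈ T, ∀ f : S → ℝ, ∫ e, f (e.1 h.succ) ∂(κ i) =
      ∑ s', M.trans h s a s' * f s' := by
    intro i hi f
    rw [hT i hi]
    have := M.integral_cond_step hpos (q := fun _ s' => f s') (fun _ => measurable_const)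
      (B := ∑ s', |f s'|) fun _ s' =>
        Finset.single_le_sum (f := fun s' => |f s'|) (fun _ _ => abs_nonneg _) (Finset.mem_univ s')
    refine this.trans ?_
    exact M.stepMean_state h s a f
  have main := measureReal_stable_sum_le (ν := κ) (M.trans_mem h s a) (measurable_state h.succ) hlaw
    hgm hε hgB hβ0 hgβ hx hTpos hl1
  refine le_trans (measureReal_mono ?_) (main.trans ?_)
  · rintro D ⟨hD, hv⟩
    rw [Set.mem_ofPred_eq] at hD hv ⊢
    have e1 : sampleSum D h s a (fun _ s' => clippedGap C b m ε V h.succ D s') -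
        count D h s a * M.transMean h s a (clippedGap C b m ε V h.succ D) =
        ∑ i ∈ T, dev (M.trans h s a) (fun e : Episode S A H => e.1 h.succ)
          (clippedGap C b m ε V h.succ D) (D i) := by
      rw [← sampleSum_sub, sampleSum, hv]
      rfl
    rw [e1] at hD
    refine lt_of_le_of_lt ?_ hD.2
    rw [count, hv]
    gcongr
  · have : (2 : ℝ) * T.card ≤ 2 * n := by
      have : (T.card : ℝ) ≤ n := by exact_mod_cast hTn
      linarith
    gcongr
    exact hl2'.trans this

end StableEvent

/-! ### Bellman recursions and performance as accumulated reward. -/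

noncomputable section Values

variable {S A : Type*} [Fintype S] [Fintype A] {H : ℕ}

lemma Model.value_last (M : Model S A H) (π : Policy S A H) : M.value π (Fin.last H) =
    fun _ => 0 := by
  simp [Model.value]

lemma Model.value_castSucc (M : Model S A H) (π : Policy S A H) (h : Fin H) :
    M.value π h.castSucc = fun s => ∑ a, π.prob h s a *
      (M.meanReward h s a + M.transMean h s a (M.value π h.succ)) := by
  simp [Model.value]

lemma Model.optValue_last (M : Model S A H) : M.optValue (Fin.last H) = fun _ => 0 := by
  simp [Model.optValue]

lemma Model.optValue_castSucc (M : Model S A H) (h : Fin H) :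
    M.optValue h.castSucc = fun s => ⨆ a, (M.meanReward h s a +
      M.transMean h s a (M.optValue h.succ)) := by
  simp [Model.optValue]

lemma Model.meanReward_nonneg (M : Model S A H) (h : Fin H) (s : S) (a : A) :
    0 ≤ M.meanReward h s a := integral_nonneg fun x => x.2.1

lemma Model.meanReward_le_one (M : Model S A H) (h : Fin H) (s : S) (a : A) :
    M.meanReward h s a ≤ 1 := by
  have := M.rewardLaw_prob h s a
  exact (abs_le.1 (abs_integral_le_of_abs_le (P := M.rewardLaw h s a) (f := fun x : I => (x : ℝ))
    (B := 1) fun x => abs_le.2 ⟨by linarith [x.2.1], x.2.2⟩)).2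

lemma Model.transMean_mono (M : Model S A H) (h : Fin H) (s : S) (a : A) {U V : S → ℝ}
    (hUV : ∀ s, U s ≤ V s) : M.transMean h s a U ≤ M.transMean h s a V :=
  Finset.sum_le_sum fun s' _ => mul_le_mul_of_nonneg_left (hUV s') ((M.trans_mem h s a).1 s')

lemma Model.transMean_const (M : Model S A H) (h : Fin H) (s : S) (a : A) (c : ℝ) :
    M.transMean h s a (fun _ => c) = c := by
  simp only [Model.transMean]
  rw [← Finset.sum_mul, (M.trans_mem h s a).2, one_mul]

lemma Model.transMean_sub (M : Model S A H) (h : Fin H) (s : S) (a : A) (U V : S → ℝ) :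
    M.transMean h s a (fun s => U s - V s) = M.transMean h s a U - M.transMean h s a V := by
  simp [Model.transMean, mul_sub, Finset.sum_sub_distrib]

lemma Model.transMean_add_const (M : Model S A H) (h : Fin H) (s : S) (a : A) (V : S → ℝ) (c : ℝ) :
    M.transMean h s a (fun s => V s + c) = M.transMean h s a V + c := by
  simp only [Model.transMean, mul_add, Finset.sum_add_distrib]
  rw [← Finset.sum_mul, (M.trans_mem h s a).2, one_mul]

lemma Model.transMean_mem (M : Model S A H) (h : Fin H) (s : S) (a : A) {V : S → ℝ} {x y : ℝ}
    (hV : ∀ s, V s ∈ Set.Icc x y) : M.transMean h s a V ∈ Set.Icc x y := by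
  have h1 := M.transMean_mono h s a fun s => (hV s).1
  have h2 := M.transMean_mono h s a fun s => (hV s).2
  rw [M.transMean_const] at h1 h2
  exact ⟨h1, h2⟩

lemma Model.value_mem (M : Model S A H) (π : Policy S A H) (h : Fin (H + 1)) (s : S) :
    M.value π h s ∈ Set.Icc 0 ((H : ℝ) - (h : ℕ)) := by
  induction h using Fin.reverseInduction generalizing s with
  | last => simp [M.value_last]
  | cast h ih =>
    have e : ∀ a, M.meanReward h s a + M.transMean h s a (M.value π h.succ) ∈
        Set.Icc 0 ((H : ℝ) - (h : ℕ)) := fun a => by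
      have h1 := M.transMean_mem h s a ih
      have h2 := M.meanReward_nonneg h s a
      have h3 := M.meanReward_le_one h s a
      rw [Set.mem_Icc] at h1 ⊢
      simp only [Fin.val_succ, Nat.cast_add, Nat.cast_one] at h1
      constructor <;> linarith
    rw [M.value_castSucc]
    refine ⟨Finset.sum_nonneg fun a _ => mul_nonneg ((π.prob_mem h s).1 a) (e a).1, ?_⟩
    calc _ ≤ ∑ a, π.prob h s a * ((H : ℝ) - (h : ℕ)) := Finset.sum_le_sum fun a _ =>
          mul_le_mul_of_nonneg_left (e a).2 ((π.prob_mem h s).1 a)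
      _ = _ := by rw [← Finset.sum_mul, (π.prob_mem h s).2, one_mul]; rfl

lemma sum_mul_le_ciSup {p f : A → ℝ} (hp : p ∈ stdSimplex ℝ A) : ∑ a, p a * f a ≤ ⨆ a, f a := by
  calc _ ≤ ∑ a, p a * ⨆ a, f a := Finset.sum_le_sum fun a _ =>
        mul_le_mul_of_nonneg_left (le_ciSup (Set.finite_range f).bddAbove a) (hp.1 a)
    _ = _ := by rw [← Finset.sum_mul, hp.2, one_mul]

lemma Model.value_le_optValue (M : Model S A H) (π : Policy S A H) (h : Fin (H + 1)) (s : S) :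
    M.value π h s ≤ M.optValue h s := by
  induction h using Fin.reverseInduction generalizing s with
  | last => simp [M.value_last, M.optValue_last]
  | cast h ih =>
    rw [M.value_castSucc, M.optValue_castSucc]
    refine le_trans (Finset.sum_le_sum fun a _ => mul_le_mul_of_nonneg_left ?_
      ((π.prob_mem h s).1 a)) (sum_mul_le_ciSup (π.prob_mem h s))
    have := M.transMean_mono h s a ih
    linarith

lemma Model.optValue_mem [Nonempty A] (M : Model S A H) (h : Fin (H + 1)) (s : S) :
    M.optValue h s ∈ Set.Icc 0 ((H : ℝ) - (h : ℕ)) := by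
  induction h using Fin.reverseInduction generalizing s with
  | last => simp [M.optValue_last]
  | cast h ih =>
    have e : ∀ a, M.meanReward h s a + M.transMean h s a (M.optValue h.succ) ∈
        Set.Icc 0 ((H : ℝ) - (h : ℕ)) := fun a => by
      have h1 := M.transMean_mem h s a ih
      have h2 := M.meanReward_nonneg h s a
      have h3 := M.meanReward_le_one h s a
      rw [Set.mem_Icc] at h1 ⊢
      simp only [Fin.val_succ, Nat.cast_add, Nat.cast_one] at h1
      constructor <;> linarith
    rw [M.optValue_castSucc]
    exact ⟨(e (Classical.arbitrary A)).1.trans (le_ciSup (f := fun a => M.meanReward h s a +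
      M.transMean h s a (M.optValue h.succ)) (Set.finite_range _).bddAbove _),
      ciSup_le fun a => (e a).2⟩

lemma MDP.perf_mem (M : MDP S A H) (π : Policy S A H) : M.perf π ∈ Set.Icc 0 (H : ℝ) := by
  have h : ∀ s, M.value π 0 s ∈ Set.Icc 0 (H : ℝ) := fun s => by
    have := M.toModel.value_mem π 0 s
    simpa using this
  refine ⟨Finset.sum_nonneg fun s _ => mul_nonneg (M.init_mem.1 s) (h s).1, ?_⟩
  calc _ ≤ ∑ s, M.init s * (H : ℝ) := Finset.sum_le_sum fun s _ =>
        mul_le_mul_of_nonneg_left (h s).2 (M.init_mem.1 s)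
    _ = _ := by rw [← Finset.sum_mul, M.init_mem.2, one_mul]

/-- A function of the state that decreases by at most `b` in expectation along each step is bounded
by the expected total of `b`. -/
lemma MDP.sum_init_mul_le (M : MDP S A H) (π : Policy S A H) (W : Fin (H + 1) → S → ℝ)
    (b : Fin H → S → A → ℝ) (hlast : ∀ s, W (Fin.last H) s ≤ 0)
    (hW : ∀ h s, W h.castSucc s ≤ ∑ a, π.prob h s a * (b h s a + M.transMean h s a (W h.succ))) :
    ∑ s, M.init s * W 0 s ≤ ∑ h, ∑ s, ∑ a, M.occ π h s a * b h s a := by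
  set f : Fin (H + 1) → ℝ := fun h => ∑ s, M.stateOcc π h s * W h s with hf
  have step : ∀ h : Fin H, f h.castSucc ≤ ∑ s, ∑ a, M.occ π h s a * b h s a + f h.succ := by
    intro h
    have e : f h.succ = ∑ s, ∑ a, M.occ π h s a * M.transMean h s a (W h.succ) := by
      simp only [hf, M.stateOcc_succ, Finset.sum_mul, Model.transMean, Finset.mul_sum, MDP.occ]
      rw [Finset.sum_comm]
      refine Finset.sum_congr rfl fun s _ => ?_
      rw [Finset.sum_comm]
      exact Finset.sum_congr rfl fun a _ => Finset.sum_congr rfl fun s' _ => by ring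
    rw [e, ← Finset.sum_add_distrib]
    refine Finset.sum_le_sum fun s _ => ?_
    refine (mul_le_mul_of_nonneg_left (hW h s) (M.stateOcc_nonneg π _ s)).trans (le_of_eq ?_)
    rw [← Finset.sum_add_distrib, Finset.mul_sum]
    exact Finset.sum_congr rfl fun a _ => by rw [MDP.occ]; ring
  have h1 := Fin.sum_univ_castSucc f
  have h2 := Fin.sum_univ_succ f
  have h3 : ∑ h : Fin H, f h.castSucc ≤
      ∑ h : Fin H, (∑ s, ∑ a, M.occ π h s a * b h s a) + ∑ h : Fin H, f h.succ := by
    rw [← Finset.sum_add_distrib]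
    exact Finset.sum_le_sum fun h _ => step h
  have h4 : f (Fin.last H) ≤ 0 := Finset.sum_nonpos fun s _ =>
    mul_nonpos_of_nonneg_of_nonpos (M.stateOcc_nonneg π _ s) (hlast s)
  have h5 : ∑ s, M.init s * W 0 s = f 0 := rfl
  linarith

/-- For `W` the value function the potential inequality is an equality; applying it to `W` and to
`-W` gives both directions. -/
lemma MDP.perf_eq (M : MDP S A H) (π : Policy S A H) :
    M.perf π = ∑ h, ∑ s, ∑ a, M.occ π h s a * M.meanReward h s a := by
  refine le_antisymm (M.sum_init_mul_le π (M.value π) M.meanReward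
    (fun s => by rw [Model.value_last]) fun h s => by rw [Model.value_castSucc]) ?_
  have := M.sum_init_mul_le π (fun h s => -M.value π h s) (fun h s a => -M.meanReward h s a)
    (fun s => by simp [Model.value_last]) fun h s => by
      rw [Model.value_castSucc, ← Finset.sum_neg_distrib]
      refine le_of_eq (Finset.sum_congr rfl fun a _ => ?_)
      simp only [Model.transMean, mul_neg, Finset.sum_neg_distrib]
      ring
  simp only [mul_neg, Finset.sum_neg_distrib] at this
  exact neg_le_neg_iff.1 this

end Values

/-! ### Values in the augmented model. -/

noncomputable section Augmented

variable {S A : Type*} [Fintype S] [DecidableEq S] [DecidableEq A] {H : ℕ}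
  (M : Model S A H) (K : Fin H → Finset (S × A)) (h : Fin H) (s : S) (a : A)

lemma Model.augment_meanReward_none : (M.augment K).meanReward h none a = 0 := by
  simp [Model.augment, Model.meanReward]

lemma Model.augment_meanReward_some : (M.augment K).meanReward h (some s) a =
    if (s, a) ∈ K h then M.meanReward h s a else 0 := by
  by_cases hs : (s, a) ∈ K h <;> simp [Model.augment, Model.meanReward, hs]

lemma Model.augment_transMean_none (V : Option S → ℝ) :
    (M.augment K).transMean h none a V = V none := by
  simp [Model.augment, Model.transMean, Fintype.sum_option]

lemma Model.augment_transMean_some (V : Option S → ℝ) : (M.augment K).transMean h (some s) a V =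
    if (s, a) ∈ K h then M.transMean h s a (fun s' => V (some s')) else V none := by
  by_cases hs : (s, a) ∈ K h <;> simp [Model.augment, Model.transMean, hs, Fintype.sum_option]

lemma Model.augment_stepVar_some (hs : (s, a) ∈ K h) (V : Option S → ℝ) :
    (M.augment K).stepVar h (some s) a V = M.stepVar h s a (fun s' => V (some s')) := by
  simp only [Model.stepVar, Model.augment_transMean_some, hs, if_true]
  simp [Model.augment, hs, Fintype.sum_option]

variable [Fintype A]

lemma Model.augment_value_none (π : Policy (Option S) A H) (h : Fin (H + 1)) :
    (M.augment K).value π h none = 0 := by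
  induction h using Fin.reverseInduction with
  | last => simp [Model.value_last]
  | cast h ih =>
    simp [Model.value_castSucc, Model.augment_meanReward_none, Model.augment_transMean_none, ih]

lemma Model.augment_value_some (π : Policy (Option S) A H) :
    (M.augment K).value π h.castSucc (some s) = ∑ a, π.prob h (some s) a *
      if (s, a) ∈ K h then M.meanReward h s a +
        M.transMean h s a (fun s' => (M.augment K).value π h.succ (some s')) else 0 := by
  rw [Model.value_castSucc]
  refine Finset.sum_congr rfl fun a _ => ?_
  rw [Model.augment_meanReward_some, Model.augment_transMean_some, Model.augment_value_none]
  split_ifs <;> simp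

lemma Model.augment_optValue_none (h : Fin (H + 1)) : (M.augment K).optValue h none = 0 := by
  induction h using Fin.reverseInduction with
  | last => simp [Model.optValue_last]
  | cast h ih =>
    simp [Model.optValue_castSucc, Model.augment_meanReward_none, Model.augment_transMean_none, ih]

lemma Model.augment_optValue_some : (M.augment K).optValue h.castSucc (some s) = ⨆ a,
      if (s, a) ∈ K h then M.meanReward h s a +
        M.transMean h s a (fun s' => (M.augment K).optValue h.succ (some s')) else 0 := by
  rw [Model.optValue_castSucc]
  refine iSup_congr fun a => ?_
  rw [Model.augment_meanReward_some, Model.augment_transMean_some, Model.augment_optValue_none]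
  split_ifs <;> simp

/-- Absorption replaces nonnegative future rewards by zero. -/
lemma Model.augment_value_le_value (π : Policy (Option S) A H) (h : Fin (H + 1)) (s : S) :
    (M.augment K).value π h (some s) ≤ M.value π.restrict h s := by
  induction h using Fin.reverseInduction generalizing s with
  | last => simp [Model.value_last]
  | cast h ih =>
    rw [Model.augment_value_some, Model.value_castSucc]
    refine Finset.sum_le_sum fun a _ => mul_le_mul_of_nonneg_left ?_ ((π.prob_mem h (some s)).1 a)
    have h1 := M.transMean_mono h s a ih
    have h2 := M.meanReward_nonneg h s a
    have h3 := (M.transMean_mem h s a fun s' => M.value_mem π.restrict h.succ s').1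
    split_ifs <;> linarith

end Augmented

/-! ### Occupancies in the augmented model and the cost of leaving the trackable sets. -/

noncomputable section AugmentedMDP

variable {S A : Type*} [Fintype S] [Fintype A] [DecidableEq S] [DecidableEq A] {H : ℕ}
  (M : MDP S A H) (K : Fin H → Finset (S × A)) (π : Policy (Option S) A H)

lemma MDP.augment_stateOcc_some (h : Fin H) (s' : S) :
    (M.augment K).stateOcc π h.succ (some s') = ∑ s, ∑ a,
      if (s, a) ∈ K h then (M.augment K).occ π h (some s) a * M.trans h s a s' else 0 := by
  rw [MDP.stateOcc_succ, Fintype.sum_option]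
  have h1 : ∑ a, (M.augment K).stateOcc π h.castSucc none * π.prob h none a *
      (M.augment K).trans h none a (some s') = 0 :=
    Finset.sum_eq_zero fun a _ => by simp [MDP.augment, Model.augment]
  rw [h1, zero_add]
  refine Finset.sum_congr rfl fun s _ => Finset.sum_congr rfl fun a _ => ?_
  by_cases hs : (s, a) ∈ K h <;> simp [MDP.occ, MDP.augment, Model.augment, hs]

/-- On the original states the augmented flow is the original one with the transitions from unknown
pairs deleted; nothing returns from the extra states. -/
lemma MDP.augment_stateOcc_le (h : Fin (H + 1)) (s : S) :
    (M.augment K).stateOcc π h (some s) ≤ M.stateOcc π.restrict h s := by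
  induction h using Fin.induction generalizing s with
  | zero => exact le_of_eq rfl
  | succ h ih =>
    rw [MDP.augment_stateOcc_some, MDP.stateOcc_succ]
    refine Finset.sum_le_sum fun u _ => Finset.sum_le_sum fun a _ => ?_
    have h1 := (M.trans_mem h u a).1 s
    have h2 : (M.augment K).occ π h (some u) a ≤
        M.stateOcc π.restrict h.castSucc u * π.restrict.prob h u a :=
      mul_le_mul_of_nonneg_right (ih u) ((π.prob_mem h _).1 a)
    have h3 := (M.augment K).occ_nonneg π h (some u) a
    split_ifs
    · exact mul_le_mul_of_nonneg_right h2 h1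
    · exact mul_nonneg (h3.trans h2) h1

lemma MDP.augment_occ_le (h : Fin H) (s : S) (a : A) :
    (M.augment K).occ π h (some s) a ≤ M.occ π.restrict h s a :=
  mul_le_mul_of_nonneg_right (M.augment_stateOcc_le K π _ s) ((π.prob_mem h _).1 a)

lemma MDP.augment_stateOcc_none_succ (h : Fin H) : (M.augment K).stateOcc π h.succ none =
    (M.augment K).stateOcc π h.castSucc none +
      ∑ x ∈ Finset.univ \ K h, (M.augment K).occ π h (some x.1) x.2 := by
  rw [MDP.stateOcc_succ, Fintype.sum_option]
  congr 1
  · calc _ = ∑ a, (M.augment K).stateOcc π h.castSucc none * π.prob h none a :=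
          Finset.sum_congr rfl fun a _ => by simp [MDP.augment, Model.augment]
      _ = _ := by rw [← Finset.mul_sum, (π.prob_mem h none).2, mul_one]
  · rw [← Fintype.sum_prod_type' (f := fun s a => (M.augment K).stateOcc π h.castSucc (some s) *
      π.prob h (some s) a * (M.augment K).trans h (some s) a none),
      ← Finset.sum_sdiff (Finset.subset_univ (K h))]
    have : ∑ x ∈ K h, (M.augment K).stateOcc π h.castSucc (some x.1) *
      π.prob h (some x.1) x.2 * (M.augment K).trans h (some x.1) x.2 none = 0 :=
      Finset.sum_eq_zero fun x hx => by simp [MDP.augment, Model.augment, hx]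
    rw [this, add_zero]
    refine Finset.sum_congr rfl fun x hx => ?_
    have hx' : x ∉ K h := (Finset.mem_sdiff.1 hx).2
    simp [MDP.occ, MDP.augment, Model.augment, hx']

/-- The extra state is absorbing and starts empty, so its mass is the accumulated inflow from
unknown pairs. -/
lemma MDP.augment_stateOcc_none (h : Fin (H + 1)) : (M.augment K).stateOcc π h none =
    ∑ t ∈ Finset.univ.filter (fun t : Fin H => t.castSucc < h),
      ∑ x ∈ Finset.univ \ K t, (M.augment K).occ π t (some x.1) x.2 := by
  induction h using Fin.induction with
  | zero => simp [MDP.stateOcc, MDP.augment]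
  | succ h ih =>
    have e : Finset.univ.filter (fun t : Fin H => t.castSucc < h.succ) =
        insert h (Finset.univ.filter fun t : Fin H => t.castSucc < h.castSucc) := by
      ext t
      simp only [Finset.mem_filter_univ, Finset.mem_insert, Fin.castSucc_lt_succ_iff,
        Fin.castSucc_lt_castSucc_iff]
      exact le_iff_eq_or_lt
    rw [MDP.augment_stateOcc_none_succ, ih, e, Finset.sum_insert (by simp), add_comm]

lemma MDP.perf_restrict_ge : (M.augment K).perf π ≤ M.perf π.restrict := by
  unfold MDP.perf
  rw [Fintype.sum_option]
  have : (M.augment K).init none = 0 := rfl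
  rw [this, zero_mul, zero_add]
  exact Finset.sum_le_sum fun s _ => mul_le_mul_of_nonneg_left
    (M.toModel.augment_value_le_value K π 0 s) (M.init_mem.1 s)

lemma MDP.augment_sum_occ (h : Fin H) : (M.augment K).stateOcc π h.succ none +
    ∑ x ∈ K h, (M.augment K).occ π h (some x.1) x.2 = 1 := by
  have h1 := (M.augment K).sum_occ π h
  rw [Fintype.sum_option, ← Fintype.sum_prod_type' (f := fun s a =>
    (M.augment K).occ π h (some s) a), ← Finset.sum_sdiff (Finset.subset_univ (K h))] at h1
  have h2 : ∑ a, (M.augment K).occ π h none a = (M.augment K).stateOcc π h.castSucc none := by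
    simp only [MDP.occ, ← Finset.mul_sum, (π.prob_mem h none).2, mul_one]
  rw [MDP.augment_stateOcc_none_succ]
  linarith

/-- Comparison step by step. Both occupancies have total mass one and the augmented one is smaller
on known pairs, so the mass earning reward only in the original process at step `h` is exactly the
mass of the extra state after step `h`. Each unit of it earns at most `1`. The layer index `h.succ`
arises because leaving at step `h` already forfeits the reward of step `h`. -/
lemma MDP.perf_restrict_le : M.perf π.restrict ≤
    (M.augment K).perf π + ∑ h : Fin H, (M.augment K).stateOcc π h.succ none := by
  rw [MDP.perf_eq, MDP.perf_eq, ← Finset.sum_add_distrib]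
  refine Finset.sum_le_sum fun h _ => ?_
  have e1 : ∑ s, ∑ a, (M.augment K).occ π h s a * (M.augment K).meanReward h s a =
      ∑ x ∈ K h, (M.augment K).occ π h (some x.1) x.2 * M.meanReward h x.1 x.2 := by
    rw [Fintype.sum_option]
    have : ∀ a, (M.augment K).meanReward h none a = 0 :=
      M.toModel.augment_meanReward_none K h
    simp only [this, mul_zero, Finset.sum_const_zero, zero_add]
    rw [← Fintype.sum_prod_type' (f := fun s a =>
      (M.augment K).occ π h (some s) a * (M.augment K).meanReward h (some s) a)]
    rw [← Finset.sum_filter_add_sum_filter_not _ (· ∈ K h), Finset.filter_mem_eq_inter,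
      Finset.univ_inter]
    rw [Finset.sum_congr rfl (g := fun x => (M.augment K).occ π h (some x.1) x.2 *
      M.meanReward h x.1 x.2) fun x hx => by
        rw [show (M.augment K).meanReward h (some x.1) x.2 = _ from
          M.toModel.augment_meanReward_some K h x.1 x.2, if_pos hx]]
    rw [add_eq_left]
    refine Finset.sum_eq_zero fun x hx => ?_
    rw [show (M.augment K).meanReward h (some x.1) x.2 = _ from
          M.toModel.augment_meanReward_some K h x.1 x.2, if_neg (Finset.mem_filter.1 hx).2,
          mul_zero]
  have h1 := M.sum_occ π.restrict h
  have h2 := M.augment_sum_occ K π h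
  rw [e1]
  rw [← Fintype.sum_prod_type' (f := fun s a => M.occ π.restrict h s a)] at h1
  rw [← Fintype.sum_prod_type' (f := fun s a => M.occ π.restrict h s a * M.meanReward h s a)]
  rw [← Finset.sum_sdiff (Finset.subset_univ (K h))] at h1 ⊢
  have h3 : ∑ x ∈ Finset.univ \ K h, M.occ π.restrict h x.1 x.2 * M.meanReward h x.1 x.2 ≤
      ∑ x ∈ Finset.univ \ K h, M.occ π.restrict h x.1 x.2 := Finset.sum_le_sum fun x _ =>
    mul_le_of_le_one_right (M.occ_nonneg _ _ _ _) (M.meanReward_le_one _ _ _)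
  have h4 : ∑ x ∈ K h, (M.occ π.restrict h x.1 x.2 - (M.augment K).occ π h (some x.1) x.2) *
        M.meanReward h x.1 x.2 ≤
      ∑ x ∈ K h, (M.occ π.restrict h x.1 x.2 - (M.augment K).occ π h (some x.1) x.2) :=
    Finset.sum_le_sum fun x _ =>
    mul_le_of_le_one_right (sub_nonneg.2 (M.augment_occ_le K π _ _ _)) (M.meanReward_le_one _ _ _)
  simp only [sub_mul, Finset.sum_sub_distrib] at h4
  linarith

lemma MDP.IsOptimal.optPerf_le {M : MDP S A H} {π : Policy S A H} (hπ : M.IsOptimal π) :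
    M.optPerf ≤ M.perf π :=
  have : Nonempty (Policy S A H) := ⟨π⟩
  ciSup_le hπ

section MinOcc

variable (μ : Policy S A H)

lemma MDP.finite_occ : {p : ℝ | 0 < p ∧ ∃ h s a, p = M.occ μ h s a}.Finite := by
  refine (Set.finite_range fun x : Fin H × S × A => M.occ μ x.1 x.2.1 x.2.2).subset ?_
  rintro p ⟨-, h, s, a, rfl⟩
  exact ⟨(h, s, a), rfl⟩

lemma MDP.minOcc_le {h : Fin H} {s : S} {a : A} (hpos : 0 < M.occ μ h s a) :
    M.minOcc μ ≤ M.occ μ h s a :=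
  csInf_le ⟨0, fun _ hp => hp.1.le⟩ ⟨hpos, h, s, a, rfl⟩

lemma MDP.minOcc_pos (hH : 0 < H) : 0 < M.minOcc μ := by
  have hne : {p : ℝ | 0 < p ∧ ∃ h s a, p = M.occ μ h s a}.Nonempty := by
    have h1 := M.sum_occ μ ⟨0, hH⟩
    obtain ⟨s, -, hs⟩ := Finset.exists_ne_zero_of_sum_ne_zero (h1.trans_ne one_ne_zero)
    obtain ⟨a, -, ha⟩ := Finset.exists_ne_zero_of_sum_ne_zero hs
    exact ⟨_, (M.occ_nonneg μ _ s a).lt_of_ne' ha, _, s, a, rfl⟩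
  exact (hne.csInf_mem (M.finite_occ μ)).1

end MinOcc

end AugmentedMDP

/-! ### The plug-in model and the padded algorithm agree once counts exceed `m`. -/

noncomputable section EmpiricalModel

variable {S A : Type*} [Fintype S] [Fintype A] [DecidableEq S] [DecidableEq A] {H n : ℕ}
  {m : ℝ} {D : Fin n → Episode S A H} {h : Fin H} {s : S} {a : A}

lemma padCount_of_le (hmN : m ≤ count D h s a) : padCount m D h s a = count D h s a :=
  max_eq_left hmN

lemma padMean_const (hN : 0 < count D h s a) (hmN : m ≤ count D h s a) (c : ℝ) :
    padMean m D h s a (fun _ _ => c) = c := by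
  have : (count D h s a : ℝ) ≠ 0 := by exact_mod_cast hN.ne'
  rw [padMean, padCount_of_le hmN, sampleSum, Finset.sum_const, nsmul_eq_mul]
  exact mul_div_cancel_left₀ c this

/-- Bias–variance decomposition. It requires weights of total mass one, hence a positive count that
is not padded. -/
lemma padMean_sq_sub (hN : 0 < count D h s a) (hmN : m ≤ count D h s a) (q : I → S → ℝ) (c : ℝ) :
    padMean m D h s a (fun r s' => (q r s' - c) ^ 2) =
      padVar m D h s a q + (padMean m D h s a q - c) ^ 2 := by
  have e : padMean m D h s a (fun r s' => (q r s' - c) ^ 2) =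
      padMean m D h s a (fun r s' => q r s' ^ 2) - 2 * c * padMean m D h s a q +
        padMean m D h s a (fun _ _ => c ^ 2) := by
    simp only [padMean, sampleSum]
    rw [← mul_div_assoc, ← sub_div, ← add_div, Finset.mul_sum, ← Finset.sum_sub_distrib,
      ← Finset.sum_add_distrib]
    congr 1
    exact Finset.sum_congr rfl fun τ _ => by ring
  rw [e, padMean_const hN hmN, padVar]
  ring

variable [Nonempty S]

lemma integral_empModel_reward (hN : 0 < count D h s a) (hmN : m ≤ count D h s a) (f : I → ℝ) :
    ∫ r, f r ∂((empModel D).rewardLaw h s a) = padMean m D h s a (fun r _ => f r) := by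
  rw [show (empModel D).rewardLaw h s a =
    (count D h s a : ENNReal)⁻¹ • ∑ τ ∈ visits D h s a, Measure.dirac ((D τ).2.2 h) from
    if_pos hN, integral_smul_measure, integral_finsetSum_measure]
  · simp only [integral_dirac]
    rw [padMean, padCount_of_le hmN, sampleSum, smul_eq_mul, div_eq_inv_mul]
    simp
  · intro τ _
    exact integrable_dirac (by simp)

lemma empModel_transMean (hN : 0 < count D h s a) (hmN : m ≤ count D h s a) (V : S → ℝ) :
    (empModel D).transMean h s a V = padMean m D h s a (fun _ s' => V s') := by
  rw [padMean, padCount_of_le hmN, sampleSum, Model.transMean,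
    ← Finset.sum_fiberwise' (visits D h s a) (fun τ => (D τ).1 h.succ) V, Finset.sum_div]
  refine Finset.sum_congr rfl fun s' _ => ?_
  simp only [empModel, hN, if_true, Finset.sum_const, nsmul_eq_mul]
  ring

lemma empModel_meanReward (hN : 0 < count D h s a) (hmN : m ≤ count D h s a) :
    (empModel D).meanReward h s a = padMean m D h s a (fun r _ => (r : ℝ)) :=
  integral_empModel_reward hN hmN _

lemma empModel_stepVar (hN : 0 < count D h s a) (hmN : m ≤ count D h s a) (V : S → ℝ) :
    (empModel D).stepVar h s a V = padStepVar m D h s a V := by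
  have := (empModel D).rewardLaw_prob h s a
  have e1 := integral_empModel_reward hN hmN fun r =>
    ((r : ℝ) - (empModel D).meanReward h s a) ^ 2
  have e2 : ∑ s', (empModel D).trans h s a s' * (V s' - (empModel D).transMean h s a V) ^ 2 =
      padVar m D h s a (fun _ s' => V s') := (empModel_transMean hN hmN _).trans (by
    rw [padMean_sq_sub hN hmN (fun _ s' => V s'), empModel_transMean hN hmN, sub_self]
    ring)
  rw [padMean_sq_sub hN hmN (fun r _ => (r : ℝ)), empModel_meanReward hN hmN, sub_self] at e1
  rw [Model.stepVar, variance_reward, padStepVar]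
  have e3 : ∫ x : I, (x : ℝ) ∂((empModel D).rewardLaw h s a) =
    padMean m D h s a (fun r _ => (r : ℝ)) := empModel_meanReward hN hmN
  rw [e3, e1, e2]
  ring

lemma mem_visited : (s, a) ∈ visited D h ↔ 0 < count D h s a := by simp [visited]

variable {C : Fin H → Finset (S × A)} {δ : ℝ}

lemma qBar_none {V : Option S → ℝ} (hV : V none = 0) : qBar D δ h V none a = 0 := by
  have : (0 : ℝ) ≤ (H : ℝ) - (h : ℕ) := sub_nonneg.2 (by exact_mod_cast h.2.le)
  simp [qBar, empDagger, Model.augment_meanReward_none, Model.augment_transMean_none, hV, penalty,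
    augCount, this]

/-- Both sides vanish at unknown pairs, since `V none = 0`; at known pairs the count is positive and
at least `m`, so padding is inactive. -/
lemma qBar_some (hvis : visited D = C) (hmN : (s, a) ∈ C h → m ≤ count D h s a)
    {V : Option S → ℝ} (hV : V none = 0) :
    qBar D δ h V (some s) a = padQBar C (iota S A H δ) m D h (fun s' => V (some s')) s a := by
  have hH : (0 : ℝ) ≤ (H : ℝ) - (h : ℕ) := sub_nonneg.2 (by exact_mod_cast h.2.le)
  subst hvis
  by_cases hs : (s, a) ∈ visited D h
  · have hN := mem_visited.1 hs
    have hm := hmN hs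
    have h1 : 1 ≤ augCount D h (some s) a := hN
    rw [qBar, padQBar, if_pos hs, padQ, penalty, if_pos h1]
    simp only [empDagger, Model.augment_meanReward_some, Model.augment_transMean_some, hs, if_true]
    rw [Model.augment_stepVar_some _ _ _ _ _ hs, empModel_stepVar hN hm, empModel_meanReward hN hm,
      empModel_transMean hN hm, padCount_of_le hm]
    rfl
  · have h1 : ¬ 1 ≤ augCount D h (some s) a := fun h => hs (mem_visited.2 h)
    rw [qBar, padQBar, if_neg hs, penalty, if_neg h1]
    simp [empDagger, Model.augment_meanReward_some, Model.augment_transMean_some, hs, hV, hH]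

/-- The output of the algorithm is greedy with respect to the padded value estimates, as soon as the
padding has no effect. -/
lemma IsAPVIOutput.padValue_eq [Nonempty A] {πhat : Policy (Option S) A H}
    (hπ : IsAPVIOutput D δ πhat) (hvis : visited D = C)
    (hmN : ∀ h s a, (s, a) ∈ C h → m ≤ count D h s a) (h : Fin H) (s : S) :
    padValue C (iota S A H δ) m D h.castSucc s = ∑ a, πhat.prob h (some s) a *
      padQBar C (iota S A H δ) m D h (padValue C (iota S A H δ) m D h.succ) s a := by
  obtain ⟨V, hlast, hV⟩ := hπ
  have hnone : ∀ h, V h none = 0 := by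
    intro h
    induction h using Fin.reverseInduction with
    | last => exact hlast none
    | cast h ih =>
      rw [(hV h none).2]
      exact Finset.sum_eq_zero fun a _ => by rw [qBar_none ih, zero_mul]
  have hsome : ∀ h s, V h (some s) = padValue C (iota S A H δ) m D h s := by
    intro h
    induction h using Fin.reverseInduction with
    | last => intro s; rw [hlast, padValue_last]
    | cast h ih =>
      intro s
      have e : ∀ a, qBar D δ h (V h.succ) (some s) a =
          padQBar C (iota S A H δ) m D h (padValue C (iota S A H δ) m D h.succ) s a := fun a => by
        rw [qBar_some hvis (hmN h s a) (hnone _)]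
        simp only [ih]
      rw [padValue_castSucc]
      -- A maximizing distribution attains the supremum over actions: it is compared with the point
      -- masses. The tie-breaking rule therefore does not affect the value estimate.
      refine le_antisymm ?_ (ciSup_le fun a => ?_)
      · rw [(hV h (some s)).2]
        simp only [e]
        refine le_trans (le_of_eq ?_) (sum_mul_le_ciSup (πhat.prob_mem h (some s)))
        exact Finset.sum_congr rfl fun a _ => mul_comm _ _
      · rw [(hV h (some s)).2, ← e]
        have := (hV h (some s)).1 _ (single_mem_stdSimplex ℝ a)
        simpa [Pi.single_apply] using this
  have e : ∀ a, qBar D δ h (V h.succ) (some s) a =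
      padQBar C (iota S A H δ) m D h (padValue C (iota S A H δ) m D h.succ) s a := fun a => by
    rw [qBar_some hvis (hmN h s a) (hnone _)]
    simp only [hsome]
  rw [← hsome, (hV h (some s)).2]
  exact Finset.sum_congr rfl fun a _ => by rw [e, mul_comm]

end EmpiricalModel

/-! ### From deviation events to comparisons of empirical and true variances. -/

noncomputable section Consequences

variable {S A : Type*} [Fintype S] [Fintype A] [DecidableEq S] [DecidableEq A] {H n : ℕ}
  {M : Model S A H} {m : ℝ} {D : Fin n → Episode S A H} {h : Fin H} {s : S} {a : A}
  {q : I → S → ℝ} {B t : ℝ}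

lemma padMean_add (q q' : I → S → ℝ) : padMean m D h s a (fun r s' => q r s' + q' r s') =
    padMean m D h s a q + padMean m D h s a q' := by
  simp only [padMean, sampleSum, Finset.sum_add_distrib, add_div]

lemma padMean_mono (hm : 0 < m) {q q' : I → S → ℝ} (h0 : ∀ r s', q r s' ≤ q' r s') :
    padMean m D h s a q ≤ padMean m D h s a q' :=
  div_le_div_of_nonneg_right (Finset.sum_le_sum fun _ _ => h0 _ _) (padCount_pos hm).le

lemma sqrt_count_mul_div (hN : 0 < count D h s a) {x y : ℝ} (hx : 0 ≤ x) :
    Real.sqrt (2 * (count D h s a * x) * y) / count D h s a =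
      Real.sqrt x * Real.sqrt (2 * y / count D h s a) := by
  have hN' : (0 : ℝ) < count D h s a := by exact_mod_cast hN
  have e : 2 * (count D h s a * x) * y = x * (2 * y / count D h s a) * (count D h s a : ℝ) ^ 2 := by
    field_simp
  rw [← Real.sqrt_mul hx, div_eq_iff hN'.ne', e, Real.sqrt_mul' _ (sq_nonneg _),
    Real.sqrt_sq hN'.le]

/-- A bound for the sum of deviations gives a bound for the deviation of the mean. -/
lemma padMean_sub_le (hN : 0 < count D h s a) (hmN : m ≤ count D h s a) {c v : ℝ} (hv : 0 ≤ v)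
    (hc : sampleSum D h s a q - count D h s a * c ≤
      Real.sqrt (2 * (count D h s a * v) * t) + B * t) :
    padMean m D h s a q - c ≤
      Real.sqrt v * Real.sqrt (2 * t / count D h s a) + B * t / count D h s a := by
  have hN' : (0 : ℝ) < count D h s a := by exact_mod_cast hN
  have := div_le_div_of_nonneg_right hc hN'.le
  rw [add_div, sqrt_count_mul_div hN hv, sub_div, mul_div_cancel_left₀ _ hN'.ne'] at this
  rwa [padMean, padCount_of_le hmN]

lemma le_padMean_sub (hN : 0 < count D h s a) (hmN : m ≤ count D h s a) {c v : ℝ} (hv : 0 ≤ v)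
    (hc : count D h s a * c - sampleSum D h s a q ≤
      Real.sqrt (2 * (count D h s a * v) * t) + B * t) :
    c - padMean m D h s a q ≤
      Real.sqrt v * Real.sqrt (2 * t / count D h s a) + B * t / count D h s a := by
  have hN' : (0 : ℝ) < count D h s a := by exact_mod_cast hN
  have := div_le_div_of_nonneg_right hc hN'.le
  rw [add_div, sqrt_count_mul_div hN hv, sub_div, mul_div_cancel_left₀ _ hN'.ne'] at this
  rwa [padMean, padCount_of_le hmN]

lemma StepConc.abs_padMean_sub_le (sc : StepConc M D h s a q B t) (hN : 0 < count D h s a)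
    (hmN : m ≤ count D h s a) : |padMean m D h s a q - M.stepMean h s a q| ≤
      Real.sqrt (M.stepSq h s a q) * Real.sqrt (2 * t / count D h s a) + B * t / count D h s a := by
  have h1 := padMean_sub_le hN hmN (M.stepSq_nonneg h s a q) sc.upper
  have h2 := le_padMean_sub hN hmN (M.stepSq_nonneg h s a q) sc.lower
  rw [abs_le]
  constructor <;> linarith

/-- The empirical variance is at most the empirical second moment about the true mean, whose mixed
term `√v * √(t / N)` is split by the inequality of arithmetic and geometric means. -/
lemma StepConc.padVar_le (sc : StepConc M D h s a q B t) (hN : 0 < count D h s a)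
    (hmN : m ≤ count D h s a) (hB : 0 ≤ B) (ht : 0 ≤ t) :
    padVar m D h s a q ≤ 2 * M.stepSq h s a q + 2 * B ^ 2 * (t / count D h s a) := by
  have hN' : (0 : ℝ) < count D h s a := by exact_mod_cast hN
  have hv := M.stepSq_nonneg h s a q
  have h1 := padMean_sub_le hN hmN (mul_nonneg (sq_nonneg B) hv) sc.sq_upper
  rw [padMean_sq_sub hN hmN] at h1
  set v := M.stepSq h s a q
  set N : ℝ := (count D h s a : ℝ)
  rw [Real.sqrt_mul (sq_nonneg B), Real.sqrt_sq hB] at h1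
  simp only [mul_div_assoc] at h1
  have h2 : Real.sqrt v ^ 2 = v := Real.sq_sqrt hv
  have h3 : Real.sqrt (2 * t / N) ^ 2 = 2 * t / N := Real.sq_sqrt (by positivity)
  have h4 : 2 * t / N = 2 * (t / N) := by ring
  have h5 : 0 ≤ t / N := by positivity
  rw [h4] at h3
  set x := Real.sqrt v
  set y := Real.sqrt (2 * (t / N))
  nlinarith [sq_nonneg (x - B * y / 2), sq_nonneg (padMean m D h s a q - M.stepMean h s a q),
    mul_nonneg (sq_nonneg B) h5]

/-- With `u = B √(t / N)`, the true variance exceeds the empirical one by at most a quadratic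
expression in `u` plus a multiple of `u √v`. For `√v > 5 u` this is less than the gap between `v`
and `(√v - 5 u)²`. The linear form keeps coefficient `1` in front of the empirical standard
deviation, which the sharp pessimism constant requires. -/
lemma StepConc.sqrt_stepSq_le (sc : StepConc M D h s a q B t) (hN : 0 < count D h s a)
    (hmN : m ≤ count D h s a) (hB : 0 ≤ B) (ht : 0 ≤ t) (hvB : M.stepSq h s a q ≤ B ^ 2) :
    Real.sqrt (M.stepSq h s a q) ≤
      Real.sqrt (padVar m D h s a q) + 5 * B * Real.sqrt (t / count D h s a) := by
  have hN' : (0 : ℝ) < count D h s a := by exact_mod_cast hN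
  have hv := M.stepSq_nonneg h s a q
  have h1 := le_padMean_sub hN hmN (mul_nonneg (sq_nonneg B) hv) sc.sq_lower
  rw [padMean_sq_sub hN hmN] at h1
  have h6 := sc.abs_padMean_sub_le hN hmN
  set v := M.stepSq h s a q
  set N : ℝ := (count D h s a : ℝ)
  rw [Real.sqrt_mul (sq_nonneg B), Real.sqrt_sq hB] at h1
  have h2 : Real.sqrt v ^ 2 = v := Real.sq_sqrt hv
  have h4 : Real.sqrt (2 * (t / N)) ≤ 3 / 2 * Real.sqrt (t / N) := by
    rw [Real.sqrt_mul (by norm_num)]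
    exact mul_le_mul_of_nonneg_right (Real.sqrt_le_iff.2 (by norm_num)) (Real.sqrt_nonneg _)
  have h5 : Real.sqrt (t / N) ^ 2 = t / N := Real.sq_sqrt (by positivity)
  have hxB : Real.sqrt v ≤ B := Real.sqrt_le_iff.2 ⟨hB, hvB⟩
  have hx0 := Real.sqrt_nonneg v
  have hz0 := Real.sqrt_nonneg (t / N)
  have hp0 := Real.sqrt_nonneg (padVar m D h s a q)
  simp only [mul_div_assoc] at h1 h6
  set x := Real.sqrt v
  set w := Real.sqrt (2 * (t / N))
  rw [← h5] at h1 h6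
  set z := Real.sqrt (t / N)
  -- For `z ≥ 1`, and again for `x ≤ 5 B z`, the claim is trivial; `z < 1` allows `z²` to be
  -- replaced by `z` in the bias.
  rcases le_or_gt 1 z with hz | hz
  · nlinarith
  rcases le_or_gt x (5 * B * z) with hxz | hxz
  · linarith
  rw [← sub_le_iff_le_add]
  refine Real.le_sqrt_of_sq_le ?_
  set u := B * z with hu
  have hu0 : 0 ≤ u := mul_nonneg hB hz0
  have e1 : |padMean m D h s a q - M.stepMean h s a q| ≤ 5 / 2 * u := by
    refine h6.trans ?_
    have a1 : x * w ≤ B * (3 / 2 * z) :=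
      mul_le_mul hxB h4 (Real.sqrt_nonneg _) hB
    have a2 : B * z ^ 2 ≤ B * z := mul_le_mul_of_nonneg_left (by nlinarith) hB
    rw [hu]
    linarith
  have e2 : (padMean m D h s a q - M.stepMean h s a q) ^ 2 ≤ (5 / 2 * u) ^ 2 := by
    rw [← sq_abs]
    exact pow_le_pow_left₀ (abs_nonneg _) e1 2
  have e3 : B * x * w ≤ 3 / 2 * (u * x) := by
    calc _ ≤ B * x * (3 / 2 * z) := mul_le_mul_of_nonneg_left h4 (mul_nonneg hB hx0)
      _ = _ := by rw [hu]; ring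
  have e4 : B ^ 2 * z ^ 2 = u ^ 2 := by rw [hu]; ring
  rw [e4] at h1
  have e5 : 5 * B * z = 5 * u := by rw [hu]; ring
  rw [e5] at hxz ⊢
  nlinarith

end Consequences

/-! ### The true one-step variance as a seminorm. -/

noncomputable section TrueVariance

variable {S A : Type*} [Fintype S] {H : ℕ} (M : Model S A H) (h : Fin H) (s : S) (a : A)

lemma Model.sum_trans_mul_sq (V : S → ℝ) :
    ∑ s', M.trans h s a s' * (V s' - M.transMean h s a V) ^ 2 =
      wvar Finset.univ (M.trans h s a) V := by
  have e : ∀ s', M.trans h s a s' * (V s' - M.transMean h s a V) ^ 2 =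
      M.trans h s a s' * V s' ^ 2 - 2 * M.transMean h s a V * (M.trans h s a s' * V s') +
        M.trans h s a s' * M.transMean h s a V ^ 2 := fun s' => by ring
  rw [Finset.sum_congr rfl fun s' _ => e s', Finset.sum_add_distrib, Finset.sum_sub_distrib,
    ← Finset.mul_sum, ← Finset.sum_mul, (M.trans_mem h s a).2, wvar]
  simp only [Model.transMean]
  ring

lemma Model.stepVar_nonneg (V : S → ℝ) : 0 ≤ M.stepVar h s a V :=
  add_nonneg (ProbabilityTheory.variance_nonneg _ _) (Finset.sum_nonneg fun s' _ =>
    mul_nonneg ((M.trans_mem h s a).1 s') (sq_nonneg _))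

lemma Model.sqrt_stepVar_le_add {U V : S → ℝ} {ε : ℝ} (hε : 0 ≤ ε)
    (hUV : ∀ s, |U s - V s| ≤ ε) :
    Real.sqrt (M.stepVar h s a U) ≤ Real.sqrt (M.stepVar h s a V) + ε := by
  unfold Model.stepVar
  rw [M.sum_trans_mul_sq, M.sum_trans_mul_sq]
  exact sqrt_add_le_add (ProbabilityTheory.variance_nonneg _ _)
    (wvar_nonneg (fun s' _ => (M.trans_mem h s a).1 s') (M.trans_mem h s a).2.le _) hε
    (sqrt_wvar_le_add (fun s' _ => (M.trans_mem h s a).1 s') (M.trans_mem h s a).2.le hε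
      fun s' _ => hUV s')

lemma Model.stepVar_eq_stepSq (V : S → ℝ) : M.stepVar h s a V =
    M.stepSq h s a (fun r _ => (r : ℝ)) + M.stepSq h s a (fun _ s' => V s') := by
  rw [Model.stepSq_reward, Model.stepSq_state, Model.stepVar]

end TrueVariance

/-! ### Deterministic consequences of concentration at one pair. -/

noncomputable section GoodPair

variable {S A : Type*} [Fintype S] [Fintype A] [DecidableEq S] [DecidableEq A] {H n : ℕ}

/-- The data at the pair `(s, a)` in step `h` concentrate: the pair is visited about `p` times and
the empirical means of the relevant functions of the reward and the next state are close to the true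
means.  Here `U` and `V` are fixed functions. -/
structure GoodPair (M : Model S A H) (K : Fin H → Finset (S × A)) (D : Fin n → Episode S A H)
    (b m ε x p : ℝ) (U V : S → ℝ) (h : Fin H) (s : S) (a : A) : Prop where
  count_ge : p / 2 ≤ count D h s a
  reward : StepConc M D h s a (fun r _ => (r : ℝ)) 1 (10 * b)
  lowerState : StepConc M D h s a (fun _ s' => U s') H (10 * b)
  lower : StepConc M D h s a (fun r s' => (r : ℝ) + U s') H (10 * b)
  optState : StepConc M D h s a (fun _ s' => V s') H (10 * b)
  opt : StepConc M D h s a (fun r s' => (r : ℝ) + V s') H (10 * b)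
  opt_sharp : sampleSum D h s a (fun r s' => (r : ℝ) + V s') -
      count D h s a * M.stepMean h s a (fun r s' => (r : ℝ) + V s') ≤
    Real.sqrt (2 * (count D h s a * M.stepSq h s a (fun r s' => (r : ℝ) + V s')) * (2 * b)) +
      H * (2 * b)
  gap : |sampleSum D h s a (fun _ s' => clippedGap K b m ε V h.succ D s') -
      count D h s a * M.transMean h s a (clippedGap K b m ε V h.succ D)| ≤
    Real.sqrt (2 * (count D h s a * ε ^ 2) * x) +
      2 * count D h s a * (3 * (H : ℝ) ^ 2 * (8 + 18 * b) / m) * (2 + 2 * Nat.clog 2 n * x)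

variable {M : Model S A H} {K : Fin H → Finset (S × A)} {D : Fin n → Episode S A H}
    {b m ε x p : ℝ} {U V : S → ℝ} {h : Fin H} {s : S} {a : A}

lemma sqrt_const_mul_div_le {c k y N : ℝ} (hk : 0 ≤ k) (hc : c ≤ k ^ 2) (hy : 0 ≤ y) (hN : 0 ≤ N) :
    Real.sqrt (c * y / N) ≤ k * Real.sqrt (y / N) := by
  rw [mul_div_assoc]
  refine Real.sqrt_le_iff.2 ⟨mul_nonneg hk (Real.sqrt_nonneg _), ?_⟩
  rw [mul_pow, Real.sq_sqrt (div_nonneg hy hN)]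
  exact mul_le_mul_of_nonneg_right hc (div_nonneg hy hN)

lemma GoodPair.count_bounds (g : GoodPair M K D b m ε x p U V h s a) (hm : 1 ≤ m)
    (hmp : 2 * m ≤ p) : 0 < count D h s a ∧ m ≤ count D h s a := by
  have h1 := g.count_ge
  have h2 : m ≤ count D h s a := by linarith
  refine ⟨?_, h2⟩
  have : (0 : ℝ) < count D h s a := by linarith
  exact_mod_cast this

lemma one_le_horizon (h : Fin H) : (1 : ℝ) ≤ H := by exact_mod_cast (Nat.zero_le _).trans_lt h.2

lemma padStepVar_le (hm : 0 < m) {V' : S → ℝ} (hV' : ∀ s, V' s ∈ Set.Icc 0 (H : ℝ)) :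
    Real.sqrt (padStepVar m D h s a V') ≤ 3 / 2 * H := by
  have hH := one_le_horizon h
  refine Real.sqrt_le_iff.2 ⟨by positivity, ?_⟩
  have h1 : padVar m D h s a (fun r _ => (r : ℝ)) ≤ 1 ^ 2 := padVar_le hm
    fun r _ => abs_le.2 ⟨by linarith [r.2.1], r.2.2⟩
  have h2 : padVar m D h s a (fun _ s' => V' s') ≤ (H : ℝ) ^ 2 := padVar_le hm
    fun _ s' => abs_le.2 ⟨by linarith [(hV' s').1], (hV' s').2⟩
  unfold padStepVar
  nlinarith

/-- The penalized estimate is close to the one-step optimal estimate. -/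
lemma GoodPair.abs_padQ_sub_le (g : GoodPair M K D b m ε x p U V h s a) (hm : 1 ≤ m)
    (hmp : 2 * m ≤ p) (hb : 0 ≤ b) (hbm : b ≤ m) (hV : ∀ r : I, ∀ s', (r : ℝ) + V s' ∈ Set.Icc 0 (H : ℝ))
    {V' : S → ℝ} (hV' : ∀ s, V' s ∈ Set.Icc 0 (H : ℝ)) {e : ℝ} (he : ∀ s, |V' s - V s| ≤ e)
    (he0 : 0 ≤ e) :
    |padQ b m D h V' s a - (M.meanReward h s a + M.transMean h s a V)| ≤
      e + 32 * H * Real.sqrt (b / m) := by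
  obtain ⟨hN, hmN⟩ := g.count_bounds hm hmp
  have hm0 : 0 < m := one_pos.trans_le hm
  have hH := one_le_horizon h
  have h1 : |padMean m D h s a (fun _ s' => V' s' - V s')| ≤ e :=
    abs_padMean_le hm0 he0 fun _ s' => he s'
  have h2 := g.opt.abs_padMean_sub_le hN hmN
  have h3 := padStepVar_le (D := D) (h := h) (s := s) (a := a) hm0 hV'
  have hv : Real.sqrt (M.stepSq h s a (fun r s' => (r : ℝ) + V s')) ≤ H :=
    Real.sqrt_le_iff.2 ⟨by positivity, M.stepSq_le h s a (fun r s' => (hV r s').1)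
      fun r s' => (hV r s').2⟩
  rw [Model.stepMean_add, padMean_add] at h2
  rw [padMean_sub] at h1
  rw [padQ, padCount_of_le hmN, sqrt_mul_div (padStepVar_nonneg hm0 _)]
  set N : ℝ := (count D h s a : ℝ)
  have hN' : 0 < N := hm0.trans_le hmN
  have hr2 : Real.sqrt (b / N) ^ 2 = b / N := Real.sq_sqrt (by positivity)
  have hrR : Real.sqrt (b / N) ≤ Real.sqrt (b / m) :=
    Real.sqrt_le_sqrt (div_le_div_of_nonneg_left hb hm0 hmN)
  have hR1 : Real.sqrt (b / m) ≤ 1 := Real.sqrt_le_iff.2 ⟨zero_le_one, by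
    rw [one_pow]; exact (div_le_one hm0).2 hbm⟩
  have hs : Real.sqrt (2 * (10 * b) / N) ≤ 9 / 2 * Real.sqrt (b / N) := by
    rw [← mul_assoc]
    exact sqrt_const_mul_div_le (by norm_num) (by norm_num) hb hN'.le
  have hr0 := Real.sqrt_nonneg (b / N)
  have e1 : (H : ℝ) * (10 * b) / N = 10 * H * Real.sqrt (b / N) ^ 2 := by rw [hr2]; ring
  have e2 : 14 * (H : ℝ) * b / N = 14 * H * Real.sqrt (b / N) ^ 2 := by rw [hr2]; ring
  rw [e1] at h2
  rw [e2]
  set r := Real.sqrt (b / N)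
  set R := Real.sqrt (b / m)
  have h4 : Real.sqrt (M.stepSq h s a (fun r s' => (r : ℝ) + V s')) *
      Real.sqrt (2 * (10 * b) / N) ≤ H * (9 / 2 * r) :=
    mul_le_mul hv hs (Real.sqrt_nonneg _) (by positivity)
  have h5 : Real.sqrt (padStepVar m D h s a V') * r ≤ 3 / 2 * H * r :=
    mul_le_mul_of_nonneg_right h3 hr0
  have h6 : 0 ≤ Real.sqrt (padStepVar m D h s a V') * r := mul_nonneg (Real.sqrt_nonneg _) hr0
  have h7 : r ^ 2 ≤ r := by nlinarith
  have h8 : H * r ^ 2 ≤ H * r := mul_le_mul_of_nonneg_left h7 (by positivity)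
  have h9 : H * r ≤ H * R := mul_le_mul_of_nonneg_left hrR (by positivity)
  have h10 : 0 ≤ H * r ^ 2 := by positivity
  -- With `r ≤ 1` the contributions are `9 / 2 + 10` from Bernstein and `3 + 14` from the penalty,
  -- altogether at most `32`.
  have h11 := h2.trans (add_le_add_left h4 _)
  rw [abs_le] at h1 h11 ⊢
  constructor <;> linarith

/-- The penalized estimate is almost pessimistic. -/
lemma GoodPair.padQ_le (g : GoodPair M K D b m ε x p U V h s a) (hm : 1 ≤ m)
    (hmp : 2 * m ≤ p) (hb : 0 ≤ b)
    (hV0 : ∀ s, 0 ≤ V s) (hV : ∀ r : I, ∀ s', (r : ℝ) + V s' ∈ Set.Icc 0 (H : ℝ))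
    (hε : ∀ s, |padValue K b m D h.succ s - V s| ≤ ε) (hε0 : 0 ≤ ε) (hx : 0 ≤ x) :
    padQ b m D h (padValue K b m D h.succ) s a ≤
      M.meanReward h s a + M.transMean h s a (padValue K b m D h.succ) +
      (ε * Real.sqrt (2 * x / m) +
        2 * (3 * (H : ℝ) ^ 2 * (8 + 18 * b) / m) * (2 + 2 * Nat.clog 2 n * x) +
        2 * ε * Real.sqrt (b / m) + 52 * H * (b / m)) := by
  obtain ⟨hN, hmN⟩ := g.count_bounds hm hmp
  have hm0 : 0 < m := one_pos.trans_le hm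
  have hH := one_le_horizon h
  have hN' : (0 : ℝ) < count D h s a := hm0.trans_le hmN
  -- The a priori bound `hε` makes the clipping inactive.
  have hgap : clippedGap K b m ε V h.succ D = fun s' => padValue K b m D h.succ s' - V s' := by
    funext s'
    have := abs_le.1 (hε s')
    rw [clippedGap, min_eq_right this.2, max_eq_right this.1]
  have h1 := (abs_le.1 g.gap).2
  rw [hgap] at h1
  have h2 : padMean m D h s a (fun _ s' => padValue K b m D h.succ s' - V s') -
      M.transMean h s a (fun s' => padValue K b m D h.succ s' - V s') ≤
      ε * Real.sqrt (2 * x / count D h s a) +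
        2 * (3 * (H : ℝ) ^ 2 * (8 + 18 * b) / m) * (2 + 2 * Nat.clog 2 n * x) := by
    have := div_le_div_of_nonneg_right h1 hN'.le
    rw [add_div, sqrt_count_mul_div hN (sq_nonneg ε), Real.sqrt_sq hε0, sub_div,
      mul_div_cancel_left₀ _ hN'.ne'] at this
    rw [padMean, padCount_of_le hmN]
    refine this.trans (le_of_eq ?_)
    field_simp
  -- The confidence level `2 * b` is chosen so that `√(2 * (2 b)) = 2 √b` matches the coefficient of
  -- the penalty exactly; larger levels appear only in lower-order terms.
  have h3 := padMean_sub_le hN hmN (M.stepSq_nonneg h s a _) g.opt_sharp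
  rw [Model.stepMean_add, padMean_add, Model.stepSq_add] at h3
  rw [Model.transMean_sub, padMean_sub] at h2
  have hVH : ∀ s', V s' ≤ H := fun s' => by
    have := (hV 0 s').2
    simpa using this
  have h4 := g.reward.sqrt_stepSq_le hN hmN zero_le_one (by positivity)
    (M.stepSq_le h s a (fun r _ => r.2.1) fun r _ => r.2.2)
  have h5 := g.optState.sqrt_stepSq_le hN hmN (by positivity) (by positivity)
    (M.stepSq_le h s a (fun _ s' => hV0 s') fun _ s' => hVH s')
  have h6 : Real.sqrt (M.stepVar h s a V) ≤ Real.sqrt (padStepVar m D h s a V) +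
      5 * H * Real.sqrt (10 * b / count D h s a) + 5 * 1 * Real.sqrt (10 * b / count D h s a) := by
    rw [Model.stepVar_eq_stepSq, padStepVar]
    refine (sqrt_add_le_add (M.stepSq_nonneg h s a _) (padVar_nonneg hm0 _) (by positivity)
      h5).trans ?_
    have := sqrt_add_le_add (padVar_nonneg (D := D) (h := h) (s := s) (a := a) hm0
      (fun _ s' => V s')) (padVar_nonneg hm0 _) (by positivity) h4
    rw [add_comm, add_comm (padVar m D h s a fun _ s' => V s')] at this
    linarith
  have h7 := sqrt_padStepVar_le_add (D := D) (h := h) (s := s) (a := a) hm0 hε0 (V := V)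
    (V' := padValue K b m D h.succ) fun s => by rw [abs_sub_comm]; exact hε s
  rw [padQ, padCount_of_le hmN, sqrt_mul_div (padStepVar_nonneg hm0 _)]
  set N : ℝ := (count D h s a : ℝ)
  have hr2 : Real.sqrt (b / N) ^ 2 = b / N := Real.sq_sqrt (by positivity)
  have hbN : b / N ≤ b / m := div_le_div_of_nonneg_left hb hm0 hmN
  have hrR : Real.sqrt (b / N) ≤ Real.sqrt (b / m) := Real.sqrt_le_sqrt hbN
  have hxR : Real.sqrt (2 * x / N) ≤ Real.sqrt (2 * x / m) :=
    Real.sqrt_le_sqrt (div_le_div_of_nonneg_left (by positivity) hm0 hmN)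
  have hs : Real.sqrt (10 * b / N) ≤ 16 / 5 * Real.sqrt (b / N) :=
    sqrt_const_mul_div_le (by norm_num) (by norm_num) hb hN'.le
  have hs2 : Real.sqrt (2 * (2 * b) / N) ≤ 2 * Real.sqrt (b / N) := by
    rw [← mul_assoc]
    exact sqrt_const_mul_div_le (by norm_num) (by norm_num) hb hN'.le
  have hr0 := Real.sqrt_nonneg (b / N)
  have e1 : (H : ℝ) * (2 * b) / N = 2 * H * (b / N) := by ring
  have e2 : 14 * (H : ℝ) * b / N = 14 * H * (b / N) := by ring
  rw [e1] at h3
  rw [e2]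
  set r := Real.sqrt (b / N)
  -- The true standard deviation at `V` is traded for the empirical one at the estimate, which is
  -- what the penalty contains. The cost is `ε` for changing the function and `32 H r` for changing
  -- the law.
  have h8 : Real.sqrt (M.stepVar h s a V) ≤
      Real.sqrt (padStepVar m D h s a (padValue K b m D h.succ)) + ε + 32 * H * r := by
    have a1 : (H : ℝ) * Real.sqrt (10 * b / N) ≤ H * (16 / 5 * r) :=
      mul_le_mul_of_nonneg_left hs (by positivity)
    have a2 : r ≤ H * r := le_mul_of_one_le_left hr0 hH
    linarith
  have h9 : Real.sqrt (M.stepVar h s a V) * Real.sqrt (2 * (2 * b) / N) ≤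
      (Real.sqrt (padStepVar m D h s a (padValue K b m D h.succ)) + ε + 32 * H * r) * (2 * r) :=
    mul_le_mul h8 hs2 (Real.sqrt_nonneg _) (by positivity)
  have h10 : ε * r ≤ ε * Real.sqrt (b / m) := mul_le_mul_of_nonneg_left hrR hε0
  have h11 : ε * Real.sqrt (2 * x / N) ≤ ε * Real.sqrt (2 * x / m) :=
    mul_le_mul_of_nonneg_left hxR hε0
  have h12 : H * (b / N) ≤ H * (b / m) := mul_le_mul_of_nonneg_left hbN (by positivity)
  -- The coefficient `52` is `64 + 2 - 14`: variance exchange plus Bernstein remainder minus the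
  -- second penalty term.
  have h13 : (H : ℝ) * r * r = H * (b / N) := by rw [← hr2]; ring
  nlinarith

/-- The penalized estimate is almost monotone in the value function, and therefore bounded from
below by the estimate for a fixed function. -/
lemma GoodPair.le_padQ (g : GoodPair M K D b m ε x p U V h s a) (hm : 1 ≤ m)
    (hmp : 2 * m ≤ p) (hb : 0 ≤ b) (hU0 : ∀ s, 0 ≤ U s) {V' : S → ℝ} (hUV : ∀ s, U s ≤ V' s)
    (hV' : ∀ s, V' s ≤ H) :
    M.meanReward h s a + M.transMean h s a U -
      (11 * Real.sqrt (M.stepVar h s a U * b / p) + 80 * H * (b / p)) ≤ padQ b m D h V' s a := by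
  obtain ⟨hN, hmN⟩ := g.count_bounds hm hmp
  have hm0 : 0 < m := one_pos.trans_le hm
  have hH := one_le_horizon h
  have hN' : (0 : ℝ) < count D h s a := hm0.trans_le hmN
  have hsv := M.stepVar_nonneg h s a U
  have h1 := (abs_le.1 (g.lower.abs_padMean_sub_le hN hmN)).1
  rw [Model.stepMean_add, padMean_add, Model.stepSq_add] at h1
  have h2 := g.reward.padVar_le hN hmN zero_le_one (by positivity)
  have h3 := g.lowerState.padVar_le hN hmN (by positivity) (by positivity)
  have h4 : padStepVar m D h s a U ≤ 2 * M.stepVar h s a U + 4 * H ^ 2 *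
      (10 * b / count D h s a) := by
    rw [Model.stepVar_eq_stepSq, padStepVar]
    have : (1 : ℝ) * (10 * b / count D h s a) ≤ H ^ 2 * (10 * b / count D h s a) :=
      mul_le_mul_of_nonneg_right (by nlinarith) (by positivity)
    linarith
  -- The reward variances cancel; only the variances of the value functions differ.
  have h5 : padStepVar m D h s a V' - padStepVar m D h s a U ≤ 2 * H *
      (padMean m D h s a (fun _ s' => V' s') - padMean m D h s a (fun _ s' => U s')) := by
    rw [← padMean_sub, padStepVar, padStepVar, padVar_eq (fun _ s' => V' s'),
      padVar_eq (fun _ s' => U s'), add_sub_add_left_eq_sub, padMean_eq]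
    exact wvar_sub_le (fun _ _ => padWeight_nonneg hm0) (fun _ _ => hU0 _) (fun _ _ => hUV _)
      fun _ _ => hV' _
  have h5' : 0 ≤ padMean m D h s a (fun _ s' => V' s') - padMean m D h s a (fun _ s' => U s') :=
    sub_nonneg.2 (padMean_mono hm0 fun _ s' => hUV s')
  rw [padQ, padCount_of_le hmN, sqrt_mul_div (padStepVar_nonneg hm0 _), sqrt_mul_div hsv]
  have hp0 : 0 < p := by linarith
  have hpN : b / count D h s a ≤ 2 * (b / p) := by
    rw [← mul_div_assoc, div_le_div_iff₀ hN' hp0]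
    have := mul_le_mul_of_nonneg_left g.count_ge hb
    linarith
  set N : ℝ := (count D h s a : ℝ)
  have hr2 : Real.sqrt (b / N) ^ 2 = b / N := Real.sq_sqrt (by positivity)
  have hr0 := Real.sqrt_nonneg (b / N)
  have hs : Real.sqrt (2 * (10 * b) / N) ≤ 9 / 2 * Real.sqrt (b / N) := by
    rw [← mul_assoc]
    exact sqrt_const_mul_div_le (by norm_num) (by norm_num) hb hN'.le
  have hrp : Real.sqrt (b / N) ≤ 71 / 50 * Real.sqrt (b / p) := by
    refine (Real.sqrt_le_sqrt hpN).trans ?_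
    rw [← mul_div_assoc]
    exact sqrt_const_mul_div_le (by norm_num) (by norm_num) hb hp0.le
  have e1 : (H : ℝ) * (10 * b) / N = 10 * H * (b / N) := by ring
  have e2 : 14 * (H : ℝ) * b / N = 14 * H * (b / N) := by ring
  have e3 : 10 * b / N = 10 * (b / N) := by ring
  rw [e1] at h1
  rw [e3] at h4
  rw [e2]
  rw [← hr2] at h1 h4 hpN ⊢
  set r := Real.sqrt (b / N)
  have hy2 := Real.sq_sqrt (padStepVar_nonneg (D := D) (h := h) (s := s) (a := a) hm0 V')
  have hx2 := Real.sq_sqrt (padStepVar_nonneg (D := D) (h := h) (s := s) (a := a) hm0 U)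
  have hw2 := Real.sq_sqrt hsv
  rw [← hy2, ← hx2] at h5
  rw [← hx2, ← hw2] at h4
  have hy0 := Real.sqrt_nonneg (padStepVar m D h s a V')
  have hx0 := Real.sqrt_nonneg (padStepVar m D h s a U)
  have hw0 := Real.sqrt_nonneg (M.stepVar h s a U)
  set y := Real.sqrt (padStepVar m D h s a V')
  set z := Real.sqrt (padStepVar m D h s a U)
  set w := Real.sqrt (M.stepVar h s a U)
  set δ := padMean m D h s a (fun _ s' => V' s') - padMean m D h s a (fun _ s' => U s') with hδ
  -- If the standard deviation grows, then `(y - z)² ≤ y² - z² ≤ 2 H δ`, so `2 (y - z) r ≤ δ + 2 H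
  -- r²`. The larger penalty at `V'` is paid for by the larger empirical mean `δ`, up to `2 H r²`.
  have h6 : 2 * (y * r) ≤ 2 * (z * r) + δ + 2 * H * r ^ 2 := by
    rcases le_or_gt y z with hyz | hyz
    · have := mul_le_mul_of_nonneg_right hyz hr0
      have : 0 ≤ H * r ^ 2 := by positivity
      linarith
    · have a1 : (y - z) ^ 2 ≤ 2 * H * δ := by nlinarith
      have a2 : (2 * H * (2 * ((y - z) * r))) ≤ (y - z) ^ 2 + (2 * H * r) ^ 2 := by
        nlinarith [sq_nonneg ((y - z) - 2 * H * r)]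
      have a3 : 2 * H * (2 * ((y - z) * r)) ≤ 2 * H * (δ + 2 * H * r ^ 2) := by linarith
      have a4 := le_of_mul_le_mul_left a3 (by positivity)
      linarith
  -- From `z² ≤ 2 w² + 40 H² r²`, since `(3 / 2)² ≥ 2` and `(13 / 2)² ≥ 40`.
  have h7 : z ≤ 3 / 2 * w + 13 / 2 * (H * r) := by
    have hHr : 0 ≤ H * r := by positivity
    refine (abs_le_of_sq_le_sq' (h4.trans ?_) (by positivity)).2
    have := mul_nonneg hw0 hHr
    have e : (3 / 2 * w + 13 / 2 * (H * r)) ^ 2 = 9 / 4 * w ^ 2 + 39 / 2 * (w * (H * r)) +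
      169 / 4 * (H ^ 2 * r ^ 2) := by ring
    have : 0 ≤ (H : ℝ) ^ 2 * r ^ 2 := by positivity
    rw [e]
    linarith [sq_nonneg w]
  have h8 : z * r ≤ (3 / 2 * w + 13 / 2 * (H * r)) * r := mul_le_mul_of_nonneg_right h7 hr0
  have h9 : w * Real.sqrt (2 * (10 * b) / N) ≤ w * (9 / 2 * r) := mul_le_mul_of_nonneg_left hs hw0
  have h10 : w * r ≤ w * (71 / 50 * Real.sqrt (b / p)) := mul_le_mul_of_nonneg_left hrp hw0
  have h11 : H * r ^ 2 ≤ H * (2 * (b / p)) := mul_le_mul_of_nonneg_left hpN (by positivity)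
  have h12 : 0 ≤ w * Real.sqrt (b / p) := mul_nonneg hw0 (Real.sqrt_nonneg _)
  have h13 : 0 ≤ H * (b / p) := by positivity
  rw [Real.sqrt_sq hr0]
  -- Leading term: `(9 / 2 + 3) * 71 / 50 ≤ 11`. Second term: `2 * (10 + 13 + 2 + 14) ≤ 80`, the
  -- factor `2` coming from `b / N ≤ 2 * (b / p)`.
  linarith

end GoodPair

/-! ### The deterministic lower bound and its distance from the value of the comparator. -/

noncomputable section LowerValue

variable {S A : Type*} [Fintype S] [Fintype A] [DecidableEq S] [DecidableEq A] {H n : ℕ}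

/-- The loss in one step caused by the penalty, with `p` the expected number of visits. -/
def bonus (M : Model S A H) (b p : ℝ) (U : S → ℝ) (h : Fin H) (s : S) (a : A) : ℝ :=
  11 * Real.sqrt (M.stepVar h s a U * b / p) + 80 * H * (b / p)

/-- A deterministic lower bound for the value estimates: the value of `π` in the augmented model,
with a penalty subtracted in each step. -/
def lowerValue (M : Model S A H) (K : Fin H → Finset (S × A)) (π : Policy (Option S) A H) (b : ℝ)
    (p : Fin H → S → A → ℝ) (h : Fin (H + 1)) : S → ℝ :=
  Fin.reverseInduction (motive := fun _ => S → ℝ) (fun _ => 0)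
    (fun h U s => ∑ a, π.prob h (some s) a * if (s, a) ∈ K h then
      max 0 (M.meanReward h s a + M.transMean h s a U - bonus M b (p h s a) U h s a) else 0) h

variable {M : Model S A H} {K : Fin H → Finset (S × A)} {π : Policy (Option S) A H} {b m : ℝ}
  {p : Fin H → S → A → ℝ}

lemma bonus_nonneg (hb : 0 ≤ b) {q : ℝ} (hq : 0 ≤ q) (U : S → ℝ) (h : Fin H) (s : S) (a : A) :
    0 ≤ bonus M b q U h s a := by unfold bonus; positivity

lemma lowerValue_last : lowerValue M K π b p (Fin.last H) = fun _ => 0 := by simp [lowerValue]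

lemma lowerValue_castSucc (h : Fin H) : lowerValue M K π b p h.castSucc = fun s =>
    ∑ a, π.prob h (some s) a * if (s, a) ∈ K h then max 0 (M.meanReward h s a +
      M.transMean h s a (lowerValue M K π b p h.succ) -
        bonus M b (p h s a) (lowerValue M K π b p h.succ) h s a) else 0 := by
  simp [lowerValue]

lemma lowerValue_nonneg (h : Fin (H + 1)) (s : S) : 0 ≤ lowerValue M K π b p h s := by
  induction h using Fin.reverseInduction with
  | last => simp [lowerValue_last]
  | cast h ih =>
    rw [lowerValue_castSucc]
    refine Finset.sum_nonneg fun a _ => mul_nonneg ((π.prob_mem h _).1 a) ?_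
    split_ifs
    · exact le_max_left _ _
    · exact le_rfl

lemma lowerValue_le (hb : 0 ≤ b) (hp : ∀ h s a, (s, a) ∈ K h → 0 ≤ p h s a) (h : Fin (H + 1))
    (s : S) : lowerValue M K π b p h s ≤ (M.augment K).value π h (some s) := by
  induction h using Fin.reverseInduction generalizing s with
  | last => simp [lowerValue_last, Model.value_last]
  | cast h ih =>
    rw [lowerValue_castSucc, Model.augment_value_some]
    refine Finset.sum_le_sum fun a _ => mul_le_mul_of_nonneg_left ?_ ((π.prob_mem h _).1 a)
    split_ifs with hs
    · have h1 := M.transMean_mono h s a ih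
      have h2 := M.meanReward_nonneg h s a
      have h3 := (M.transMean_mem h s a fun s' => (M.augment K).value_mem π h.succ (some s')).1
      have h4 := bonus_nonneg (M := M) hb (hp h s a hs) (lowerValue M K π b p h.succ) h s a
      exact max_le (by linarith) (by linarith)
    · exact le_rfl

lemma lowerValue_mem (hb : 0 ≤ b) (hp : ∀ h s a, (s, a) ∈ K h → 0 ≤ p h s a) (h : Fin (H + 1))
    (s : S) : lowerValue M K π b p h s ∈ Set.Icc 0 ((H : ℝ) - (h : ℕ)) :=
  ⟨lowerValue_nonneg h s, (lowerValue_le hb hp h s).trans ((M.augment K).value_mem π h _).2⟩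

lemma add_mem_of_mem_succ {V : S → ℝ} {h : Fin H}
    (hV : ∀ s, V s ∈ Set.Icc 0 ((H : ℝ) - (h.succ : ℕ))) (r : I) (s : S) :
    (r : ℝ) + V s ∈ Set.Icc 0 (H : ℝ) := by
  have h1 := hV s
  have h2 := r.2.1
  have h3 := r.2.2
  have h4 : (0 : ℝ) ≤ (h : ℕ) := Nat.cast_nonneg _
  simp only [Fin.val_succ, Nat.cast_add, Nat.cast_one, Set.mem_Icc] at h1 ⊢
  constructor <;> linarith

lemma mem_horizon_of_mem {V : S → ℝ} {h : Fin (H + 1)}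
    (hV : ∀ s, V s ∈ Set.Icc 0 ((H : ℝ) - (h : ℕ))) (s : S) : V s ∈ Set.Icc 0 (H : ℝ) :=
  ⟨(hV s).1, (hV s).2.trans (sub_le_self _ (Nat.cast_nonneg _))⟩

lemma Model.sqrt_stepVar_le {U : S → ℝ} {h : Fin H}
    (hU : ∀ s, U s ∈ Set.Icc 0 ((H : ℝ) - (h.succ : ℕ))) (s : S) (a : A) :
    Real.sqrt (M.stepVar h s a U) ≤ H := by
  refine Real.sqrt_le_iff.2 ⟨by positivity, ?_⟩
  rw [← Model.stepSq_add]
  exact M.stepSq_le h s a (fun r s' => (add_mem_of_mem_succ hU r s').1)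
    fun r s' => (add_mem_of_mem_succ hU r s').2

lemma div_le_sqrt_div (hb : 0 ≤ b) (hm : 0 < m) (hbm : b ≤ m) : b / m ≤ Real.sqrt (b / m) := by
  refine Real.le_sqrt_of_sq_le ?_
  have h1 : b / m ≤ 1 := (div_le_one hm).2 hbm
  have h2 : 0 ≤ b / m := by positivity
  nlinarith

lemma bonus_le (hb : 0 ≤ b) (hm : 0 < m) (hbm : b ≤ m) {q : ℝ} (hq : 2 * m ≤ q) {U : S → ℝ}
    {h : Fin H} (hU : ∀ s, U s ∈ Set.Icc 0 ((H : ℝ) - (h.succ : ℕ))) (s : S) (a : A) :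
    bonus M b q U h s a ≤ 91 * H * Real.sqrt (b / m) := by
  have h1 := M.sqrt_stepVar_le hU s a
  have h2 : b / q ≤ b / m := div_le_div_of_nonneg_left hb hm (by linarith)
  have h3 := Real.sqrt_le_sqrt h2
  have h4 := div_le_sqrt_div hb hm hbm
  have h5 : Real.sqrt (M.stepVar h s a U) * Real.sqrt (b / q) ≤ H * Real.sqrt (b / m) :=
    mul_le_mul h1 h3 (Real.sqrt_nonneg _) (by positivity)
  have h6 : H * (b / q) ≤ H * Real.sqrt (b / m) :=
    mul_le_mul_of_nonneg_left (h2.trans h4) (by positivity)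
  rw [bonus, sqrt_mul_div (M.stepVar_nonneg h s a U)]
  linarith

lemma sum_prob_mul_le (π : Policy (Option S) A H) (h : Fin H) (s : Option S) {f g : A → ℝ} {c : ℝ}
    (hfg : ∀ a, f a ≤ g a + c) : ∑ a, π.prob h s a * f a ≤ ∑ a, π.prob h s a * g a + c := by
  calc _ ≤ ∑ a, π.prob h s a * (g a + c) := Finset.sum_le_sum fun a _ =>
        mul_le_mul_of_nonneg_left (hfg a) ((π.prob_mem h s).1 a)
    _ = _ := by
        simp only [mul_add, Finset.sum_add_distrib]
        rw [← Finset.sum_mul, (π.prob_mem h s).2, one_mul]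

/-- A crude bound obtained by adding the worst bonus over the remaining steps. It serves only to
replace the variance at the lower bound by that at the true augmented value, where it is multiplied
by another `√(b / m)`. -/
lemma value_le_lowerValue_add (hb : 0 ≤ b) (hm : 0 < m) (hbm : b ≤ m)
    (hp : ∀ h s a, (s, a) ∈ K h → 2 * m ≤ p h s a) (h : Fin (H + 1)) (s : S) :
    (M.augment K).value π h (some s) ≤ lowerValue M K π b p h s +
      ((H : ℝ) - (h : ℕ)) * (91 * H * Real.sqrt (b / m)) := by
  have hp0 : ∀ h s a, (s, a) ∈ K h → 0 ≤ p h s a := fun h s a hs => by linarith [hp h s a hs]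
  set e := 91 * H * Real.sqrt (b / m) with he
  have he0 : 0 ≤ e := by positivity
  induction h using Fin.reverseInduction generalizing s with
  | last => simp [lowerValue_last, Model.value_last]
  | cast h ih =>
    rw [lowerValue_castSucc, Model.augment_value_some]
    refine sum_prob_mul_le π h (some s) fun a => ?_
    have hH : (0 : ℝ) ≤ (H : ℝ) - (h : ℕ) := sub_nonneg.2 (by exact_mod_cast h.2.le)
    split_ifs with hs
    · have h1 := M.transMean_mono h s a ih
      rw [M.transMean_add_const] at h1
      have h2 := bonus_le (M := M) hb hm hbm (hp h s a hs) (lowerValue_mem (M := M) (π := π)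
        hb hp0 h.succ) s a
      refine le_trans ?_ (add_le_add_left (le_max_right _ _) _)
      simp only [Fin.val_succ, Nat.cast_add, Nat.cast_one] at h1
      simp only [Fin.val_castSucc]
      linarith
    · simp only [Fin.val_castSucc]
      positivity

/-- The performance in the augmented model exceeds the lower bound by at most the sum of the
intrinsic standard deviations, up to terms of higher order. -/
lemma MDP.perf_le_lowerValue (M : MDP S A H) (hH : 0 < H) (hb : 0 ≤ b) (hm : 0 < m) (hbm : b ≤ m)
    (hp : ∀ h s a, (s, a) ∈ K h → 2 * m ≤ p h s a) :
    (M.augment K).perf π ≤ ∑ s, M.init s * lowerValue M.toModel K π b p 0 s +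
      11 * ∑ h, ∑ x ∈ K h, (M.augment K).occ π h (some x.1) x.2 *
        Real.sqrt ((M.augment K).stepVar h (some x.1) x.2 ((M.augment K).value π h.succ) * b /
          p h x.1 x.2) + 1081 * (H : ℝ) ^ 3 * (b / m) := by
  have hp0 : ∀ h s a, (s, a) ∈ K h → 0 ≤ p h s a := fun h s a hs => by linarith [hp h s a hs]
  set U := lowerValue M.toModel K π b p with hU
  -- The potential is the augmented value minus the lower bound, set to zero on the extra states; by
  -- its recursion it loses at most one bonus per step.
  have h1 := (M.augment K).sum_init_mul_le π
    (fun h s => s.elim 0 fun s => (M.augment K).value π h (some s) - U h s)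
    (fun h s a => s.elim 0 fun s => if (s, a) ∈ K h then
      bonus M.toModel b (p h s a) (U h.succ) h s a else 0)
    (by rintro (_ | s) <;> simp [hU, lowerValue_last, Model.value_last]) ?_
  · rw [Fintype.sum_option] at h1
    have e1 : ∑ s, (M.augment K).init (some s) * ((M.augment K).value π 0 (some s) - U 0 s) =
        (M.augment K).perf π - ∑ s, M.init s * U 0 s := by
      rw [MDP.perf, Fintype.sum_option]
      have : (M.augment K).init none = 0 := rfl
      rw [this, zero_mul, zero_add, ← Finset.sum_sub_distrib]
      exact Finset.sum_congr rfl fun s _ => mul_sub _ _ _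
    simp only [Option.elim_none, Option.elim_some, mul_zero, zero_add] at h1
    rw [e1] at h1
    have h2 : ∀ h : Fin H, ∑ s, ∑ a, (M.augment K).occ π h s a *
        (s.elim 0 fun s => if (s, a) ∈ K h then
          bonus M.toModel b (p h s a) (U h.succ) h s a else 0) ≤
        11 * ∑ x ∈ K h, (M.augment K).occ π h (some x.1) x.2 *
          Real.sqrt ((M.augment K).stepVar h (some x.1) x.2 ((M.augment K).value π h.succ) * b /
          p h x.1 x.2) + 1081 * (H : ℝ) ^ 2 * (b / m) := by
      intro h
      rw [Fintype.sum_option]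
      simp only [Option.elim_none, Option.elim_some, mul_zero, Finset.sum_const_zero, zero_add]
      rw [← Fintype.sum_prod_type' (f := fun s a => (M.augment K).occ π h (some s) a *
        if (s, a) ∈ K h then bonus M.toModel b (p h s a) (U h.succ) h s a else 0)]
      simp only [mul_ite, mul_zero]
      rw [← Finset.sum_filter, Finset.filter_mem_eq_inter, Finset.univ_inter]
      have h3 : ∀ x ∈ K h, (M.augment K).occ π h (some x.1) x.2 *
          bonus M.toModel b (p h x.1 x.2) (U h.succ) h x.1 x.2 ≤
          11 * ((M.augment K).occ π h (some x.1) x.2 *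
          Real.sqrt ((M.augment K).stepVar h (some x.1) x.2 ((M.augment K).value π h.succ) * b /
          p h x.1 x.2)) + (M.augment K).occ π h (some x.1) x.2 *
            (1081 * (H : ℝ) ^ 2 * (b / m)) := by
        intro x hx
        have hs : (x.1, x.2) ∈ K h := hx
        have hH1 := one_le_horizon h
        have hq := hp h x.1 x.2 hs
        have hq0 : 0 < p h x.1 x.2 := by linarith
        set q := p h x.1 x.2
        have e2 : (M.augment K).stepVar h (some x.1) x.2 ((M.augment K).value π h.succ) =
            M.stepVar h x.1 x.2 fun s' => (M.augment K).value π h.succ (some s') :=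
          M.toModel.augment_stepVar_some K h x.1 x.2 hs _
        have a1 : b / q ≤ b / m := div_le_div_of_nonneg_left hb hm (by linarith)
        have a2 := Real.sqrt_le_sqrt a1
        -- The exchange costs `91 H² √(b / m)` in standard deviation. Together with the second bonus
        -- term this gives `11 * 91 + 80 = 1081`.
        have a3 := M.toModel.sqrt_stepVar_le_add h x.1 x.2 (U := U h.succ)
          (V := fun s' => (M.augment K).value π h.succ (some s'))
          (ε := H * (91 * H * Real.sqrt (b / m))) (by positivity) fun s' => by
            have c1 := lowerValue_le (M := M.toModel) (π := π) hb hp0 h.succ s'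
            have c2 := value_le_lowerValue_add (M := M.toModel) (π := π) hb hm hbm hp h.succ s'
            have c3 : ((H : ℝ) - (h.succ : ℕ)) * (91 * H * Real.sqrt (b / m)) ≤
                H * (91 * H * Real.sqrt (b / m)) :=
              mul_le_mul_of_nonneg_right (sub_le_self _ (Nat.cast_nonneg _)) (by positivity)
            rw [abs_le]
            constructor
            · have : (M.augment K).value π h.succ (some s') =
                (M.toModel.augment K).value π h.succ (some s') := rfl
              rw [this]
              linarith
            · exact (sub_nonpos.2 c1).trans (by positivity)
        rw [← mul_assoc, mul_comm (11 : ℝ), mul_assoc, ← mul_add]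
        refine mul_le_mul_of_nonneg_left ?_ ((M.augment K).occ_nonneg _ _ _ _)
        rw [bonus, e2, sqrt_mul_div (M.stepVar_nonneg _ _ _ _),
          sqrt_mul_div (M.stepVar_nonneg _ _ _ _)]
        have a4 := mul_le_mul_of_nonneg_right a3 (Real.sqrt_nonneg (b / q))
        have a5 : (H : ℝ) ^ 2 * (Real.sqrt (b / m) * Real.sqrt (b / q)) ≤
            (H : ℝ) ^ 2 * (b / m) := by
          refine mul_le_mul_of_nonneg_left ?_ (by positivity)
          calc _ ≤ Real.sqrt (b / m) * Real.sqrt (b / m) :=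
                mul_le_mul_of_nonneg_left a2 (Real.sqrt_nonneg _)
            _ = _ := Real.mul_self_sqrt (by positivity)
        have a6 : H * (b / q) ≤ (H : ℝ) ^ 2 * (b / m) :=
          mul_le_mul (by nlinarith) a1 (by positivity) (by positivity)
        linarith
      refine (Finset.sum_le_sum h3).trans ?_
      rw [Finset.sum_add_distrib, ← Finset.mul_sum, ← Finset.sum_mul]
      -- The occupancy of the known pairs in one step is at most one, so the remainder is paid once
      -- per step.
      refine add_le_add_right (mul_le_of_le_one_left (by positivity) ?_) _
      have := M.augment_sum_occ K π h
      have := (M.augment K).stateOcc_nonneg π h.succ none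
      linarith
    have h3 := h1.trans (Finset.sum_le_sum fun h _ => h2 h)
    rw [Finset.sum_add_distrib, ← Finset.mul_sum, Finset.sum_const, Finset.card_univ,
      Fintype.card_fin, nsmul_eq_mul] at h3
    have e3 : (H : ℝ) * (1081 * (H : ℝ) ^ 2 * (b / m)) = 1081 * (H : ℝ) ^ 3 * (b / m) := by ring
    linarith
  · rintro h (_ | s)
    · refine le_of_eq (Eq.symm (Finset.sum_eq_zero fun a _ => ?_))
      rw [show (M.augment K).transMean h none a = _ from
        funext (M.toModel.augment_transMean_none K h a)]
      simp
    · simp only [Option.elim_some]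
      rw [show (M.augment K).value π h.castSucc (some s) = _ from
        M.toModel.augment_value_some K h s π, hU, lowerValue_castSucc, ← Finset.sum_sub_distrib]
      refine Finset.sum_le_sum fun a _ => ?_
      rw [← mul_sub]
      refine mul_le_mul_of_nonneg_left ?_ ((π.prob_mem h _).1 a)
      rw [show (M.augment K).transMean h (some s) a = _ from
        funext (M.toModel.augment_transMean_some K h s a)]
      simp only [Option.elim_some, Option.elim_none]
      split_ifs with hs
      · have c1 := le_max_right 0 (M.meanReward h s a +
          M.transMean h s a (lowerValue M.toModel K π b p h.succ) -
          bonus M.toModel b (p h s a) (lowerValue M.toModel K π b p h.succ) h s a)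
        rw [Model.transMean_sub]
        have : (fun s' => (M.augment K).value π h.succ (some s')) =
          fun s' => (M.toModel.augment K).value π h.succ (some s') := rfl
        rw [this]
        linarith
      · simp

end LowerValue

/-! ### Sandwiching the estimates and the deterministic suboptimality bound. -/

noncomputable section Suboptimality

variable {S A : Type*} [Fintype S] [Fintype A] [DecidableEq S] [DecidableEq A] [Nonempty A]
  {H n : ℕ}

/-- The data concentrate at all pairs of the sets `K h`. -/
def GoodData (M : Model S A H) (K : Fin H → Finset (S × A)) (π : Policy (Option S) A H)
    (D : Fin n → Episode S A H) (b m ε x : ℝ) (p : Fin H → S → A → ℝ) : Prop :=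
  ∀ h s a, (s, a) ∈ K h → GoodPair M K D b m ε x (p h s a) (lowerValue M K π b p h.succ)
    (fun s => (M.augment K).optValue h.succ (some s)) h s a

variable {M : Model S A H} {K : Fin H → Finset (S × A)} {π : Policy (Option S) A H}
  {D : Fin n → Episode S A H} {b m ε x : ℝ} {p : Fin H → S → A → ℝ}

/-- Writing the estimate as `V⋆` plus an error, the empirical mean does not expand the error and
Bernstein is needed only at the fixed `V⋆`. No concentration for the data-dependent estimate enters,
so its clipping can be justified without circularity. -/
lemma GoodData.abs_padValue_sub_le (g : GoodData M K π D b m ε x p) (hm : 1 ≤ m)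
    (hp : ∀ h s a, (s, a) ∈ K h → 2 * m ≤ p h s a) (hb : 0 ≤ b) (hbm : b ≤ m) (h : Fin (H + 1))
    (s : S) : |padValue K b m D h s - (M.augment K).optValue h (some s)| ≤
      ((H : ℝ) - (h : ℕ)) * (32 * H * Real.sqrt (b / m)) := by
  set e := 32 * H * Real.sqrt (b / m) with he
  have he0 : 0 ≤ e := by positivity
  induction h using Fin.reverseInduction generalizing s with
  | last => simp [padValue_last, Model.optValue_last]
  | cast h ih =>
    rw [padValue_castSucc, Model.augment_optValue_some]
    have hV : ∀ s, (M.augment K).optValue h.succ (some s) ∈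
      Set.Icc 0 ((H : ℝ) - (h.succ : ℕ)) := fun s => (M.augment K).optValue_mem h.succ (some s)
    have hH : (0 : ℝ) ≤ (H : ℝ) - (h.succ : ℕ) :=
      sub_nonneg.2 (by exact_mod_cast Nat.le_of_lt_succ h.succ.2)
    have hH' : (0 : ℝ) ≤ (H : ℝ) - (h : ℕ) := sub_nonneg.2 (by exact_mod_cast h.2.le)
    refine abs_ciSup_sub_le fun a => ?_
    rw [padQBar]
    split_ifs with hs
    · have h1 := (g h s a hs).abs_padQ_sub_le hm (hp h s a hs) hb hbm (add_mem_of_mem_succ hV)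
        (mem_horizon_of_mem fun s => padValue_mem (C := K) (b := b) (m := m) (D := D) h.succ s)
        ih (mul_nonneg hH he0)
      have h2 := M.transMean_mem h s a hV
      have h3 := M.meanReward_nonneg h s a
      have h4 := M.meanReward_le_one h s a
      set Q := M.meanReward h s a +
        M.transMean h s a (fun s' => (M.augment K).optValue h.succ (some s'))
      -- The optimal one-step value already lies in the clipping range, so nonexpansiveness of
      -- clipping applies.
      have h5 : max (min Q ((H : ℝ) - (h : ℕ))) 0 = Q := by
        simp only [Fin.val_succ, Nat.cast_add, Nat.cast_one, Set.mem_Icc] at h2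
        rw [min_eq_left (by linarith), max_eq_left (by linarith)]
      rw [← h5]
      refine (abs_clip_sub_le _ _ _).trans (h1.trans (le_of_eq ?_))
      simp only [Fin.val_succ, Nat.cast_add, Nat.cast_one, Fin.val_castSucc]
      ring
    · rw [sub_self, abs_zero]
      exact mul_nonneg hH' he0

/-- Backward induction through `GoodPair.le_padQ`; the average over the comparator's actions is at
most the supremum taken by the algorithm. -/
lemma GoodData.lowerValue_le_padValue (g : GoodData M K π D b m ε x p) (hm : 1 ≤ m)
    (hp : ∀ h s a, (s, a) ∈ K h → 2 * m ≤ p h s a) (hb : 0 ≤ b) (h : Fin (H + 1)) (s : S) :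
    lowerValue M K π b p h s ≤ padValue K b m D h s := by
  have hp0 : ∀ h s a, (s, a) ∈ K h → 0 ≤ p h s a := fun h s a hs => by linarith [hp h s a hs]
  induction h using Fin.reverseInduction generalizing s with
  | last => simp [padValue_last, lowerValue_last]
  | cast h ih =>
    rw [padValue_castSucc, lowerValue_castSucc]
    refine le_trans (Finset.sum_le_sum fun a _ => mul_le_mul_of_nonneg_left ?_
      ((π.prob_mem h _).1 a)) (sum_mul_le_ciSup (π.prob_mem h (some s)))
    rw [padQBar]
    split_ifs with hs
    · have hV' := mem_horizon_of_mem fun s =>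
        padValue_mem (C := K) (b := b) (m := m) (D := D) h.succ s
      have h1 := (g h s a hs).le_padQ hm (hp h s a hs) hb (lowerValue_nonneg h.succ) ih
        fun s => (hV' s).2
      have h2 := M.transMean_mem h s a (lowerValue_mem (M := M) (π := π) hb hp0 h.succ)
      have h3 := M.meanReward_le_one h s a
      have h4 := bonus_nonneg (M := M) hb (hp0 h s a hs) (lowerValue M K π b p h.succ) h s a
      rw [max_comm]
      refine max_le_max_right 0 (le_min h1 ?_)
      simp only [Fin.val_succ, Nat.cast_add, Nat.cast_one, Set.mem_Icc] at h2
      linarith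
    · exact le_rfl

/-- If the penalized estimates are pessimistic up to `c`, then the estimated value of the greedy
policy exceeds its true value in the augmented model by at most `c` per step. -/
lemma padValue_le_value_add {πhat : Policy (Option S) A H} {c : ℝ} (hc : 0 ≤ c)
    (hgreedy : ∀ h s, padValue K b m D h.castSucc s = ∑ a, πhat.prob h (some s) a *
      padQBar K b m D h (padValue K b m D h.succ) s a)
    (hQ : ∀ h s a, (s, a) ∈ K h → padQ b m D h (padValue K b m D h.succ) s a ≤
      M.meanReward h s a + M.transMean h s a (padValue K b m D h.succ) + c)
    (h : Fin (H + 1)) (s : S) : padValue K b m D h s ≤ (M.augment K).value πhat h (some s) +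
      ((H : ℝ) - (h : ℕ)) * c := by
  induction h using Fin.reverseInduction generalizing s with
  | last => simp [padValue_last, Model.value_last]
  | cast h ih =>
    rw [hgreedy, Model.augment_value_some]
    refine sum_prob_mul_le πhat h (some s) fun a => ?_
    have hH' : (0 : ℝ) ≤ (H : ℝ) - (h : ℕ) := sub_nonneg.2 (by exact_mod_cast h.2.le)
    rw [padQBar]
    split_ifs with hs
    · have h1 := M.transMean_mono h s a ih
      rw [M.transMean_add_const] at h1
      have h2 := hQ h s a hs
      have h3 := (M.transMean_mem h s a fun s' => (M.augment K).value_mem πhat h.succ (some s')).1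
      have h4 := M.meanReward_nonneg h s a
      simp only [Fin.val_succ, Nat.cast_add, Nat.cast_one, Fin.val_castSucc] at h1 ⊢
      have h5 := mul_nonneg hH' hc
      exact max_le ((min_le_left _ _).trans (by linarith)) (by linarith)
    · simp only [Fin.val_castSucc, zero_add]
      exact mul_nonneg hH' hc

/-- All error terms of `GoodPair.padQ_le` at `ε = 32 h² √(b / m)` and `x = 10 L` have the order `h²
L³ / m`; `L ≥ 1 / 2` allows lower powers of `L` to be raised. -/
lemma pessimism_slack_le {k : ℕ} {h b m L : ℝ} (hh : 1 ≤ h) (hb : 0 ≤ b) (hm : 0 < m) (hbL : b ≤ L)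
    (hL : 1 / 2 ≤ L) (hk : (k : ℝ) ≤ 2 * L) :
    32 * h ^ 2 * Real.sqrt (b / m) * Real.sqrt (2 * (10 * L) / m) +
      2 * (3 * h ^ 2 * (8 + 18 * b) / m) * (2 + 2 * k * (10 * L)) +
      2 * (32 * h ^ 2 * Real.sqrt (b / m)) * Real.sqrt (b / m) + 52 * h * (b / m) ≤
    11000 * h ^ 2 * L ^ 3 / m := by
  have hL0 : 0 < L := by linarith
  have h1 : Real.sqrt (b / m) ≤ Real.sqrt (L / m) :=
    Real.sqrt_le_sqrt (div_le_div_of_nonneg_right hbL hm.le)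
  have h2 : Real.sqrt (2 * (10 * L) / m) ≤ 9 / 2 * Real.sqrt (L / m) := by
    rw [← mul_assoc]
    exact sqrt_const_mul_div_le (by norm_num) (by norm_num) hL0.le hm.le
  have h3 : Real.sqrt (L / m) * Real.sqrt (L / m) = L / m := Real.mul_self_sqrt (by positivity)
  have h4 : Real.sqrt (b / m) * Real.sqrt (2 * (10 * L) / m) ≤ 9 / 2 * (L / m) := by
    rw [← h3]
    calc _ ≤ Real.sqrt (L / m) * (9 / 2 * Real.sqrt (L / m)) :=
          mul_le_mul h1 h2 (Real.sqrt_nonneg _) (Real.sqrt_nonneg _)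
      _ = _ := by ring
  have h5 : Real.sqrt (b / m) * Real.sqrt (b / m) ≤ L / m := by
    rw [← h3]
    exact mul_le_mul h1 h1 (Real.sqrt_nonneg _) (Real.sqrt_nonneg _)
  have h6 : b / m ≤ L / m := div_le_div_of_nonneg_right hbL hm.le
  have hh2 : h ≤ h ^ 2 := by nlinarith
  have h7 : h * (b / m) ≤ h ^ 2 * (L / m) := mul_le_mul hh2 h6 (by positivity) (by positivity)
  have h8 : L ≤ 4 * L ^ 3 := by nlinarith [mul_nonneg hL0.le (show 0 ≤ L - 1 / 2 by linarith)]
  have h9 : L / m ≤ 4 * L ^ 3 / m := div_le_div_of_nonneg_right h8 hm.le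
  have h10 : (8 + 18 * b) * (2 + 2 * k * (10 * L)) ≤ 1632 * L ^ 3 := by
    have a1 : 8 + 18 * b ≤ 34 * L := by linarith
    have a2 : 2 + 2 * k * (10 * L) ≤ 48 * L ^ 2 := by nlinarith
    have a3 : 0 ≤ 2 + 2 * (k : ℝ) * (10 * L) := by positivity
    calc _ ≤ 34 * L * (48 * L ^ 2) := mul_le_mul a1 a2 a3 (by positivity)
      _ = _ := by ring
  have h11 : h ^ 2 * ((8 + 18 * b) * (2 + 2 * k * (10 * L)) / m) ≤ h ^ 2 * (1632 * L ^ 3 / m) :=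
    mul_le_mul_of_nonneg_left (div_le_div_of_nonneg_right h10 hm.le) (by positivity)
  have h12 : h ^ 2 * (Real.sqrt (b / m) * Real.sqrt (2 * (10 * L) / m)) ≤
    h ^ 2 * (9 / 2 * (L / m)) := mul_le_mul_of_nonneg_left h4 (by positivity)
  have h13 : h ^ 2 * (Real.sqrt (b / m) * Real.sqrt (b / m)) ≤ h ^ 2 * (L / m) :=
    mul_le_mul_of_nonneg_left h5 (by positivity)
  have h14 : h ^ 2 * (L / m) ≤ h ^ 2 * (4 * L ^ 3 / m) :=
    mul_le_mul_of_nonneg_left h9 (by positivity)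
  have h15 : 0 ≤ h ^ 2 * (L ^ 3 / m) := by positivity
  have e1 : 2 * (3 * h ^ 2 * (8 + 18 * b) / m) * (2 + 2 * k * (10 * L)) =
    6 * (h ^ 2 * ((8 + 18 * b) * (2 + 2 * k * (10 * L)) / m)) := by ring
  have e2 : h ^ 2 * (4 * L ^ 3 / m) = 4 * (h ^ 2 * (L ^ 3 / m)) := by ring
  have e3 : h ^ 2 * (1632 * L ^ 3 / m) = 1632 * (h ^ 2 * (L ^ 3 / m)) := by ring
  have e4 : 11000 * h ^ 2 * L ^ 3 / m = 11000 * (h ^ 2 * (L ^ 3 / m)) := by ring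
  rw [e1, e4]
  rw [e2] at h14
  rw [e3] at h11
  -- `32 * (9 / 2) * 4 + 6 * 1632 + 64 * 4 + 52 * 4 = 10832`.
  linarith

/-- The suboptimality of a greedy policy for the penalized value estimates. -/
theorem MDP.optPerf_sub_perf_le {M : MDP S A H} {L : ℝ} {πhat : Policy (Option S) A H} (hH : 0 < H)
    (hb : 0 ≤ b) (hm : 1 ≤ m) (hbm : b ≤ m) (hbL : b ≤ L) (hL : 1 / 2 ≤ L)
    (hn : (Nat.clog 2 n : ℝ) ≤ 2 * L) (hp : ∀ h s a, (s, a) ∈ K h → 2 * m ≤ p h s a)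
    (hπ : M.IsOptimal π.restrict)
    (g : GoodData M.toModel K π D b m (32 * (H : ℝ) ^ 2 * Real.sqrt (b / m)) (10 * L) p)
    (hgreedy : ∀ h s, padValue K b m D h.castSucc s = ∑ a, πhat.prob h (some s) a *
      padQBar K b m D h (padValue K b m D h.succ) s a) :
    M.optPerf - M.perf πhat.restrict ≤ ∑ h : Fin H, (M.augment K).stateOcc π h.succ none +
      11 * ∑ h, ∑ x ∈ K h, (M.augment K).occ π h (some x.1) x.2 *
        Real.sqrt ((M.augment K).stepVar h (some x.1) x.2 ((M.augment K).value π h.succ) * b /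
          p h x.1 x.2) + 15324 * (H : ℝ) ^ 3 * L ^ 3 / m := by
  have hm0 : 0 < m := one_pos.trans_le hm
  have hH1 : (1 : ℝ) ≤ H := by exact_mod_cast hH
  have hL0 : 0 < L := by linarith
  set c := 11000 * (H : ℝ) ^ 2 * L ^ 3 / m with hc
  have hc0 : 0 ≤ c := by positivity
  have hQ : ∀ h s a, (s, a) ∈ K h → padQ b m D h (padValue K b m D h.succ) s a ≤
      M.meanReward h s a + M.transMean h s a (padValue K b m D h.succ) + c := by
    intro h s a hs
    have hV : ∀ s, (M.toModel.augment K).optValue h.succ (some s) ∈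
      Set.Icc 0 ((H : ℝ) - (h.succ : ℕ)) := fun s => Model.optValue_mem _ h.succ (some s)
    have h1 := (g h s a hs).padQ_le hm (hp h s a hs) hb (fun s => (hV s).1)
      (add_mem_of_mem_succ hV) (fun s => by
        refine (g.abs_padValue_sub_le hm hp hb hbm h.succ s).trans ?_
        calc ((H : ℝ) - (h.succ : ℕ)) * (32 * H * Real.sqrt (b / m)) ≤
              H * (32 * H * Real.sqrt (b / m)) :=
              mul_le_mul_of_nonneg_right (sub_le_self _ (Nat.cast_nonneg _)) (by positivity)
          _ = _ := by ring) (by positivity) (by positivity)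
    have h2 := pessimism_slack_le hH1 hb hm0 hbL hL hn
    exact h1.trans (add_le_add_right h2 _)
  have h1 := hπ.optPerf_le
  have h2 := M.perf_restrict_le K π
  have h3 := M.perf_le_lowerValue (π := π) hH hb hm0 hbm hp
  have h4 : ∑ s, M.init s * lowerValue M.toModel K π b p 0 s ≤ (M.augment K).perf πhat + H * c := by
    rw [MDP.perf, Fintype.sum_option]
    have e0 : (M.augment K).init none = 0 := rfl
    rw [e0, zero_mul, zero_add]
    calc _ ≤ ∑ s, M.init s * ((M.augment K).value πhat 0 (some s) + H * c) :=
          Finset.sum_le_sum fun s _ => mul_le_mul_of_nonneg_left (by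
            have a1 := g.lowerValue_le_padValue hm hp hb 0 s
            have a2 := padValue_le_value_add (M := M.toModel) hc0 hgreedy hQ 0 s
            simp only [Fin.val_zero, Nat.cast_zero, sub_zero] at a2
            exact a1.trans a2) (M.init_mem.1 s)
      _ = _ := by
          simp only [mul_add, Finset.sum_add_distrib]
          rw [← Finset.sum_mul, M.init_mem.2, one_mul]
          rfl
  have h5 := M.perf_restrict_ge K πhat
  have h6 : (H : ℝ) ^ 3 * (b / m) ≤ 4 * ((H : ℝ) ^ 3 * L ^ 3 / m) := by
    have : b / m ≤ 4 * L ^ 3 / m := div_le_div_of_nonneg_right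
      (by nlinarith [mul_nonneg hL0.le (show 0 ≤ L - 1 / 2 by linarith)]) hm0.le
    calc _ ≤ (H : ℝ) ^ 3 * (4 * L ^ 3 / m) := mul_le_mul_of_nonneg_left this (by positivity)
      _ = _ := by ring
  have e1 : H * c = 11000 * ((H : ℝ) ^ 3 * L ^ 3 / m) := by rw [hc]; ring
  have e2 : 15324 * (H : ℝ) ^ 3 * L ^ 3 / m = 15324 * ((H : ℝ) ^ 3 * L ^ 3 / m) := by ring
  rw [e2]
  -- Chain: optimal performance, augmented performance of the comparator, lower bound, estimate,
  -- augmented and finally true performance of the output. The constant is `11000 + 4 * 1081`.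
  linarith

end Suboptimality

/-! ### Probability of the concentration events and union bounds. -/

noncomputable section GoodEvent

lemma measure_union_le_ofReal {Ω : Type*} [MeasurableSpace Ω] {P : Measure Ω} {E F : Set Ω}
    {x y : ℝ} (hx : 0 ≤ x) (hy : 0 ≤ y) (hE : P E ≤ ENNReal.ofReal x) (hF : P F ≤ ENNReal.ofReal y) :
    P (E ∪ F) ≤ ENNReal.ofReal (x + y) := by
  rw [ENNReal.ofReal_add hx hy]
  exact (measure_union_le _ _).trans (add_le_add hE hF)

variable {S A : Type*} [Fintype S] [Fintype A] [DecidableEq S] [DecidableEq A] {H n : ℕ}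
  [MeasurableSpace S] [MeasurableSingletonClass S] [MeasurableSpace A]
  [MeasurableSingletonClass A] {M : MDP S A H} {μ : Policy S A H} {K : Fin H → Finset (S × A)}
  {b m ε x : ℝ} {h : Fin H} {s : S} {a : A}

/-- The coefficient `21` counts one event for the visits and five `StepConc` events with four tails
each, all at level `10 b`. The count event reaches this level because `160 b ≤ n d` gives `n d / 16
≥ 10 b`. -/
lemma MDP.dataLaw_not_goodPair [Nonempty A] (hpos : 0 < M.occ μ h s a) (hb : 0 < b) (hm : 1 ≤ m)
    (hbm : 4 * (H : ℝ) ^ 2 * b ≤ m) (hε : 0 < ε) (hx : 0 < x) (hn : 160 * b ≤ n * M.occ μ h s a)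
    {U V : S → ℝ} (hU : ∀ s, U s ∈ Set.Icc 0 ((H : ℝ) - (h.succ : ℕ)))
    (hV : ∀ s, V s ∈ Set.Icc 0 ((H : ℝ) - (h.succ : ℕ))) :
    M.dataLaw μ n {D | ¬ GoodPair M.toModel K D b m ε x (n * M.occ μ h s a) U V h s a} ≤
      ENNReal.ofReal (21 * Real.exp (-(10 * b)) + Real.exp (-(2 * b)) +
        2 * n * ((4 * Fintype.card S + 4) * Real.exp (-x))) := by
  have hH : (0 : ℝ) < H := one_pos.trans_le (one_le_horizon h)
  have hq1 : ∀ V : S → ℝ, ∀ s' : S, Measurable fun r : I => (r : ℝ) + V s' :=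
    fun V s' => measurable_subtype_coe.add_const _
  have ht : 0 ≤ 10 * b := by positivity
  have p0 := M.dataLaw_count_lt (n := n) μ h s a
  have p1 := M.dataLaw_not_stepConc (n := n) hpos (q := fun r _ => (r : ℝ))
    (fun _ => measurable_subtype_coe) one_pos ht (fun r _ => r.2.1) fun r _ => r.2.2
  have p2 := M.dataLaw_not_stepConc (n := n) hpos (q := fun _ s' => U s')
    (fun _ => measurable_const) hH ht (fun _ s' => (mem_horizon_of_mem hU s').1)
    fun _ s' => (mem_horizon_of_mem hU s').2
  have p3 := M.dataLaw_not_stepConc (n := n) hpos (q := fun r s' => (r : ℝ) + U s')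
    (hq1 U) hH ht (fun r s' => (add_mem_of_mem_succ hU r s').1)
    fun r s' => (add_mem_of_mem_succ hU r s').2
  have p4 := M.dataLaw_not_stepConc (n := n) hpos (q := fun _ s' => V s')
    (fun _ => measurable_const) hH ht (fun _ s' => (mem_horizon_of_mem hV s').1)
    fun _ s' => (mem_horizon_of_mem hV s').2
  have p5 := M.dataLaw_not_stepConc (n := n) hpos (q := fun r s' => (r : ℝ) + V s')
    (hq1 V) hH ht (fun r s' => (add_mem_of_mem_succ hV r s').1)
    fun r s' => (add_mem_of_mem_succ hV r s').2
  have p6 := (M.dataLaw_bernstein (n := n) hpos (q := fun r s' => (r : ℝ) + V s')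
    (v := M.stepSq h s a fun r s' => (r : ℝ) + V s') (t := 2 * b)
    (hq1 V) hH (by positivity) (fun r s' => (add_mem_of_mem_succ hV r s').1)
    (fun r s' => (add_mem_of_mem_succ hV r s').2) le_rfl).1
  have p7 := M.dataLaw_clippedGap (n := n) (C := K) hpos hε hx V hm hb.le hbm
  have p0' := p0.trans (ENNReal.ofReal_le_ofReal (Real.exp_le_exp.2
    (show -(n * M.occ μ h s a / 16) ≤ -(10 * b) by linarith)))
  have u1 := measure_union_le_ofReal (by positivity) (by positivity) p0' p1
  have u2 := measure_union_le_ofReal (by positivity) (by positivity) u1 p2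
  have u3 := measure_union_le_ofReal (by positivity) (by positivity) u2 p3
  have u4 := measure_union_le_ofReal (by positivity) (by positivity) u3 p4
  have u5 := measure_union_le_ofReal (by positivity) (by positivity) u4 p5
  have u6 := measure_union_le_ofReal (by positivity) (by positivity) u5 p6
  have u7 := measure_union_le_ofReal (by positivity) (by positivity) u6 p7
  refine (measure_mono ?_).trans (u7.trans (ENNReal.ofReal_le_ofReal (le_of_eq (by ring))))
  intro D hD
  by_contra hcon
  simp only [Set.mem_union, Set.mem_ofPred_eq, not_or, not_not, not_lt, not_and] at hcon
  obtain ⟨⟨⟨⟨⟨⟨⟨c0, c1⟩, c2⟩, c3⟩, c4⟩, c5⟩, c6⟩, c7⟩ := hcon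
  have hN : 0 < count D h s a := by
    have : (0 : ℝ) < count D h s a := by linarith
    exact_mod_cast this
  exact hD ⟨c0, c1, c2, c3, c4, c5, c6, c7 hN⟩

lemma MDP.dataLaw_count_pos (h0 : M.occ μ h s a = 0) :
    M.dataLaw μ n {D | 0 < count D h s a} = 0 := by
  have e : {D : Fin n → Episode S A H | 0 < count D h s a} ⊆
      ⋃ τ, Function.eval τ ⁻¹' visitSet h s a := by
    intro D hD
    rw [Set.mem_ofPred_eq, count, Finset.card_pos] at hD
    obtain ⟨τ, hτ⟩ := hD
    exact Set.mem_iUnion.2 ⟨τ, mem_visits.1 hτ⟩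
  refine measure_mono_null e (measure_iUnion_null fun τ => ?_)
  exact Measure.pi_eval_preimage_null _ (by rw [M.episodeLaw_visitSet, h0, ENNReal.ofReal_zero])

lemma mem_covered : (s, a) ∈ M.covered μ h ↔ 0 < M.occ μ h s a := by simp [MDP.covered]

/-- A union bound over all steps and all state-action pairs. -/
lemma MDP.dataLaw_exists_le {y : ℝ} (B : Fin H → S → A → Set (Fin n → Episode S A H))
    (hB : ∀ h s a, 0 < M.occ μ h s a → M.dataLaw μ n (B h s a) ≤ ENNReal.ofReal y) :
    M.dataLaw μ n {D | (∃ h s a, 0 < M.occ μ h s a ∧ D ∈ B h s a) ∨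
      ∃ h s a, M.occ μ h s a = 0 ∧ 0 < count D h s a} ≤
      ENNReal.ofReal (H * Fintype.card S * Fintype.card A * y) := by
  set F : Fin H × S × A → Set (Fin n → Episode S A H) := fun z =>
    {D | (0 < M.occ μ z.1 z.2.1 z.2.2 ∧ D ∈ B z.1 z.2.1 z.2.2) ∨
      (M.occ μ z.1 z.2.1 z.2.2 = 0 ∧ 0 < count D z.1 z.2.1 z.2.2)} with hF
  have hsub : {D | (∃ h s a, 0 < M.occ μ h s a ∧ D ∈ B h s a) ∨
      ∃ h s a, M.occ μ h s a = 0 ∧ 0 < count D h s a} ⊆ ⋃ z, F z := by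
    rintro D (⟨h, s, a, hD⟩ | ⟨h, s, a, hD⟩)
    · exact Set.mem_iUnion.2 ⟨(h, s, a), Or.inl hD⟩
    · exact Set.mem_iUnion.2 ⟨(h, s, a), Or.inr hD⟩
  have hz : ∀ z, M.dataLaw μ n (F z) ≤ ENNReal.ofReal y := by
    intro z
    rcases (M.occ_nonneg μ z.1 z.2.1 z.2.2).eq_or_lt with h0 | h0
    · refine (measure_mono (t := {D | 0 < count D z.1 z.2.1 z.2.2}) ?_).trans
        ((M.dataLaw_count_pos h0.symm).le.trans zero_le)
      rintro D (hD | hD)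
      · exact absurd hD.1 (by rw [← h0]; exact lt_irrefl _)
      · exact hD.2
    · refine (measure_mono ?_).trans (hB _ _ _ h0)
      rintro D (hD | hD)
      · exact hD.2
      · exact absurd hD.1 h0.ne'
  calc _ ≤ M.dataLaw μ n (⋃ z, F z) := measure_mono hsub
    _ ≤ ∑ z, M.dataLaw μ n (F z) := measure_iUnion_fintype_le _ _
    _ ≤ ∑ _z : Fin H × S × A, ENNReal.ofReal y := Finset.sum_le_sum fun z _ => hz z
    _ = _ := by
        rw [Finset.sum_const, Finset.card_univ, Fintype.card_prod, Fintype.card_prod,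
          Fintype.card_fin, nsmul_eq_mul, ENNReal.ofReal_mul (by positivity)]
        congr 1
        rw [← ENNReal.ofReal_natCast]
        push_cast
        ring_nf

lemma visited_eq_covered {D : Fin n → Episode S A H}
    (h1 : ∀ h s a, 0 < M.occ μ h s a → 0 < count D h s a)
    (h2 : ∀ h s a, M.occ μ h s a = 0 → count D h s a = 0) : visited D = M.covered μ := by
  funext h
  ext ⟨s, a⟩
  rw [mem_covered, visited, Finset.mem_filter_univ]
  refine ⟨fun hc => ?_, h1 h s a⟩
  rcases (M.occ_nonneg μ h s a).eq_or_lt with h0 | h0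
  · exact absurd (h2 h s a h0.symm) hc.ne'
  · exact h0

/-! ### Choice of the confidence levels. -/

section Confidence

variable {δ : ℝ} [Nonempty S] [Nonempty A]

lemma one_le_card_mul (hH : 0 < H) : (1 : ℝ) ≤ (H : ℝ) * Fintype.card S * Fintype.card A := by
  have h1 : 1 ≤ H * Fintype.card S * Fintype.card A :=
    Nat.mul_pos (Nat.mul_pos hH Fintype.card_pos) Fintype.card_pos
  exact_mod_cast h1

lemma exp_neg_iota (hH : 0 < H) (hδ : 0 < δ) :
    Real.exp (-iota S A H δ) = δ / ((H : ℝ) * Fintype.card S * Fintype.card A) := by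
  have := one_le_card_mul (S := S) (A := A) hH
  rw [iota, Real.exp_neg, Real.exp_log (by positivity), inv_div]

lemma iota_pos (hH : 0 < H) (hδ : 0 < δ) (hδ1 : δ < 1) : 0 < iota S A H δ := by
  have := one_le_card_mul (S := S) (A := A) hH
  exact Real.log_pos ((one_lt_div hδ).2 (by linarith))

lemma exp_neg_natCast_mul (k : ℕ) (y : ℝ) : Real.exp (-(k * y)) = Real.exp (-y) ^ k := by
  rw [← Real.exp_nat_mul]
  congr 1
  ring

/-- Needed in the degenerate cases, where the suboptimality bound is automatic but the statement on
visited pairs is still to be shown. -/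
lemma MDP.dataLaw_visited_ne (hH : 0 < H) (hδ : 0 < δ) (hδ1 : δ < 1)
    (hn : 160 * iota S A H δ ≤ n * M.minOcc μ) :
    M.dataLaw μ n {D | visited D ≠ M.covered μ} ≤ ENNReal.ofReal δ := by
  have hι := iota_pos (S := S) (A := A) hH hδ hδ1
  have hJ := one_le_card_mul (S := S) (A := A) hH
  have hn' : ∀ h s a, 0 < M.occ μ h s a → 160 * iota S A H δ ≤ n * M.occ μ h s a :=
    fun h s a hpos => hn.trans (mul_le_mul_of_nonneg_left (M.minOcc_le μ hpos) (Nat.cast_nonneg _))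
  have h1 := M.dataLaw_exists_le (n := n) (μ := μ) (y := Real.exp (-iota S A H δ))
    (fun h s a => {D | (count D h s a : ℝ) < n * M.occ μ h s a / 2}) fun h s a hpos =>
      (M.dataLaw_count_lt μ h s a).trans (ENNReal.ofReal_le_ofReal (Real.exp_le_exp.2 (by
        linarith [hn' h s a hpos])))
  rw [exp_neg_iota hH hδ, mul_div_cancel₀ _ (by positivity)] at h1
  refine (measure_mono ?_).trans h1
  intro D hD
  by_contra hcon
  rw [Set.mem_ofPred_eq, not_or] at hcon
  push Not at hcon
  refine hD (visited_eq_covered (fun h s a hpos => ?_) fun h s a h0 =>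
    Nat.eq_zero_of_le_zero (hcon.2 h s a h0))
  have c1 : n * M.occ μ h s a / 2 ≤ count D h s a := not_lt.1 (hcon.1 h s a hpos)
  have : (0 : ℝ) < count D h s a := by linarith [hn' h s a hpos]
  exact_mod_cast this

lemma log_two_le_iota (hδ : 0 < δ) (hδ1 : δ < 1)
    (h2 : 2 ≤ (H : ℝ) * Fintype.card S * Fintype.card A) : Real.log 2 ≤ iota S A H δ := by
  refine Real.log_le_log two_pos (h2.trans ?_)
  rw [le_div_iff₀ hδ]
  nlinarith

lemma log_eq_add_iota (hH : 0 < H) (hδ : 0 < δ) (hn : 0 < n) :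
    Real.log (n * H * Fintype.card S * Fintype.card A / δ) = Real.log n + iota S A H δ := by
  have := one_le_card_mul (S := S) (A := A) hH
  rw [iota, ← Real.log_mul (by positivity) (by positivity)]
  congr 1
  ring

lemma clog_le_two_mul {L : ℝ} (hL : Real.log n + Real.log 2 ≤ L) :
    (Nat.clog 2 n : ℝ) ≤ 2 * L := by
  have hl2 := Real.log_two_gt_d9
  have hlog : 0 ≤ Real.log n := Real.log_natCast_nonneg n
  rcases Nat.lt_or_ge 1 n with h1 | h1
  · have h2 := Nat.pow_pred_clog_lt_self (b := 2) (by norm_num) h1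
    obtain ⟨k, hk⟩ : ∃ k, Nat.clog 2 n = k + 1 :=
      ⟨Nat.clog 2 n - 1, by have := Nat.clog_pos (b := 2) (by norm_num) h1; omega⟩
    rw [hk] at h2 ⊢
    simp only [Nat.pred_eq_sub_one, Nat.add_sub_cancel] at h2
    have h3 : (k : ℝ) * Real.log 2 ≤ Real.log n := by
      rw [← Real.log_pow]
      refine Real.log_le_log (by positivity) ?_
      exact_mod_cast h2.le
    push_cast
    have h4 : ((k : ℝ) + 1) * (1 / 2) ≤ ((k : ℝ) + 1) * Real.log 2 :=
      mul_le_mul_of_nonneg_left (by linarith) (by positivity)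
    linarith
  · rw [Nat.clog_of_right_le_one h1]
    simp only [Nat.cast_zero]
    linarith

/-- Here `y` is the budget `δ / (H S A)` of one pair and `z = y / n`. High powers absorb all
prefactors: `z ^ 10` cancels `n`, one factor of `y ^ 10` cancels `k`, and `y ≤ 1 / 2` makes the rest
small. Only the sharp event at level `2 b` is large: it contributes `y² ≤ y / 2`. -/
lemma failure_bound {y z k n : ℝ} (hy0 : 0 ≤ y) (hy : y ≤ 1 / 2) (hk0 : 1 ≤ k) (hk : k * y ≤ 1)
    (hn : 1 ≤ n) (hz : z = y / n) :
    21 * y ^ 10 + y ^ 2 + 2 * n * ((4 * k + 4) * z ^ 10) ≤ y := by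
  have hn0 : 0 < n := by linarith
  have a1 : y ^ 2 ≤ y * (1 / 2) := by nlinarith
  have a2 : y ^ 8 ≤ (1 / 2) ^ 8 := pow_le_pow_left₀ hy0 hy 8
  have a3 : y ^ 9 ≤ y * (1 / 2) ^ 8 := by
    calc y ^ 9 = y * y ^ 8 := by ring
      _ ≤ _ := mul_le_mul_of_nonneg_left a2 hy0
  have a4 : y ^ 10 ≤ y ^ 9 * (1 / 2) := by
    calc y ^ 10 = y ^ 9 * y := by ring
      _ ≤ _ := mul_le_mul_of_nonneg_left hy (by positivity)
  have a5 : n * z ^ 10 ≤ y ^ 10 := by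
    rw [hz, div_pow, ← mul_div_assoc, div_le_iff₀ (by positivity), mul_comm]
    refine mul_le_mul_of_nonneg_left ?_ (by positivity)
    exact le_self_pow₀ hn (by norm_num)
  have a6 : 2 * n * ((4 * k + 4) * z ^ 10) ≤ 16 * y ^ 9 := by
    calc 2 * n * ((4 * k + 4) * z ^ 10) = (8 * k + 8) * (n * z ^ 10) := by ring
      _ ≤ (16 * k) * y ^ 10 := mul_le_mul (by linarith) a5
          (by rw [hz]; positivity) (by positivity)
      _ = 16 * (k * y) * y ^ 9 := by ring
      _ ≤ 16 * 1 * y ^ 9 := by gcongr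
      _ = _ := by ring
  nlinarith

lemma MDP.dataLaw_not_goodData {π : Policy (Option S) A H} (hH : 0 < H) (hδ : 0 < δ) (hδ1 : δ < 1)
    (h2 : 2 ≤ (H : ℝ) * Fintype.card S * Fintype.card A) (hn0 : 0 < n)
    (hn : 160 * iota S A H δ ≤ n * M.minOcc μ) (hm : 1 ≤ m)
    (hbm : 4 * (H : ℝ) ^ 2 * iota S A H δ ≤ m) (hε : 0 < ε) :
    M.dataLaw μ n {D | ¬ (visited D = M.covered μ ∧
      GoodData M.toModel (M.covered μ) π D (iota S A H δ) m ε
        (10 * Real.log (n * H * Fintype.card S * Fintype.card A / δ))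
        fun h s a => n * M.occ μ h s a)} ≤ ENNReal.ofReal δ := by
  have hι := iota_pos (S := S) (A := A) hH hδ hδ1
  have hJ := one_le_card_mul (S := S) (A := A) hH
  have hn' : ∀ h s a, 0 < M.occ μ h s a → 160 * iota S A H δ ≤ n * M.occ μ h s a :=
    fun h s a hpos => hn.trans (mul_le_mul_of_nonneg_left (M.minOcc_le μ hpos) (Nat.cast_nonneg _))
  have hL := log_eq_add_iota (S := S) (A := A) (n := n) hH hδ hn0
  set L := Real.log (n * H * Fintype.card S * Fintype.card A / δ) with hLdef
  have hL0 : 0 < L := by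
    rw [hL]
    have := Real.log_natCast_nonneg n
    linarith
  set y := Real.exp (-iota S A H δ) with hy
  have hy' : y = δ / ((H : ℝ) * Fintype.card S * Fintype.card A) := exp_neg_iota hH hδ
  have hz : Real.exp (-L) = y / n := by
    rw [hL, neg_add, Real.exp_add, Real.exp_neg, Real.exp_log (by exact_mod_cast hn0)]
    ring
  have hp0 : ∀ h s a, (s, a) ∈ M.covered μ h → 0 ≤ n * M.occ μ h s a :=
    fun h s a _ => mul_nonneg (Nat.cast_nonneg _) (M.occ_nonneg _ _ _ _)
  -- This is where at least two triples `(h, s, a)` are needed; otherwise `δ` near `1` leaves no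
  -- room for the union bound.
  have hyb : y ≤ 1 / 2 := by
    rw [hy', div_le_iff₀ (by positivity)]
    linarith
  have hky : (Fintype.card S : ℝ) * y ≤ 1 := by
    have hHA : (1 : ℝ) ≤ (H : ℝ) * Fintype.card A := by
      have : 1 ≤ H * Fintype.card A := Nat.mul_pos hH Fintype.card_pos
      exact_mod_cast this
    have hS : (0 : ℝ) ≤ Fintype.card S := Nat.cast_nonneg _
    rw [hy', ← mul_div_assoc, div_le_one (by positivity)]
    nlinarith
  have hfail : 21 * Real.exp (-(10 * iota S A H δ)) + Real.exp (-(2 * iota S A H δ)) +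
        2 * n * ((4 * Fintype.card S + 4) * Real.exp (-(10 * L))) ≤ y := by
    have e1 := exp_neg_natCast_mul 10 (iota S A H δ)
    have e2 := exp_neg_natCast_mul 2 (iota S A H δ)
    have e3 := exp_neg_natCast_mul 10 L
    push_cast at e1 e2 e3
    rw [e1, e2, e3]
    have hS1 : (1 : ℝ) ≤ Fintype.card S := by exact_mod_cast Fintype.card_pos (α := S)
    exact failure_bound (Real.exp_pos _).le hyb hS1 hky (by exact_mod_cast hn0) hz
  have h1 := M.dataLaw_exists_le (n := n) (μ := μ) (y := y)
    (fun h s a => {D | ¬ GoodPair M.toModel (M.covered μ) D (iota S A H δ) m ε (10 * L)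
      (n * M.occ μ h s a) (lowerValue M.toModel (M.covered μ) π (iota S A H δ)
        (fun h s a => n * M.occ μ h s a) h.succ)
      (fun s => (M.toModel.augment (M.covered μ)).optValue h.succ (some s)) h s a})
    fun h s a hpos => (M.dataLaw_not_goodPair hpos hι hm hbm hε (by positivity) (hn' h s a hpos)
      (lowerValue_mem hι.le hp0 h.succ) fun s => Model.optValue_mem _ h.succ (some s)).trans
        (ENNReal.ofReal_le_ofReal hfail)
  rw [hy', mul_div_cancel₀ _ (by positivity)] at h1
  refine (measure_mono ?_).trans h1
  intro D hD
  by_contra hcon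
  rw [Set.mem_ofPred_eq, not_or] at hcon
  push Not at hcon
  have hgood : GoodData M.toModel (M.covered μ) π D (iota S A H δ) m ε (10 * L)
      fun h s a => n * M.occ μ h s a := fun h s a hs =>
    not_not.1 (hcon.1 h s a (mem_covered.1 hs))
  refine hD ⟨visited_eq_covered (fun h s a hpos => ?_) fun h s a h0 =>
    Nat.eq_zero_of_le_zero (hcon.2 h s a h0), hgood⟩
  have c1 := (hgood h s a (mem_covered.2 hpos)).count_ge
  have : (0 : ℝ) < count D h s a := by linarith [hn' h s a hpos]
  exact_mod_cast this

end Confidence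

end GoodEvent

/-! ### Assembly, with the degenerate cases split off. -/

noncomputable section Bound

variable {S A : Type*} [Fintype S] [Fintype A] [DecidableEq S] [DecidableEq A] {H n : ℕ}

/-- The right-hand side of the suboptimality bound. -/
def suboptBound (M : MDP S A H) (μ : Policy S A H) (π : Policy (Option S) A H) (n : ℕ) (δ : ℝ) :
    ℝ :=
  ∑ h : Fin H, (M.dagger μ).stateOcc π h.succ none +
    11 * ∑ h : Fin H, ∑ x ∈ M.covered μ h, (M.dagger μ).occ π h (some x.1) x.2 *
      Real.sqrt ((M.dagger μ).stepVar h (some x.1) x.2 ((M.dagger μ).value π h.succ) *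
        iota S A H δ / (n * M.occ μ h x.1 x.2)) +
    31000 * (H : ℝ) ^ 3 * Real.log (n * H * Fintype.card S * Fintype.card A / δ) ^ 3 /
      (n * M.minOcc μ)

variable {M : MDP S A H} {μ : Policy S A H} {π : Policy (Option S) A H} {δ : ℝ}

lemma residual_le_suboptBound :
    31000 * (H : ℝ) ^ 3 * Real.log (n * H * Fintype.card S * Fintype.card A / δ) ^ 3 /
      (n * M.minOcc μ) ≤ suboptBound M μ π n δ := by
  refine le_add_of_nonneg_left (add_nonneg (Finset.sum_nonneg fun h _ =>
    MDP.stateOcc_nonneg _ _ _ _) (mul_nonneg (by norm_num) (Finset.sum_nonneg fun h _ =>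
    Finset.sum_nonneg fun x _ => mul_nonneg (MDP.occ_nonneg _ _ _ _ _) (Real.sqrt_nonneg _))))

lemma MDP.optPerf_sub_perf_le_horizon (hπ : M.IsOptimal π.restrict) (π' : Policy S A H) :
    M.optPerf - M.perf π' ≤ H := by
  have h1 := hπ.optPerf_le
  have h2 := (M.perf_mem π.restrict).2
  have h3 := (M.perf_mem π').1
  linarith

lemma Policy.eq_of_subsingleton [Subsingleton A] (π π' : Policy S A H) : π = π' := by
  have e : π.prob = π'.prob := by
    funext h s a
    have h1 := (π.prob_mem h s).2
    have h2 := (π'.prob_mem h s).2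
    rw [Fintype.sum_subsingleton _ a] at h1 h2
    rw [h1, h2]
  cases π
  cases π'
  congr

/-- With probability at least `1 - δ`, the data visit exactly the covered pairs and every output of
the algorithm satisfies the suboptimality bound. -/
theorem MDP.dataLaw_suboptBound [Nonempty S] [Nonempty A] [MeasurableSpace S]
    [MeasurableSingletonClass S] [MeasurableSpace A] [MeasurableSingletonClass A] (hH : 0 < H)
    (hπ : M.IsOptimal π.restrict) (hδ : 0 < δ) (hδ1 : δ < 1)
    (hn : 160 * (1 / M.minOcc μ) * iota S A H δ < n) :
    M.dataLaw μ n {D | ¬ (visited D = M.covered μ ∧ ∀ πhat : Policy (Option S) A H,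
      IsAPVIOutput D δ πhat → M.optPerf - M.perf πhat.restrict ≤ suboptBound M μ π n δ)} ≤
      ENNReal.ofReal δ := by
  have hι := iota_pos (S := S) (A := A) hH hδ hδ1
  have hJ := one_le_card_mul (S := S) (A := A) hH
  have hd := M.minOcc_pos μ hH
  have hH1 : (1 : ℝ) ≤ H := by exact_mod_cast hH
  have hn0 : 0 < n := by
    have : (0 : ℝ) < n := lt_of_le_of_lt (by positivity) hn
    exact_mod_cast this
  have hnR : (1 : ℝ) ≤ n := by exact_mod_cast hn0
  have hn' : 160 * iota S A H δ < n * M.minOcc μ := by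
    rw [mul_one_div, div_mul_eq_mul_div, div_lt_iff₀ hd] at hn
    exact hn
  have hL := log_eq_add_iota (S := S) (A := A) (n := n) hH hδ hn0
  have hlog : 0 ≤ Real.log n := Real.log_natCast_nonneg n
  -- If the bound holds for every policy, only the event on visited pairs remains. The two
  -- degenerate cases below are excluded by contradiction with the negation.
  by_cases htriv : ∀ πhat : Policy (Option S) A H,
      M.optPerf - M.perf πhat.restrict ≤ suboptBound M μ π n δ
  · refine (measure_mono ?_).trans (M.dataLaw_visited_ne hH hδ hδ1 hn'.le)
    intro D hD hv
    exact hD ⟨hv, fun πhat _ => htriv πhat⟩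
  -- Otherwise there is a single action, hence a single policy, and the left-hand side is
  -- nonpositive.
  have h2 : 2 ≤ (H : ℝ) * Fintype.card S * Fintype.card A := by
    by_contra hlt
    refine htriv fun πhat => ?_
    have hlt' : H * Fintype.card S * Fintype.card A < 2 := by
      rw [not_le] at hlt
      exact_mod_cast hlt
    have hA : Fintype.card A ≤ 1 := by
      have : 1 * Fintype.card A ≤ H * Fintype.card S * Fintype.card A :=
        Nat.mul_le_mul_right _ (Nat.mul_pos hH Fintype.card_pos)
      omega
    have : Subsingleton A := Fintype.card_le_one_iff_subsingleton.1 hA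
    refine le_trans ?_ residual_le_suboptBound
    have h1 := hπ.optPerf_le
    rw [Policy.eq_of_subsingleton π.restrict πhat.restrict] at h1
    refine (sub_nonpos.2 h1).trans ?_
    have : 0 ≤ Real.log (n * H * Fintype.card S * Fintype.card A / δ) := by
      rw [hL]
      positivity
    positivity
  have hι2 := log_two_le_iota (S := S) (A := A) hδ hδ1 h2
  have hl2 := Real.log_two_gt_d9
  set L := Real.log (n * H * Fintype.card S * Fintype.card A / δ) with hLdef
  have hιL : iota S A H δ ≤ L := by rw [hL]; linarith
  have hL2 : 1 / 2 ≤ L := by linarith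
  -- Half of the least expected count: on the good event every covered pair has at least `m` visits,
  -- so padding is inactive.
  set m := n * M.minOcc μ / 2 with hm
  have hm1 : 1 ≤ m := by linarith
  -- If this fails, the residual term alone exceeds the trivial bound `H`.
  have hbm : 4 * (H : ℝ) ^ 2 * iota S A H δ ≤ m := by
    by_contra hlt
    rw [not_le] at hlt
    refine htriv fun πhat => (MDP.optPerf_sub_perf_le_horizon hπ _).trans
      (le_trans ?_ residual_le_suboptBound)
    rw [← hLdef, le_div_iff₀ (by positivity)]
    have a1 : n * M.minOcc μ ≤ 8 * (H : ℝ) ^ 2 * L := by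
      have := mul_le_mul_of_nonneg_left hιL (show 0 ≤ 8 * (H : ℝ) ^ 2 by positivity)
      linarith
    have a2 : L ≤ 4 * L ^ 3 := by
      nlinarith [mul_nonneg (show 0 ≤ L by linarith) (show 0 ≤ L - 1 / 2 by linarith)]
    calc H * (n * M.minOcc μ) ≤ H * (8 * (H : ℝ) ^ 2 * (4 * L ^ 3)) :=
          mul_le_mul_of_nonneg_left (a1.trans (mul_le_mul_of_nonneg_left a2 (by positivity)))
            (by positivity)
      _ = 32 * ((H : ℝ) ^ 3 * L ^ 3) := by ring
      _ ≤ 31000 * ((H : ℝ) ^ 3 * L ^ 3) :=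
          mul_le_mul_of_nonneg_right (by norm_num) (by positivity)
      _ = _ := by ring
  have hbm' : iota S A H δ ≤ m :=
    le_trans (le_mul_of_one_le_left hι.le (by nlinarith)) hbm
  have hp : ∀ h s a, (s, a) ∈ M.covered μ h → 2 * m ≤ n * M.occ μ h s a := fun h s a hs => by
    have := mul_le_mul_of_nonneg_left (M.minOcc_le μ (mem_covered.1 hs)) (Nat.cast_nonneg n)
    linarith
  refine (measure_mono ?_).trans (M.dataLaw_not_goodData (π := π) hH hδ hδ1 h2 hn0 hn'.le hm1 hbm
    (ε := 32 * (H : ℝ) ^ 2 * Real.sqrt (iota S A H δ / m)) (by positivity))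
  intro D hD hgood
  obtain ⟨hvis, g⟩ := hgood
  refine hD ⟨hvis, fun πhat hπhat => ?_⟩
  have hgreedy := hπhat.padValue_eq (m := m) hvis fun h s a hs =>
    ((g h s a hs).count_bounds hm1 (hp h s a hs)).2
  refine (MDP.optPerf_sub_perf_le hH hι.le hm1 hbm' hιL hL2
    (clog_le_two_mul (by rw [hL]; linarith)) hp hπ g hgreedy).trans ?_
  refine add_le_add le_rfl ?_
  -- Passing from `m` to `n * M.minOcc μ` doubles the constant: `2 * 15324 ≤ 31000`.
  rw [hm, div_div_eq_mul_div]
  refine div_le_div_of_nonneg_right ?_ (by positivity)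
  have : 0 ≤ (H : ℝ) ^ 3 * L ^ 3 := by positivity
  linarith

end Bound

end OfflineRL

/-! ### The theorem. -/

theorem mainTheorem3 :
    ∃ c₀ Cmain Cres : ℝ, 0 < c₀ ∧ 0 < Cmain ∧ 0 < Cres ∧ ∃ k : ℕ,
      ∀ (S A : Type*) [Fintype S] [Fintype A] [Nonempty S] [DecidableEq S] [DecidableEq A]
        [MeasurableSpace S] [MeasurableSingletonClass S]
        [MeasurableSpace A] [MeasurableSingletonClass A]
        (H : ℕ) (_ : 0 < H) (M : MDP S A H) (μ : Policy S A H)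
        -- an optimal policy of `M`, extended arbitrarily to the extra states
        (πstar : Policy (Option S) A H) (_ : M.IsOptimal πstar.restrict),
        (∀ h s a, (M.dagger μ).occ πstar h (some s) a ≤ M.occ πstar.restrict h s a) ∧
        (∀ h s, (M.dagger μ).value πstar h (some s) ≤ M.optValue h s) ∧
        (∀ h : Fin (H + 1), (M.dagger μ).stateOcc πstar h none =
          ∑ t ∈ Finset.univ.filter (fun t : Fin H => t.castSucc < h),
            ∑ x ∈ Finset.univ \ M.covered μ t, (M.dagger μ).occ πstar t (some x.1) x.2) ∧
        ∀ (δ : ℝ) (_ : 0 < δ) (_ : δ < 1) (n : ℕ)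
          (_ : c₀ * (1 / M.minOcc μ) * iota S A H δ < n),
          M.dataLaw μ n {D | ¬ (visited D = M.covered μ ∧
            ∀ πhat : Policy (Option S) A H, IsAPVIOutput D δ πhat →
              M.optPerf - M.perf πhat.restrict ≤
                ∑ h : Fin H, (M.dagger μ).stateOcc πstar h.succ none +
                Cmain * ∑ h : Fin H, ∑ x ∈ M.covered μ h,
                  (M.dagger μ).occ πstar h (some x.1) x.2 *
                    Real.sqrt ((M.dagger μ).stepVar h (some x.1) x.2
                        ((M.dagger μ).value πstar h.succ) * iota S A H δ /
                      (n * M.occ μ h x.1 x.2)) +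
                Cres * (H : ℝ) ^ 3 *
                  Real.log (n * H * Fintype.card S * Fintype.card A / δ) ^ k /
                  (n * M.minOcc μ))} ≤ ENNReal.ofReal δ := by
  refine ⟨160, 11, 31000, by norm_num, by norm_num, by norm_num, 3, ?_⟩
  intro S A _ _ _ _ _ _ _ _ _ H hH M μ πstar hπ
  refine ⟨fun h s a => M.augment_occ_le _ πstar h s a, fun h s => ?_,
    fun h => M.augment_stateOcc_none _ πstar h, fun δ hδ hδ1 n hn => ?_⟩
  · exact (M.toModel.augment_value_le_value _ πstar h s).trans
      (M.toModel.value_le_optValue πstar.restrict h s)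
  -- A policy exists and its action probabilities sum to one, so there is an action.
  · have : Nonempty A := by
      obtain ⟨a, -, -⟩ := Finset.exists_ne_zero_of_sum_ne_zero
        ((πstar.prob_mem ⟨0, hH⟩ none).2.trans_ne one_ne_zero)
      exact ⟨a⟩
    exact MDP.dataLaw_suboptBound hH hπ hδ hδ1 hn
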